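/- Let $\mathbb S^2\subset\mathbb R^3$ be the unit sphere, with geodesic distance $d(x,y)=\arccos(x\cdot y)$, tangent bundle $T\mathbb S^2=\{[x;v]:\|x\|=1,\ x\cdot v=0\}$, surface gradient $\nabla_{\mathbb S^2}$ and surface curl $\nabla_{\mathbb S^2}\times$ (the gradient, respectively curl, at points of $\mathbb S^2$ of the extension $x\mapsto f(x/\|x\|)$). For probability measures $\mu,\nu$ on $\mathbb S^2$ put $W_2^2(\mu,\nu)=\inf_\pi\frac12\iint d(x,y)^2\,\pi(dx\,dy)$, the infimum being over couplings $\pi$ of $\mu$ and $\nu$. Let $\tau>0$, and consider solutions on $[0,\tau]$ of the frame equation $$\frac{d}{dt}\begin{bmatrix}V\\ X\\ X\times V\end{bmatrix}=\begin{bmatrix}g(X)\\ V\\ X\times g(X)\end{bmatrix}.$$ (i) Let the solution curve $X$ lie on $\mathbb S^2$ with $V\ne0$, let $s(t)=\int_0^t\|V\|\,du$ and $\dot s=\|V\|$, and let $\gamma(s(t))=X(t)$ be its reparametrization by arclength, which exists and is twice differentiable. With the unit normal $N=\gamma$, write $\kappa_n=\gamma''\cdot N$, $\kappa_g=\gamma''\cdot(N\times\gamma')$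 and $\kappa=\|\gamma''\|=\sqrt{\kappa_n^2+\kappa_g^2}$. Then $\kappa\neq 0$, the rows $\gamma',N,N\times\gamma'$ are orthonormal, and $$\begin{bmatrix}\gamma'\\ \gamma''/\kappa\\ \gamma'\times\gamma''/\kappa\end{bmatrix}=\begin{bmatrix}1&0&0\\0&\kappa_n/\kappa&\kappa_g/\kappa\\0&\kappa_g/\kappa&-\kappa_n/\kappa\end{bmatrix}\begin{bmatrix}\gamma'\\N\\N\times\gamma'\end{bmatrix},\qquad \kappa_n=-1,\qquad \kappa_g=-\frac{V\cdot(X\times g(X))}{\dot s^3}.$$ In (ii)-(iv) let $g(X)=-X-\nabla_{\mathbb S^2}\Theta_0(X)$ with $\Theta_0\in C^2(\mathbb S^2;\mathbb R)$. (ii) Extend $\nabla_{\mathbb S^2}\Theta_0$ to $\mathbb R^3\setminus\{0\}$ as the gradient of $x\mapsto\Theta_0(x/\|x\|)$, and let $[X;V]$ be a solution in $\mathbb R^3\setminus\{0\}$ with $[X(0);V(0)]\in T\mathbb S^2$. Then $X\cdot V=0$ on $[0,\tau]$ if and only if $\|V\|=1$ on $[0,\tau]$, if and only if $X$ stays on $\mathbb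 S^2$; in this case $|\kappa_g|=\|\nabla_{\mathbb S^2}\Theta_0(X)\|$. (iii) There is $h_0>0$, depending only on $\Theta_0$, with the following property. Let $h>0$, let $\tilde\rho_0$ be a probability measure on $T\mathbb S^2$, and for $\tilde\rho_0$-almost every $[x;v]$ let $[X(t);V(t)]\in T\mathbb S^2$, $t\in[0,h]$, be a solution of unit speed that starts at $[x;v]$. Let $\tilde\rho_h$ be induced from $\tilde\rho_0$ by $[x;v]\mapsto[X(h);V(h)]$, and let $\rho_0,\rho_h$ be the marginals of $\tilde\rho_0,\tilde\rho_h$ on $\mathbb S^2$. If $h\le2$, then the transport cost along the solution curves satisfies $$\int_{T\mathbb S^2}\int_0^h\bigl(\|\dot X\|^2+\|\ddot X\|^2\bigr)\,dt\,d\tilde\rho_0\ \ge\ 2W_2^2(\rho_0,\rho_h)+\int_0^h\int_{T\mathbb S^2}\|\nabla_{\mathbb S^2}\Theta_0(X(t))\|^2\,d\tilde\rho_0\,dt .$$ If $h\le h_0$, then the same lower bound holds for the cost $\int c([x;v],[X(h);V(h)])\,d\tilde\rho_0$ of the induced transport plan, where $c([x_0;v_0],[x_h;v_h])$ is the infimum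 of $\int_0^h(\|\dot\gamma\|^2+\|\ddot\gamma\|^2)\,dt$ over $C^4$ paths $\gamma:[0,h]\to\mathbb S^2$ from $x_0$ to $x_h$ with initial and final velocities $v_0$ and $v_h$. (iv) Let $U\subset\mathbb S^2$ be open, and for $x\in U$ let $X(x,\cdot)$ be a solution curve on $\mathbb S^2$ with $X(x,0)=x$ and with velocity $V(x,t)=v_t(X(x,t))$ given by an Eulerian velocity field $v_t$, where $X$ and $V$ are $C^1$ on $U\times[0,\tau]$ and each $v_t$ is $C^1$ on $X_t(U)$, $X_t=X(\cdot,t)$. Then the normal vorticity $\omega_t(y)=y\cdot(\nabla_{\mathbb S^2}\times v_t)(y)$ is invariant under the flow as a density: for $x\in U$, $t\in[0,\tau]$ and $a,b$ tangent to $\mathbb S^2$ at $x$, $$\omega_t(X_t(x))\;X_t(x)\cdot\bigl(D_aX_t(x)\times D_bX_t(x)\bigr)=\omega_0(x)\;x\cdot(a\times b),$$ and the circulation of $v_t$ along $X_t\circ\Gamma$ does not depend on $t$, for every closed $C^1$ curve $\Gamma$ in $U$. If moreover $v_0=\nabla_{\mathbb S^2}q_0$ on $U$ for some differentiable $q_0$,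 then for all $t\in[0,\tau]$, on $X_t(U)$: $\omega_t=0$, the vorticity is $\nabla_{\mathbb S^2}\times v_t=X\times v_t$, position, velocity and vorticity form the orthogonal frame $[X;V;X\times V]$, and $v_t=\nabla_{\mathbb S^2}q_t$ for some differentiable $q_t$. (v) Let $g$ be arbitrary, let $\rho_0$ be a probability measure on $\mathbb S^2$, and for $\rho_0$-almost every $x$ let $X(x,\cdot)$ be a solution curve on $\mathbb S^2$ with $X(x,0)=x$ and with $\|V(x,t)\|\le C$. If $X(\cdot,t)$ induces $\rho_t$ from $\rho_0$, then $t\mapsto\rho_t$ is a $2$-absolutely continuous path of probability measures: there is $M_2$ such that $\sum_jW_2^2(\rho_{b_j},\rho_{a_j})/(b_j-a_j)\le M_2$ for all sequences of pairwise disjoint subintervals $(a_j,b_j)$ of $[0,\tau]$. (vi) Let $g(X)=-X$. Every solution curve on $\mathbb S^2$ is the geodesic $X(t)=X(0)\cos t+V(0)\sin t$, and $d(X(s),X(t))=|t-s|$ when $|t-s|\le\pi$. If moreover, in the situation of (v), $q_0$ is differentiable at $x$ and $V(x,0)=\nabla_{\mathbb S^2}q_0(x)$ for $\rho_0$-almost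 every $x$, and if $T>0$ is such that $-Tq_0$ is $d^2/2$-concave, that is, $-Tq_0(x)=\inf_y\{d(x,y)^2/2-\Phi(y)\}$ for some $\Phi:\mathbb S^2\to\mathbb R$ and all $x$ (for instance $T=1$ if $-q_0$ is $d^2/2$-concave), then $t\mapsto\rho_t$ is a minimizing geodesic of constant speed for $W_2$ on $[0,\min(T,\tau)]$. -/

import Mathlib

open MeasureTheory Set
open scoped Manifold ContDiff RealInnerProductSpace ENNReal

namespace SphereFlow

/-- Euclidean three-space. -/
abbrev E3 : Type := EuclideanSpace ℝ (Fin 3)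

/-- The unit sphere of Euclidean three-space. -/
abbrev S2 : Type := Metric.sphere (0 : E3) 1

/-- The cross product on Euclidean three-space. -/
noncomputable def cross (a b : E3) : E3 :=
  WithLp.toLp 2 (crossProduct (WithLp.ofLp a) (WithLp.ofLp b))

/-- The matrix whose rows are the three given vectors. -/
def frame (a b c : E3) : Matrix (Fin 3) (Fin 3) ℝ :=
  Matrix.of ![WithLp.ofLp a, WithLp.ofLp b, WithLp.ofLp c]

theorem norm_inv_smul_mem {x : E3} (hx : x ≠ 0) :
    ‖x‖⁻¹ • x ∈ Metric.sphere (0 : E3) 1 := by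
  rw [mem_sphere_zero_iff_norm, norm_smul, norm_inv, norm_norm,
    inv_mul_cancel₀ (norm_ne_zero_iff.mpr hx)]

open Classical in
/-- The extension of a function on the sphere that is constant on open half-lines from the
origin: `x ↦ f (x / |x|)`. Its ordinary derivative at a point of the sphere is the derivative
of `f` along tangent vectors, and vanishes in the normal direction. -/
noncomputable def ext {F : Type*} [Zero F] (f : S2 → F) (x : E3) : F :=
  if hx : x = 0 then 0 else f ⟨‖x‖⁻¹ • x, norm_inv_smul_mem hx⟩

/-- The surface gradient `∇_{S²} f`, as a vector of the ambient space. -/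
noncomputable def sgrad (f : S2 → ℝ) (x : E3) : E3 := gradient (ext f) x

/-- The surface curl `∇_{S²} × v = ∑ᵢ eᵢ × ∂ᵢ v` of a vector field along the sphere, where
`∂ᵢ` are the components of `∇_{S²}`. -/
noncomputable def scurl (v : S2 → E3) (x : S2) : E3 :=
  ∑ i : Fin 3, cross (EuclideanSpace.single i 1)
    (fderiv ℝ (ext v) (x : E3) (EuclideanSpace.single i 1))

/-- The normal part `X · (∇_{S²} × v)` of the vorticity. -/
noncomputable def normalVorticity (v : S2 → E3) (x : S2) : ℝ := ⟪(x : E3), scurl v x⟫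

/-- The derivative of a map from the sphere to itself, in the direction of a tangent
vector `a` at `x`. -/
noncomputable def dirDeriv (F : S2 → S2) (x : S2) (a : E3) : E3 :=
  fderiv ℝ (ext (fun y => (F y : E3))) (x : E3) a

/-- The circulation of the vector field `v` along the closed curve `c` on `[0, 1]`. -/
noncomputable def circulation (v : S2 → E3) (c : ℝ → S2) : ℝ :=
  ∫ s in (0 : ℝ)..1, ⟪v (c s), deriv (fun r => (c r : E3)) s⟫

/-- `[V; X; X × V]` solves `d/dt [V; X; X × V] = [g(X); V; X × g(X)]` on `[0, τ]`. -/
structure IsFrameSolution (g : E3 → E3) (τ : ℝ) (X V : ℝ → E3) : Prop where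
  velocity : ∀ t ∈ Icc 0 τ, HasDerivWithinAt V (g (X t)) (Icc 0 τ) t
  position : ∀ t ∈ Icc 0 τ, HasDerivWithinAt X (V t) (Icc 0 τ) t
  binormal : ∀ t ∈ Icc 0 τ,
    HasDerivWithinAt (fun s => cross (X s) (V s)) (cross (X t) (g (X t))) (Icc 0 τ) t

/-- The field `g(X) = -X - ∇_{S²} Θ(X)`. -/
noncomputable def gField (Θ : S2 → ℝ) (x : E3) : E3 := -x - sgrad Θ x

/-- The arclength `s(t) = ∫₀ᵗ |V(u)| du`. -/
noncomputable def arclength (V : ℝ → E3) (t : ℝ) : ℝ := ∫ u in (0 : ℝ)..t, ‖V u‖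

/-- `γ` is the reparametrization by arclength of the curve `X` with velocity `V` on `[0, τ]`,
and `γ₁`, `γ₂` are its first two derivatives. -/
structure IsArclengthParam (τ : ℝ) (X V γ γ₁ γ₂ : ℝ → E3) : Prop where
  eq : ∀ t ∈ Icc 0 τ, γ (arclength V t) = X t
  deriv₁ : ∀ s ∈ Icc 0 (arclength V τ), HasDerivWithinAt γ (γ₁ s) (Icc 0 (arclength V τ)) s
  deriv₂ : ∀ s ∈ Icc 0 (arclength V τ), HasDerivWithinAt γ₁ (γ₂ s) (Icc 0 (arclength V τ)) s

/-- Normal curvature of a unit speed curve on a surface with unit normal `N`: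
the component of the acceleration `A` along `N`. -/
noncomputable def normalCurvature (A N : E3) : ℝ := ⟪A, N⟫

/-- Geodesic curvature of a unit speed curve on a surface with unit normal `N`:
the component of the acceleration `A` along `N × T`, where `T` is the velocity. -/
noncomputable def geodesicCurvature (T A N : E3) : ℝ := ⟪A, cross N T⟫

/-- The matrix `R` that takes `F = [γ'; N; N × γ']` to the Serret-Frenet frame, in terms of
the normal and geodesic curvatures; here `κ = √(κₙ² + κ_g²)`. -/
noncomputable def frenetMatrix (κn κg : ℝ) : Matrix (Fin 3) (Fin 3) ℝ :=
  !![1, 0, 0;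
     0, κn / √(κn ^ 2 + κg ^ 2), κg / √(κn ^ 2 + κg ^ 2);
     0, κg / √(κn ^ 2 + κg ^ 2), -κn / √(κn ^ 2 + κg ^ 2)]

/-- The geodesic distance on the unit sphere. -/
noncomputable def sdist (x y : S2) : ℝ := Real.arccos ⟪(x : E3), (y : E3)⟫

/-- The Wasserstein distance `W₂` on the sphere for the cost `d(x,y)² / 2`. -/
noncomputable def W2 (μ ν : Measure S2) : ℝ :=
  √(sInf {c : ℝ | ∃ π : Measure (S2 × S2), π.map Prod.fst = μ ∧ π.map Prod.snd = ν ∧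
    c = ∫ p, sdist p.1 p.2 ^ 2 / 2 ∂π})

/-- A path `[0, τ] → W²(S²)` is `2`-absolutely continuous: the sums
`∑ W₂(ρ_b, ρ_a)² / (b - a)` over sequences of disjoint subintervals are bounded. -/
def IsTwoAbsolutelyContinuous (τ : ℝ) (ρ : ℝ → Measure S2) : Prop :=
  ∃ M : ℝ, ∀ a b : ℕ → ℝ, (∀ j, 0 ≤ a j ∧ a j < b j ∧ b j ≤ τ) →
    Pairwise (fun i j => Disjoint (Ioo (a i) (b i)) (Ioo (a j) (b j))) →
    Summable (fun j => W2 (ρ (b j)) (ρ (a j)) ^ 2 / (b j - a j)) ∧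
      ∑' j, W2 (ρ (b j)) (ρ (a j)) ^ 2 / (b j - a j) ≤ M

/-- A path `[0, T] → W²(S²)` is a (minimizing, constant speed) geodesic. -/
def IsWassersteinGeodesic (T : ℝ) (ρ : ℝ → Measure S2) : Prop :=
  ∀ s ∈ Icc 0 T, ∀ t ∈ Icc 0 T, W2 (ρ s) (ρ t) = |t - s| / T * W2 (ρ 0) (ρ T)

/-- `ψ` is `d²/2`-concave: `ψ(x) = inf_y (d(x,y)²/2 - Φ(y))` for some `Φ`. -/
def IsCostConcave (ψ : S2 → ℝ) : Prop :=
  ∃ Φ : S2 → ℝ, ∀ x, IsGLB (range fun y => sdist x y ^ 2 / 2 - Φ y) (ψ x)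

/-- The tangent bundle of the sphere, as a subspace of `ℝ³ × ℝ³`. -/
abbrev TS2 : Type := {p : E3 × E3 // ‖p.1‖ = 1 ∧ ⟪p.1, p.2⟫ = 0}

/-- The canonical projection of the tangent bundle. -/
def TS2.proj (p : TS2) : S2 := ⟨p.1.1, mem_sphere_zero_iff_norm.mpr p.2.1⟩

/-- The action `∫₀ʰ (|γ'|² + |γ''|²) dt` of a curve `γ` on `[0, h]`. -/
noncomputable def action (h : ℝ) (γ : ℝ → E3) : ℝ≥0∞ :=
  ∫⁻ t in Icc 0 h, (‖derivWithin γ (Icc 0 h) t‖ₑ ^ 2 +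
    ‖derivWithin (derivWithin γ (Icc 0 h)) (Icc 0 h) t‖ₑ ^ 2)

/-- The cost `c` on the tangent bundle: the least action of a `C⁴` path on the sphere with
given initial and final positions and velocities. -/
noncomputable def tangentCost (h : ℝ) (p q : TS2) : ℝ≥0∞ :=
  ⨅ (γ : ℝ → E3) (_ : ContDiffOn ℝ 4 γ (Icc 0 h) ∧ (∀ t ∈ Icc 0 h, ‖γ t‖ = 1) ∧
    γ 0 = p.1.1 ∧ derivWithin γ (Icc 0 h) 0 = p.1.2 ∧
    γ h = q.1.1 ∧ derivWithin γ (Icc 0 h) h = q.1.2), action h γ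

end SphereFlow

open SphereFlow

/-! Two facts about `g(X) = -X - ∇Θ(X)` carry most of the argument. A radially constant extension
has a gradient orthogonal to the position (`fderiv_ext_self`), so `X · g(X) = -|X|²`. Moreover `g`
is minus the gradient of `|x|²/2 + Θ(x/|x|)`, so its derivative is symmetric
(`inner_fderiv_gField_symm`).

Curvatures: differentiating `|γ'|² = 1`, `X · γ' = 0` and `|V| γ' = V` in time gives every component
of `γ''` (`IsArclengthParam.frenet`). At unit speed, `|X|² - 1` and `X · V` form a harmonic
oscillator with zero initial data, which keeps `X` on the sphere.

Transport cost: on the sphere the acceleration has squared norm `1 + |∇Θ|²`, so a solution has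
action `2h + ∫ |∇Θ|²`, while `2 W₂² ≤ h²`. For a competitor `γ`, use `|γ''|² ≥ 2 a · γ'' - |a|²`
with `a = g(X(0))`. Equal end velocities mean that `γ''` and `g(X)` have the same integral, and on
short time intervals the error `|g(X) - a|²` uses up only half of the surplus `h`
(`le_action_of_competitor`).

Vorticity: the velocity, viewed as a one-form and pulled back by the flow, changes by the
differential of the time integral of `Θ` along trajectories (`hasFDerivAt_phase`). This gives the
invariance of circulation and the persistence of potentials. The pulled-back exterior derivative is
constant because `Dg` is symmetric (`curl_pullback_eq`). Since the velocity is a function of the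
position, backward uniqueness for the flow and its linearization makes the flow map injective with
invertible tangent map, so these facts can be pushed forward to time `t`.

Wasserstein paths: coupling positions at two times along trajectories bounds `W₂` from above by the
distance travelled. For `g(X) = -X` the curves are great circles, and the matching lower bound is
Kantorovich duality with Hopf-Lax potentials (`exists_intermediate_potentials`). The contact point
of the concave potential at `x` is forced to be the end of the great circle of length `T` that
starts along `∇q₀(x)` (`contact_point_eq_exp`). -/

namespace SphereFlow

open Filter Topology

section

/-! ### The cross product and orthonormal frames -/

theorem inner_eq_sum (a b : E3) : ⟪a, b⟫ = a 0 * b 0 + a 1 * b 1 + a 2 * b 2 := by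
  simp [PiLp.inner_apply, Fin.sum_univ_three, mul_comm]

@[simp] theorem cross_apply_zero (a b : E3) : cross a b 0 = a 1 * b 2 - a 2 * b 1 := by
  simp [cross, cross_apply]

@[simp] theorem cross_apply_one (a b : E3) : cross a b 1 = a 2 * b 0 - a 0 * b 2 := by
  simp [cross, cross_apply]

@[simp] theorem cross_apply_two (a b : E3) : cross a b 2 = a 0 * b 1 - a 1 * b 0 := by
  simp [cross, cross_apply]

theorem ext_coord {a b : E3} (h0 : a 0 = b 0) (h1 : a 1 = b 1) (h2 : a 2 = b 2) : a = b := by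
  ext i
  fin_cases i <;> assumption

theorem inner_self_cross (a b : E3) : ⟪a, cross a b⟫ = 0 := by
  simp only [inner_eq_sum, cross_apply_zero, cross_apply_one, cross_apply_two]; ring

theorem inner_cross_self (a b : E3) : ⟪b, cross a b⟫ = 0 := by
  simp only [inner_eq_sum, cross_apply_zero, cross_apply_one, cross_apply_two]; ring

theorem inner_cross_rotate (a b c : E3) : ⟪a, cross b c⟫ = ⟪b, cross c a⟫ := by
  simp only [inner_eq_sum, cross_apply_zero, cross_apply_one, cross_apply_two]; ring

theorem inner_cross_swap (a b c : E3) : ⟪a, cross b c⟫ = -⟪a, cross c b⟫ := by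
  simp only [inner_eq_sum, cross_apply_zero, cross_apply_one, cross_apply_two]; ring

theorem inner_cross_cross (a b c d : E3) :
    ⟪cross a b, cross c d⟫ = ⟪a, c⟫ * ⟪b, d⟫ - ⟪a, d⟫ * ⟪b, c⟫ := by
  simp only [inner_eq_sum, cross_apply_zero, cross_apply_one, cross_apply_two]; ring

theorem cross_add_right (a b c : E3) : cross a (b + c) = cross a b + cross a c := by
  simp [cross]

theorem cross_smul_right (a b : E3) (r : ℝ) : cross a (r • b) = r • cross a b := by
  simp [cross]

theorem cross_neg_right (a b : E3) : cross a (-b) = -cross a b := by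
  rw [← neg_one_smul ℝ b, cross_smul_right, neg_one_smul]

theorem cross_self_eq_zero (a : E3) : cross a a = 0 := by
  simp [cross]

theorem cross_cross_eq (a b c : E3) : cross a (cross b c) = ⟪a, c⟫ • b - ⟪a, b⟫ • c := by
  apply ext_coord <;>
    simp only [inner_eq_sum, cross_apply_zero, cross_apply_one, cross_apply_two, PiLp.sub_apply,
      PiLp.smul_apply, smul_eq_mul] <;> ring

theorem cross_anticomm_eq (a b : E3) : cross b a = -cross a b := by
  apply ext_coord <;>
    simp only [cross_apply_zero, cross_apply_one, cross_apply_two, PiLp.neg_apply] <;> ring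

/-- Expansion of a vector in the orthonormal frame `n, u, n × u`. -/
theorem eq_frame_expansion {n u : E3} (hn : ⟪n, n⟫ = 1) (hu : ⟪u, u⟫ = 1) (hnu : ⟪n, u⟫ = 0)
    (a : E3) : a = ⟪a, u⟫ • u + ⟪a, n⟫ • n + ⟪a, cross n u⟫ • cross n u := by
  have h1 : cross (cross n u) (cross (cross n u) a) = ⟪cross n u, a⟫ • cross n u - a := by
    rw [cross_cross_eq, inner_cross_cross, hn, hu, hnu]; simp
  have h2 : cross (cross n u) a = ⟪a, n⟫ • u - ⟪a, u⟫ • n := by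
    rw [cross_anticomm_eq a, cross_cross_eq]; abel
  have h3 : cross (cross n u) u = -n := by
    rw [cross_anticomm_eq u, cross_cross_eq, hu, real_inner_comm, hnu]; simp
  have h4 : cross (cross n u) n = u := by
    rw [cross_anticomm_eq n, cross_cross_eq, hn, hnu]; simp
  rw [h2, sub_eq_add_neg, cross_add_right, cross_neg_right, cross_smul_right, cross_smul_right,
    h3, h4] at h1
  rw [real_inner_comm a (cross n u)] at h1
  have h5 : a = ⟪a, cross n u⟫ • cross n u - (⟪a, n⟫ • -n + -(⟪a, u⟫ • u)) := by
    rw [h1]; abel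
  nth_rw 1 [h5]
  rw [smul_neg]; abel

theorem inner_self_eq_frame {n u : E3} (hn : ⟪n, n⟫ = 1) (hu : ⟪u, u⟫ = 1) (hnu : ⟪n, u⟫ = 0)
    (a : E3) : ⟪a, a⟫ = ⟪a, u⟫ ^ 2 + ⟪a, n⟫ ^ 2 + ⟪a, cross n u⟫ ^ 2 := by
  nth_rw 2 [eq_frame_expansion hn hu hnu a]
  simp only [inner_add_right, inner_smul_right]; ring

theorem frame_mul_transpose (a b c : E3) : frame a b c * (frame a b c).transpose =
    !![⟪a, a⟫, ⟪a, b⟫, ⟪a, c⟫; ⟪b, a⟫, ⟪b, b⟫, ⟪b, c⟫; ⟪c, a⟫, ⟪c, b⟫, ⟪c, c⟫] := by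
  ext i j
  fin_cases i <;> fin_cases j <;>
    simp [frame, Matrix.mul_apply, Fin.sum_univ_three, inner_eq_sum,
      -inner_self_eq_norm_sq_to_K]

theorem frame_mem_orthogonalGroup {a b c : E3} (haa : ⟪a, a⟫ = 1) (hbb : ⟪b, b⟫ = 1)
    (hcc : ⟪c, c⟫ = 1) (hab : ⟪a, b⟫ = 0) (hac : ⟪a, c⟫ = 0) (hbc : ⟪b, c⟫ = 0) :
    frame a b c ∈ Matrix.orthogonalGroup (Fin 3) ℝ := by
  rw [Matrix.mem_orthogonalGroup_iff, frame_mul_transpose, haa, hbb, hcc,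
    real_inner_comm a b, real_inner_comm a c, real_inner_comm b c, hab, hac, hbc]
  ext i j
  fin_cases i <;> fin_cases j <;> simp

/-! ### Radial extension of functions on the sphere -/

/-- Provides the junk value of `nrm` at the origin. -/
noncomputable instance : Inhabited S2 :=
  ⟨⟨EuclideanSpace.single 0 1, by simp⟩⟩

open Classical in
/-- The radial projection `x ↦ x / |x|` onto the sphere, with a default value at the origin. -/
noncomputable def nrm (x : E3) : S2 :=
  if hx : x = 0 then default else ⟨‖x‖⁻¹ • x, norm_inv_smul_mem hx⟩

theorem coe_nrm {x : E3} (hx : x ≠ 0) : (nrm x : E3) = ‖x‖⁻¹ • x := by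
  simp [nrm, hx]

theorem norm_coe (x : S2) : ‖(x : E3)‖ = 1 := mem_sphere_zero_iff_norm.mp x.2

theorem inner_coe_self (x : S2) : ⟪(x : E3), (x : E3)⟫ = 1 := by
  rw [real_inner_self_eq_norm_sq, norm_coe, one_pow]

theorem coe_ne_zero (x : S2) : (x : E3) ≠ 0 := by
  intro h
  have := norm_coe x
  rw [h, norm_zero] at this
  exact zero_ne_one this

@[simp] theorem nrm_coe (x : S2) : nrm (x : E3) = x := by
  apply Subtype.ext
  rw [coe_nrm (coe_ne_zero x), norm_coe, inv_one, one_smul]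

theorem nrm_smul {c : ℝ} (hc : 0 < c) (x : E3) (hx : x ≠ 0) : nrm (c • x) = nrm x := by
  apply Subtype.ext
  rw [coe_nrm hx, coe_nrm (smul_ne_zero hc.ne' hx), norm_smul, Real.norm_of_nonneg hc.le, smul_smul]
  congr 1
  field_simp

theorem ext_eq {F : Type*} [Zero F] {f : S2 → F} {x : E3} (hx : x ≠ 0) : ext f x = f (nrm x) := by
  simp [ext, nrm, hx]

@[simp] theorem ext_coe {F : Type*} [Zero F] (f : S2 → F) (x : S2) : ext f x = f x := by
  rw [ext_eq (coe_ne_zero x), nrm_coe]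

theorem ext_smul {F : Type*} [Zero F] {f : S2 → F} {c : ℝ} (hc : 0 < c) (x : E3) : ext f (c • x) = ext f x := by
  by_cases hx : x = 0
  · simp [hx]
  · rw [ext_eq hx, ext_eq (smul_ne_zero hc.ne' hx), nrm_smul hc x hx]

variable {F : Type*} [NormedAddCommGroup F] [NormedSpace ℝ F]

/-- The cone over a subset of the sphere, without its vertex. -/
def cone (s : Set S2) : Set E3 := {x | x ≠ 0 ∧ nrm x ∈ s}

theorem coe_mem_cone {s : Set S2} {x : S2} : (x : E3) ∈ cone s ↔ x ∈ s := by
  simp [cone, coe_ne_zero]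

theorem cone_univ : cone univ = {0}ᶜ := by
  ext; simp [cone]

/-- The ambient formula `x/|x|` is analytic off the origin, and in each chart it is followed by the
ambient formula for stereographic projection, analytic off the pole. All passage between the
manifold structure of the sphere and calculus in space goes through this map. -/
theorem contMDiffOn_nrm : ContMDiffOn 𝓘(ℝ, E3) (𝓡 2) ω nrm {0}ᶜ := by
  have hc : ContDiffOn ℝ ω (fun x : E3 => ‖x‖⁻¹ • x) {0}ᶜ := by
    intro x hx
    have hx : x ≠ 0 := hx
    exact (((contDiffAt_norm ℝ hx).inv (norm_ne_zero_iff.mpr hx)).smul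
      contDiffAt_id).contDiffWithinAt
  have : Fact (Module.finrank ℝ E3 = 2 + 1) := Fact.mk (@finrank_euclideanSpace_fin ℝ _ 3)
  have hcoe : ContDiffOn ℝ ω (fun x : E3 => (nrm x : E3)) {0}ᶜ :=
    hc.congr fun x hx => coe_nrm hx
  rw [contMDiffOn_iff_target]
  refine ⟨?_, ?_⟩
  · rw [Topology.IsInducing.subtypeVal.continuousOn_iff]
    exact hcoe.continuousOn
  intro v
  let U : _ ≃ₗᵢ[ℝ] _ :=
    (OrthonormalBasis.fromOrthogonalSpanSingleton (E := E3) 2 (ne_zero_of_mem_unit_sphere (-v))).repr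
  have h : ContDiffOn ℝ ω _ Set.univ := U.contDiff.contDiffOn
  have H₁ := (h.comp_inter contDiffOn_stereoToFun).contMDiffOn
  have H₂ := hcoe.contMDiffOn
  convert! (H₁.of_le le_top).comp' H₂ using 1
  ext x
  -- The chart at `v` projects from the pole `-v`; this matches its domain with the condition on the
  -- inner product under which the ambient formula is smooth.
  have hfxv : (nrm x : E3) = -↑v ↔ ⟪(nrm x : E3), -↑v⟫ = 1 := by
    rw [inner_eq_one_iff_of_norm_eq_one (norm_coe _)]
    exact norm_eq_of_mem_sphere (-v)
  simp [chartAt, ChartedSpace.chartAt, Subtype.ext_iff, hfxv, real_inner_comm]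

theorem continuousOn_nrm : ContinuousOn nrm {0}ᶜ := contMDiffOn_nrm.continuousOn

theorem isOpen_cone {s : Set S2} (hs : IsOpen s) : IsOpen (cone s) :=
  continuousOn_nrm.isOpen_inter_preimage isOpen_compl_singleton hs

theorem contDiffOn_ext {n : ℕ∞ω} {f : S2 → F} {s : Set S2}
    (hf : ContMDiffOn (𝓡 2) 𝓘(ℝ, F) n f s) : ContDiffOn ℝ n (ext f) (cone s) := by
  have h := hf.comp ((contMDiffOn_nrm.mono (fun x hx => hx.1)).of_le le_top)
    (fun x (hx : x ∈ cone s) => hx.2)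
  exact (contMDiffOn_iff_contDiffOn.mp h).congr fun x hx => ext_eq hx.1

theorem differentiableAt_ext {f : S2 → F} {x : S2}
    (hf : MDifferentiableAt (𝓡 2) 𝓘(ℝ, F) f x) : DifferentiableAt ℝ (ext f) x := by
  have h0 : {0}ᶜ ∈ 𝓝 (x : E3) := isOpen_compl_singleton.mem_nhds (coe_ne_zero x)
  have hn : MDifferentiableAt 𝓘(ℝ, E3) (𝓡 2) nrm (x : E3) :=
    ((contMDiffOn_nrm.contMDiffAt h0).mdifferentiableAt (by simp))
  have h := MDifferentiableAt.comp (x : E3) (by rwa [nrm_coe]) hn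
  refine (mdifferentiableAt_iff_differentiableAt.mp h).congr_of_eventuallyEq ?_
  filter_upwards [h0] with y hy using ext_eq hy

theorem mdifferentiableAt_of_ext {f : S2 → F} {x : S2}
    (hf : DifferentiableAt ℝ (ext f) x) : MDifferentiableAt (𝓡 2) 𝓘(ℝ, F) f x := by
  have : Fact (Module.finrank ℝ E3 = 2 + 1) := Fact.mk (@finrank_euclideanSpace_fin ℝ _ 3)
  have hcoe : MDifferentiableAt (𝓡 2) 𝓘(ℝ, E3) (fun y : S2 => (y : E3)) x :=
    ((contMDiff_coe_sphere (E := E3) (n := 2) (m := 1)) x).mdifferentiableAt (by simp)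
  have h := MDifferentiableAt.comp x hf.mdifferentiableAt hcoe
  have he : (ext f ∘ fun y : S2 => (y : E3)) = f := by
    funext y; simp
  rwa [he] at h

/-! ### The surface gradient -/

/-- Euler's identity for a function homogeneous of degree zero. Where `ext f` is not differentiable,
`fderiv` is zero by convention, so surface gradients are tangent without any regularity. -/
theorem fderiv_ext_self (f : S2 → F) (x : E3) : fderiv ℝ (ext f) x x = 0 := by
  by_cases hf : DifferentiableAt ℝ (ext f) x
  · have hl : HasDerivAt (fun r : ℝ => r • x) x 1 := by
      simpa using (hasDerivAt_id (1 : ℝ)).smul_const x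
    have hf' : HasFDerivAt (ext f) (fderiv ℝ (ext f) x) ((1 : ℝ) • x) := by
      rw [one_smul]; exact hf.hasFDerivAt
    have h1 := hf'.comp_hasDerivAt (1 : ℝ) hl
    have h2 : HasDerivAt (ext f ∘ fun r : ℝ => r • x) 0 1 := by
      refine (hasDerivAt_const (1 : ℝ) (ext f x)).congr_of_eventuallyEq ?_
      filter_upwards [lt_mem_nhds (zero_lt_one (α := ℝ))] with r hr using ext_smul hr x
    exact h1.unique h2
  · rw [fderiv_zero_of_not_differentiableAt hf]; rfl

theorem inner_sgrad {f : S2 → ℝ} {x : E3} (h : E3) : ⟪sgrad f x, h⟫ = fderiv ℝ (ext f) x h := by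
  simp [sgrad, gradient]

theorem inner_sgrad_self (f : S2 → ℝ) (x : E3) : ⟪x, sgrad f x⟫ = 0 := by
  rw [real_inner_comm, inner_sgrad, fderiv_ext_self]

theorem contDiffOn_sgrad {Θ : S2 → ℝ} (hΘ : ContMDiff (𝓡 2) 𝓘(ℝ, ℝ) 2 Θ) :
    ContDiffOn ℝ 1 (sgrad Θ) {0}ᶜ := by
  have h : ContDiffOn ℝ 2 (ext Θ) {0}ᶜ := by
    rw [← cone_univ]; exact contDiffOn_ext hΘ.contMDiffOn
  have h1 : ContDiffOn ℝ 1 (fderiv ℝ (ext Θ)) {0}ᶜ :=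
    h.fderiv_of_isOpen isOpen_compl_singleton (by norm_num)
  exact ((InnerProductSpace.toDual ℝ E3).symm.toContinuousLinearEquiv.contDiff).comp_contDiffOn h1

theorem differentiableAt_ext_of_contMDiff {Θ : S2 → ℝ} (hΘ : ContMDiff (𝓡 2) 𝓘(ℝ, ℝ) 2 Θ)
    {x : E3} (hx : x ≠ 0) : DifferentiableAt ℝ (ext Θ) x := by
  have h : ContDiffOn ℝ 2 (ext Θ) {0}ᶜ := by
    rw [← cone_univ]; exact contDiffOn_ext hΘ.contMDiffOn
  exact (h.contDiffAt (isOpen_compl_singleton.mem_nhds hx)).differentiableAt (by norm_num)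

theorem contDiffOn_gField {Θ : S2 → ℝ} (hΘ : ContMDiff (𝓡 2) 𝓘(ℝ, ℝ) 2 Θ) :
    ContDiffOn ℝ 1 (gField Θ) {0}ᶜ :=
  contDiff_neg.contDiffOn.sub (contDiffOn_sgrad hΘ)

/-- The derivative of `-X - ∇Θ(X)` is a symmetric operator, being minus the identity minus a
Hessian. -/
theorem inner_fderiv_gField_symm {Θ : S2 → ℝ} (hΘ : ContMDiff (𝓡 2) 𝓘(ℝ, ℝ) 2 Θ)
    {x : E3} (hx : x ≠ 0) (a b : E3) :
    ⟪fderiv ℝ (gField Θ) x a, b⟫ = ⟪fderiv ℝ (gField Θ) x b, a⟫ := by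
  have h0 : {0}ᶜ ∈ 𝓝 x := isOpen_compl_singleton.mem_nhds hx
  have h : ContDiffOn ℝ 2 (ext Θ) {0}ᶜ := by
    rw [← cone_univ]; exact contDiffOn_ext hΘ.contMDiffOn
  have h1 : ContDiffOn ℝ 1 (fderiv ℝ (ext Θ)) {0}ᶜ :=
    h.fderiv_of_isOpen isOpen_compl_singleton (by norm_num)
  have h2 : DifferentiableAt ℝ (fderiv ℝ (ext Θ)) x :=
    (h1.contDiffAt h0).differentiableAt (by norm_num)
  have hs : DifferentiableAt ℝ (sgrad Θ) x :=
    ((contDiffOn_sgrad hΘ).contDiffAt h0).differentiableAt (by norm_num)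
  have hsym := second_derivative_symmetric_of_eventually (f := ext Θ) (x := x)
    (by filter_upwards [h0] with y hy using (differentiableAt_ext_of_contMDiff hΘ hy).hasFDerivAt)
    h2.hasFDerivAt a b
  have hg : ∀ c d, ⟪fderiv ℝ (sgrad Θ) x c, d⟫ = fderiv ℝ (fderiv ℝ (ext Θ)) x c d := by
    intro c d
    have e1 : HasFDerivAt (fun y => ⟪sgrad Θ y, d⟫) _ x :=
      hs.hasFDerivAt.inner ℝ (hasFDerivAt_const d x)
    have e2 : HasFDerivAt (fun y => fderiv ℝ (ext Θ) y d) _ x :=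
      h2.hasFDerivAt.clm_apply (hasFDerivAt_const d x)
    simp only [inner_sgrad] at e1
    have e3 := congrArg (fun L : E3 →L[ℝ] ℝ => L c) (e1.unique e2)
    simpa using e3
  have hf : ∀ c, fderiv ℝ (gField Θ) x c = -c - fderiv ℝ (sgrad Θ) x c := by
    intro c
    have e : HasFDerivAt (gField Θ) (-ContinuousLinearMap.id ℝ E3 - fderiv ℝ (sgrad Θ) x) x :=
      (hasFDerivAt_id x).neg.sub hs.hasFDerivAt
    rw [e.fderiv]; rfl
  rw [hf, hf, inner_sub_left, inner_sub_left, hg, hg, hsym, inner_neg_left, inner_neg_left,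
    real_inner_comm]

end

/-! ### Calculus on a compact interval -/

section Interval

variable {F : Type*} [NormedAddCommGroup F] [NormedSpace ℝ F] {τ : ℝ}

theorem eq_of_hasDerivWithinAt_zero {f : ℝ → F}
    (hf : ∀ t ∈ Icc 0 τ, HasDerivWithinAt f 0 (Icc 0 τ) t) : ∀ t ∈ Icc 0 τ, f t = f 0 :=
  constant_of_has_deriv_right_zero (fun t ht => (hf t ht).continuousWithinAt) fun t ht =>
    (hf t (Ico_subset_Icc_self ht)).mono_of_mem_nhdsWithin (Icc_mem_nhdsGE_of_mem ht)

theorem eq_of_hasDerivWithinAt_eq {f g f' : ℝ → F}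
    (hf : ∀ t ∈ Icc 0 τ, HasDerivWithinAt f (f' t) (Icc 0 τ) t)
    (hg : ∀ t ∈ Icc 0 τ, HasDerivWithinAt g (f' t) (Icc 0 τ) t) (h0 : f 0 = g 0) :
    ∀ t ∈ Icc 0 τ, f t = g t := by
  intro t ht
  have h := eq_of_hasDerivWithinAt_zero (f := fun t => f t - g t)
    (fun t ht => by simpa using! (hf t ht).sub (hg t ht)) t ht
  simpa [h0, sub_eq_zero] using h

theorem hasDerivWithinAt_Icc_unique (hτ : 0 < τ) {f : ℝ → F} {a b : F} {t : ℝ}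
    (ht : t ∈ Icc 0 τ) (ha : HasDerivWithinAt f a (Icc 0 τ) t)
    (hb : HasDerivWithinAt f b (Icc 0 τ) t) : a = b :=
  (uniqueDiffOn_Icc hτ t ht).eq_deriv _ ha hb

theorem hasDerivWithinAt_Icc_of_eqOn (hτ : 0 < τ) {f g : ℝ → F} {a b : F} {t : ℝ}
    (ht : t ∈ Icc 0 τ) (hfg : EqOn f g (Icc 0 τ)) (ha : HasDerivWithinAt f a (Icc 0 τ) t)
    (hb : HasDerivWithinAt g b (Icc 0 τ) t) : a = b :=
  hasDerivWithinAt_Icc_unique hτ ht ha (hb.congr hfg (hfg ht))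

/-- A function that vanishes at `T` and whose derivative is dominated by the function itself
vanishes on `[0, T]`. -/
theorem eq_zero_of_norm_deriv_le {f f' : ℝ → F} {K T : ℝ} (hT : T ∈ Icc 0 τ)
    (hf : ∀ t ∈ Icc 0 τ, HasDerivWithinAt f (f' t) (Icc 0 τ) t)
    (hb : ∀ t ∈ Icc 0 τ, ‖f' t‖ ≤ K * ‖f t‖) (h0 : f T = 0) : ∀ t ∈ Icc 0 T, f t = 0 := by
  have hmem : ∀ u ∈ Icc 0 T, T - u ∈ Icc 0 τ := fun u hu =>
    ⟨by linarith [hu.2], by linarith [hu.1, hT.2]⟩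
  -- Reversing time turns the final condition at `T` into an initial one, to which Grönwall's
  -- inequality applies.
  have hd : ∀ u ∈ Icc 0 T, HasDerivWithinAt (fun u => f (T - u)) (-f' (T - u)) (Icc 0 T) u := by
    intro u hu
    have h1 : HasDerivWithinAt (fun u => T - u) (-1) (Icc 0 T) u := by
      simpa using (hasDerivWithinAt_id u (Icc 0 T)).const_sub T
    simpa using! (hf _ (hmem u hu)).scomp u h1 (fun v hv => hmem v hv)
  have h := eq_zero_of_abs_deriv_le_mul_abs_self_of_eq_zero_right (K := K)
    (fun u hu => (hd u hu).continuousWithinAt)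
    (fun u hu => (hd u (Ico_subset_Icc_self hu)).mono_of_mem_nhdsWithin (Icc_mem_nhdsGE_of_mem hu))
    (by simpa using h0)
    (fun u hu => by simpa using hb _ (hmem u (Ico_subset_Icc_self hu)))
  intro t ht
  simpa using h (T - t) ⟨by linarith [ht.2], by linarith [ht.1]⟩

end Interval

/-! ### Solution curves on the sphere -/

namespace IsFrameSolution

variable {g : E3 → E3} {τ : ℝ} {X V : ℝ → E3}

theorem hasDerivWithinAt_inner_self (hs : IsFrameSolution g τ X V) {t : ℝ} (ht : t ∈ Icc 0 τ) :
    HasDerivWithinAt (fun s => ⟪X s, X s⟫) (2 * ⟪X t, V t⟫) (Icc 0 τ) t := by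
  have h := (hs.position t ht).inner ℝ (hs.position t ht)
  rwa [real_inner_comm (X t) (V t), ← two_mul] at h

theorem hasDerivWithinAt_inner (hs : IsFrameSolution g τ X V) {t : ℝ} (ht : t ∈ Icc 0 τ) :
    HasDerivWithinAt (fun s => ⟪X s, V s⟫) (⟪X t, g (X t)⟫ + ⟪V t, V t⟫) (Icc 0 τ) t :=
  (hs.position t ht).inner ℝ (hs.velocity t ht)

theorem inner_eq_zero (hs : IsFrameSolution g τ X V) (hτ : 0 < τ)
    (hX : ∀ t ∈ Icc 0 τ, ‖X t‖ = 1) {t : ℝ} (ht : t ∈ Icc 0 τ) : ⟪X t, V t⟫ = 0 := by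
  have h := hasDerivWithinAt_Icc_of_eqOn hτ ht (g := fun _ => (1 : ℝ))
    (fun s hs => by simp [hX s hs]) (hs.hasDerivWithinAt_inner_self ht)
    (hasDerivWithinAt_const _ _ _)
  linarith

theorem inner_velocity_self (hs : IsFrameSolution g τ X V) (hτ : 0 < τ)
    (hX : ∀ t ∈ Icc 0 τ, ‖X t‖ = 1) {t : ℝ} (ht : t ∈ Icc 0 τ) :
    ⟪V t, V t⟫ = -⟪X t, g (X t)⟫ := by
  have h := hasDerivWithinAt_Icc_of_eqOn hτ ht (g := fun _ => (0 : ℝ))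
    (fun s hs' => hs.inner_eq_zero hτ hX hs') (hs.hasDerivWithinAt_inner ht)
    (hasDerivWithinAt_const _ _ _)
  linarith

theorem continuousOn_velocity (hs : IsFrameSolution g τ X V) : ContinuousOn V (Icc 0 τ) :=
  fun t ht => (hs.velocity t ht).continuousWithinAt

theorem continuousOn_position (hs : IsFrameSolution g τ X V) : ContinuousOn X (Icc 0 τ) :=
  fun t ht => (hs.position t ht).continuousWithinAt

end IsFrameSolution

/-! ### Reparametrization by arclength -/

section Arclength

variable {τ : ℝ} {V : ℝ → E3}

/-- Freezing `V` at its end values outside `[0, τ]` makes the integrand continuous on the line, so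
the fundamental theorem of calculus also applies at the endpoints. -/
theorem arclength_eq_integral_clamp (hτ : 0 ≤ τ) {t : ℝ} (ht : t ∈ Icc 0 τ) :
    arclength V t = ∫ u in (0 : ℝ)..t, ‖V (projIcc 0 τ hτ u)‖ := by
  refine intervalIntegral.integral_congr fun u hu => ?_
  rw [uIcc_of_le ht.1] at hu
  simp only [projIcc_of_mem hτ (⟨hu.1, hu.2.trans ht.2⟩ : u ∈ Icc 0 τ)]

theorem continuous_clamp (hτ : 0 ≤ τ) (hV : ContinuousOn V (Icc 0 τ)) :
    Continuous fun u => V (projIcc 0 τ hτ u) :=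
  hV.comp_continuous (continuous_subtype_val.comp continuous_projIcc) fun u => (projIcc 0 τ hτ u).2

theorem hasDerivWithinAt_arclength (hτ : 0 ≤ τ) (hV : ContinuousOn V (Icc 0 τ)) {t : ℝ}
    (ht : t ∈ Icc 0 τ) : HasDerivWithinAt (arclength V) ‖V t‖ (Icc 0 τ) t := by
  have h := ((continuous_clamp hτ hV).norm).integral_hasStrictDerivAt 0 t
  have h' := h.hasDerivAt.hasDerivWithinAt (s := Icc 0 τ)
  simp only [projIcc_of_mem hτ ht] at h'
  exact h'.congr (fun u hu => arclength_eq_integral_clamp hτ hu) (arclength_eq_integral_clamp hτ ht)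

@[simp] theorem arclength_zero : arclength V 0 = 0 := by simp [arclength]

theorem arclength_strictMonoOn (hτ : 0 ≤ τ) (hV : ContinuousOn V (Icc 0 τ))
    (hV0 : ∀ t ∈ Icc 0 τ, V t ≠ 0) : StrictMonoOn (arclength V) (Icc 0 τ) := by
  refine strictMonoOn_of_hasDerivWithinAt_pos (convex_Icc 0 τ)
    (fun t ht => (hasDerivWithinAt_arclength hτ hV ht).continuousWithinAt)
    (fun t ht => (hasDerivWithinAt_arclength hτ hV (interior_subset ht)).mono interior_subset)
    (fun t ht => norm_pos_iff.mpr (hV0 t (interior_subset ht)))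

theorem arclength_mem_Icc (hτ : 0 ≤ τ) (hV : ContinuousOn V (Icc 0 τ))
    (hV0 : ∀ t ∈ Icc 0 τ, V t ≠ 0) {t : ℝ} (ht : t ∈ Icc 0 τ) :
    arclength V t ∈ Icc 0 (arclength V τ) := by
  have hm := (arclength_strictMonoOn hτ hV hV0).monotoneOn
  refine ⟨?_, hm ht (right_mem_Icc.mpr hτ) ht.2⟩
  have h := hm (left_mem_Icc.mpr hτ) ht ht.1
  rwa [arclength_zero] at h

/-- The arclength has a differentiable inverse. -/
theorem exists_arclength_inverse (hτ : 0 ≤ τ) (hV : ContinuousOn V (Icc 0 τ))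
    (hV0 : ∀ t ∈ Icc 0 τ, V t ≠ 0) : ∃ T : ℝ → ℝ, (∀ t ∈ Icc 0 τ, T (arclength V t) = t) ∧
      MapsTo T (Icc 0 (arclength V τ)) (Icc 0 τ) ∧
      ∀ s ∈ Icc 0 (arclength V τ), HasDerivAt T ‖V (T s)‖⁻¹ s := by
  set v : ℝ → ℝ := fun u => ‖V (projIcc 0 τ hτ u)‖ with hv
  have hvc : Continuous v := (continuous_clamp hτ hV).norm
  have hvpos : ∀ u, 0 < v u := fun u => norm_pos_iff.mpr (hV0 _ (projIcc 0 τ hτ u).2)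
  set σ : ℝ → ℝ := fun t => ∫ u in (0 : ℝ)..t, v u with hσ
  have hd : ∀ t, HasDerivAt σ (v t) t := fun t => (hvc.integral_hasStrictDerivAt 0 t).hasDerivAt
  have hmono : StrictMono σ := strictMono_of_hasDerivAt_pos hd hvpos
  have hcont : Continuous σ := continuous_iff_continuousAt.mpr fun t => (hd t).continuousAt
  have hev : ∀ t ∈ Icc 0 τ, arclength V t = σ t := fun t ht => arclength_eq_integral_clamp hτ ht
  have hσ0 : σ 0 = 0 := by simp [hσ]
  -- The minimal speed is positive by compactness, so the extended arclength grows at least linearly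
  -- and is a bijection of the whole line.
  obtain ⟨c, hc0, hc⟩ : ∃ c, 0 < c ∧ ∀ u, c ≤ v u := by
    obtain ⟨t₀, ht₀, hmin⟩ := isCompact_Icc.exists_isMinOn (nonempty_Icc.mpr hτ) hV.norm
    exact ⟨‖V t₀‖, norm_pos_iff.mpr (hV0 _ ht₀), fun u => hmin (projIcc 0 τ hτ u).2⟩
  have hgrow : ∀ a b, a ≤ b → c * (b - a) ≤ σ b - σ a := fun a b hab =>
    mul_sub_le_image_sub_of_le_deriv (fun t => (hd t).differentiableAt)
      (fun t => by rw [(hd t).deriv]; exact hc t) hab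
  have hsurj : Function.Surjective σ := by
    refine hcont.surjective (tendsto_atTop.mpr fun b => ?_) (tendsto_atBot.mpr fun b => ?_)
    · filter_upwards [eventually_ge_atTop (max 0 (b / c))] with t ht
      have h1 := hgrow 0 t ((le_max_left _ _).trans ht)
      have h2 := (div_le_iff₀ hc0).mp ((le_max_right 0 (b / c)).trans ht)
      rw [hσ0] at h1
      linarith
    · filter_upwards [eventually_le_atBot (min 0 (b / c))] with t ht
      have h1 := hgrow t 0 (ht.trans (min_le_left _ _))
      have h2 := (le_div_iff₀ hc0).mp (ht.trans (min_le_right 0 (b / c)))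
      rw [hσ0] at h1
      linarith
  set e : ℝ ≃o ℝ := hmono.orderIsoOfSurjective σ hsurj with he
  have hes : ∀ t, e.symm (σ t) = t := fun t => hmono.orderIsoOfSurjective_symm_apply_self σ hsurj t
  have hse : ∀ s, σ (e.symm s) = s := fun s => hmono.orderIsoOfSurjective_self_symm_apply σ hsurj s
  have hmaps : MapsTo e.symm (Icc 0 (arclength V τ)) (Icc 0 τ) := by
    intro s hs
    rw [hev τ (right_mem_Icc.mpr hτ)] at hs
    constructor
    · rw [← hmono.le_iff_le, hse, hσ0]; exact hs.1
    · rw [← hmono.le_iff_le, hse]; exact hs.2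
  refine ⟨e.symm, fun t ht => by rw [hev t ht, hes], hmaps, fun s hs => ?_⟩
  have h := HasDerivAt.of_local_left_inverse (f := σ) (g := e.symm) (a := s)
    e.symm.continuous.continuousAt (hd _) (hvpos _).ne' (Eventually.of_forall hse)
  simpa only [hv, projIcc_of_mem hτ (hmaps hs)] using h

end Arclength

/-! ### Curvatures and Serret-Frenet frame of a solution curve. -/

section Frenet

variable {τ : ℝ} {g : E3 → E3} {X V γ γ₁ γ₂ : ℝ → E3}

theorem exists_isArclengthParam (hτ : 0 ≤ τ) (hs : IsFrameSolution g τ X V)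
    (hV0 : ∀ t ∈ Icc 0 τ, V t ≠ 0) : ∃ γ γ₁ γ₂ : ℝ → E3, IsArclengthParam τ X V γ γ₁ γ₂ := by
  obtain ⟨T, hT, hmaps, hd⟩ := exists_arclength_inverse hτ hs.continuousOn_velocity hV0
  have hdir : ∀ t ∈ Icc 0 τ, DifferentiableWithinAt ℝ (fun t => ‖V t‖⁻¹ • V t) (Icc 0 τ) t := by
    intro t ht
    have h := (hs.velocity t ht).differentiableWithinAt
    exact ((h.norm ℝ (hV0 t ht)).inv (norm_ne_zero_iff.mpr (hV0 t ht))).smul h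
  refine ⟨fun s => X (T s), fun s => ‖V (T s)‖⁻¹ • V (T s),
    fun s => ‖V (T s)‖⁻¹ • derivWithin (fun t => ‖V t‖⁻¹ • V t) (Icc 0 τ) (T s),
    fun t ht => by simp only [hT t ht], fun s hsm => ?_, fun s hsm => ?_⟩
  · exact (hs.position _ (hmaps hsm)).scomp s (hd s hsm).hasDerivWithinAt hmaps
  · exact (hdir _ (hmaps hsm)).hasDerivWithinAt.scomp s (hd s hsm).hasDerivWithinAt hmaps

/-- The derivatives of the arclength parametrization in terms of the solution. -/
theorem IsArclengthParam.frenet (hτ : 0 < τ) (hs : IsFrameSolution g τ X V)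
    (hX : ∀ t ∈ Icc 0 τ, ‖X t‖ = 1) (hV0 : ∀ t ∈ Icc 0 τ, V t ≠ 0)
    (hγ : IsArclengthParam τ X V γ γ₁ γ₂) {t : ℝ} (ht : t ∈ Icc 0 τ) :
    γ₁ (arclength V t) = ‖V t‖⁻¹ • V t ∧
    ⟪γ₁ (arclength V t), γ₂ (arclength V t)⟫ = 0 ∧
    ⟪γ₂ (arclength V t), X t⟫ = -1 ∧
    ⟪γ₂ (arclength V t), cross (X t) (γ₁ (arclength V t))⟫ =
      -⟪V t, cross (X t) (g (X t))⟫ / ‖V t‖ ^ 3 := by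
  have hmaps : MapsTo (arclength V) (Icc 0 τ) (Icc 0 (arclength V τ)) := fun t ht =>
    arclength_mem_Icc hτ.le hs.continuousOn_velocity hV0 ht
  have hnpos : ∀ t ∈ Icc 0 τ, 0 < ‖V t‖ := fun t ht => norm_pos_iff.mpr (hV0 t ht)
  have hdγ : ∀ t ∈ Icc 0 τ, HasDerivWithinAt (fun t => γ (arclength V t))
      (‖V t‖ • γ₁ (arclength V t)) (Icc 0 τ) t := fun t ht =>
    (hγ.deriv₁ _ (hmaps ht)).scomp t
      (hasDerivWithinAt_arclength hτ.le hs.continuousOn_velocity ht) hmaps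
  have hdγ₁ : ∀ t ∈ Icc 0 τ, HasDerivWithinAt (fun t => γ₁ (arclength V t))
      (‖V t‖ • γ₂ (arclength V t)) (Icc 0 τ) t := fun t ht =>
    (hγ.deriv₂ _ (hmaps ht)).scomp t
      (hasDerivWithinAt_arclength hτ.le hs.continuousOn_velocity ht) hmaps
  have hV : ∀ t ∈ Icc 0 τ, ‖V t‖ • γ₁ (arclength V t) = V t := fun t ht =>
    hasDerivWithinAt_Icc_of_eqOn hτ ht (fun s hs => hγ.eq s hs) (hdγ t ht) (hs.position t ht)
  have hγ₁ : ∀ t ∈ Icc 0 τ, γ₁ (arclength V t) = ‖V t‖⁻¹ • V t := by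
    intro t ht
    rw [← hV t ht, norm_smul, norm_norm, smul_smul]
    have h1 : ‖γ₁ (arclength V t)‖ = 1 := by
      have h := congrArg norm (hV t ht)
      rw [norm_smul, norm_norm] at h
      exact (mul_eq_left₀ (hnpos t ht).ne').mp h
    rw [h1, mul_one, inv_mul_cancel₀ (hnpos t ht).ne', one_smul]
  have hunit : ∀ t ∈ Icc 0 τ, ⟪γ₁ (arclength V t), γ₁ (arclength V t)⟫ = 1 := by
    intro t ht
    rw [real_inner_self_eq_norm_sq, hγ₁ t ht, norm_smul, norm_inv, norm_norm,
      inv_mul_cancel₀ (hnpos t ht).ne', one_pow]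
  have horth : ∀ t ∈ Icc 0 τ, ⟪X t, γ₁ (arclength V t)⟫ = 0 := by
    intro t ht
    rw [hγ₁ t ht, inner_smul_right, hs.inner_eq_zero hτ hX ht, mul_zero]
  -- Differentiate `|γ'|² = 1`.
  have h12 : ⟪γ₁ (arclength V t), γ₂ (arclength V t)⟫ = 0 := by
    have h := hasDerivWithinAt_Icc_of_eqOn hτ ht (g := fun _ => (1 : ℝ))
      (fun s hs => hunit s hs) ((hdγ₁ t ht).inner ℝ (hdγ₁ t ht)) (hasDerivWithinAt_const _ _ _)
    rw [inner_smul_left, inner_smul_right, real_inner_comm, conj_trivial, ← two_mul] at h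
    rw [real_inner_comm]
    simpa [(hnpos t ht).ne'] using h
  refine ⟨hγ₁ t ht, h12, ?_, ?_⟩
  -- Differentiate `X · γ' = 0`: since `V · γ' = |V|`, this reads `|V| (X · γ'' + 1) = 0`.
  · have h := hasDerivWithinAt_Icc_of_eqOn hτ ht (g := fun _ => (0 : ℝ))
      (fun s hs => horth s hs) ((hs.position t ht).inner ℝ (hdγ₁ t ht))
      (hasDerivWithinAt_const _ _ _)
    have h' : ⟪V t, γ₁ (arclength V t)⟫ = ‖V t‖ := by
      nth_rw 1 [← hV t ht]
      rw [inner_smul_left, hunit t ht]; simp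
    rw [inner_smul_right, h'] at h
    have h2 : ‖V t‖ * (⟪X t, γ₂ (arclength V t)⟫ + 1) = 0 := by linarith
    have h3 := (mul_eq_zero.mp h2).resolve_left (hnpos t ht).ne'
    rw [real_inner_comm]; linarith
  -- Differentiating `|V| γ' = V` gives `|V|² γ'' + |V|' γ' = g(X)`. Pairing with `X × γ'` removes
  -- the unknown derivative of the speed.
  · have hm : DifferentiableWithinAt ℝ (fun t => ‖V t‖) (Icc 0 τ) t :=
      ((hs.velocity t ht).differentiableWithinAt).norm ℝ (hV0 t ht)
    have h := hasDerivWithinAt_Icc_of_eqOn hτ ht hV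
      (hm.hasDerivWithinAt.smul (hdγ₁ t ht)) (hs.velocity t ht)
    have hperp : ⟪γ₁ (arclength V t), cross (X t) (γ₁ (arclength V t))⟫ = 0 :=
      inner_cross_self _ _
    have h3 : ⟪V t, cross (X t) (g (X t))⟫ = -⟪g (X t), cross (X t) (V t)⟫ := by
      rw [inner_cross_rotate, inner_cross_rotate, inner_cross_swap]
    rw [h3, neg_neg, ← h]
    nth_rw 3 [← hV t ht]
    rw [cross_smul_right, inner_smul_right, inner_add_left, inner_smul_left, inner_smul_left,
      inner_smul_left, hperp]
    have := (hnpos t ht).ne'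
    simp only [conj_trivial, mul_zero, add_zero]
    field_simp

/-- The vector `γ''` has no tangential part, so it is `κₙ N + κ_g N × γ'`; taking the cross product
with `γ'` gives the last row. It is nonzero because `κₙ = -1`. -/
theorem frenet_frame (hτ : 0 < τ) (hs : IsFrameSolution g τ X V)
    (hX : ∀ t ∈ Icc 0 τ, ‖X t‖ = 1) (hV0 : ∀ t ∈ Icc 0 τ, V t ≠ 0)
    (hγ : IsArclengthParam τ X V γ γ₁ γ₂) {t : ℝ} (ht : t ∈ Icc 0 τ) {s : ℝ}
    (hst : s = arclength V t) :
    normalCurvature (γ₂ s) (γ s) = -1 ∧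
    geodesicCurvature (γ₁ s) (γ₂ s) (γ s) = -⟪V t, cross (X t) (g (X t))⟫ / ‖V t‖ ^ 3 ∧
    frame (γ₁ s) (γ s) (cross (γ s) (γ₁ s)) ∈ Matrix.orthogonalGroup (Fin 3) ℝ ∧
    γ₂ s ≠ 0 ∧
    frame (γ₁ s) (‖γ₂ s‖⁻¹ • γ₂ s) (cross (γ₁ s) (‖γ₂ s‖⁻¹ • γ₂ s)) =
      frenetMatrix (normalCurvature (γ₂ s) (γ s)) (geodesicCurvature (γ₁ s) (γ₂ s) (γ s)) *
        frame (γ₁ s) (γ s) (cross (γ s) (γ₁ s)) := by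
  obtain ⟨h1, h2, h3, h4⟩ := hγ.frenet hτ hs hX hV0 ht
  rw [← hst] at h1 h2 h3 h4
  have hγX : γ s = X t := by rw [hst, hγ.eq t ht]
  have hn : ⟪γ s, γ s⟫ = 1 := by rw [hγX, real_inner_self_eq_norm_sq, hX t ht, one_pow]
  have hu : ⟪γ₁ s, γ₁ s⟫ = 1 := by
    rw [real_inner_self_eq_norm_sq, h1, norm_smul, norm_inv, norm_norm,
      inv_mul_cancel₀ (norm_ne_zero_iff.mpr (hV0 t ht)), one_pow]
  have hnu : ⟪γ s, γ₁ s⟫ = 0 := by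
    rw [hγX, h1, inner_smul_right, hs.inner_eq_zero hτ hX ht, mul_zero]
  rw [← hγX] at h3 h4
  have hne : γ₂ s ≠ 0 := by
    intro h
    rw [h, inner_zero_left] at h3
    norm_num at h3
  refine ⟨h3, by rw [hγX] at h4 ⊢; exact h4, ?_, hne, ?_⟩
  · refine frame_mem_orthogonalGroup hu hn ?_ (by rw [real_inner_comm, hnu])
      (inner_cross_self _ _) (inner_self_cross _ _)
    rw [inner_cross_cross, hn, hu, hnu]; simp
  set κg := geodesicCurvature (γ₁ s) (γ₂ s) (γ s) with hκg
  set κn := normalCurvature (γ₂ s) (γ s) with hκn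
  have hexp : γ₂ s = κn • γ s + κg • cross (γ s) (γ₁ s) := by
    have h := eq_frame_expansion hn hu hnu (γ₂ s)
    rw [real_inner_comm, h2, zero_smul, zero_add] at h
    exact h
  have hnorm : ‖γ₂ s‖ = √(κn ^ 2 + κg ^ 2) := by
    rw [eq_comm, Real.sqrt_eq_iff_eq_sq (by positivity) (norm_nonneg _),
      ← real_inner_self_eq_norm_sq, inner_self_eq_frame hn hu hnu (γ₂ s), real_inner_comm, h2]
    simp only [hκn, hκg, normalCurvature, geodesicCurvature]
    ring
  have hcr : cross (γ₁ s) (γ₂ s) = κg • γ s - κn • cross (γ s) (γ₁ s) := by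
    rw [hexp, cross_add_right, cross_smul_right, cross_smul_right, cross_cross_eq, hu,
      real_inner_comm, hnu, cross_anticomm_eq (γ s) (γ₁ s)]
    simp only [one_smul, zero_smul, sub_zero, smul_neg]
    abel
  rw [cross_smul_right, hcr, hnorm]
  nth_rw 1 [hexp]
  ext i j
  fin_cases i <;> simp [frame, frenetMatrix, Matrix.mul_apply, Fin.sum_univ_three] <;> ring

end Frenet

/-! ### Unit speed solutions that start in the tangent bundle -/

section UnitSpeed

variable {τ : ℝ} {Θ : S2 → ℝ} {X V : ℝ → E3}

theorem inner_gField (Θ : S2 → ℝ) (x : E3) : ⟪x, gField Θ x⟫ = -⟪x, x⟫ := by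
  rw [gField, inner_sub_right, inner_neg_right, inner_sgrad_self, sub_zero]

theorem IsFrameSolution.norm_velocity (hτ : 0 < τ) (hs : IsFrameSolution (gField Θ) τ X V)
    (hX : ∀ t ∈ Icc 0 τ, ‖X t‖ = 1) {t : ℝ} (ht : t ∈ Icc 0 τ) : ‖V t‖ = 1 := by
  have h := hs.inner_velocity_self hτ hX ht
  rw [inner_gField, neg_neg, real_inner_self_eq_norm_sq, real_inner_self_eq_norm_sq, hX t ht,
    one_pow] at h
  exact (pow_eq_one_iff_of_nonneg (norm_nonneg _) two_ne_zero).mp h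

/-- With `u = |X|² - 1` and `w = X · V`, unit speed gives `u' = 2w` and `w' = -u`, so `u² + 2w²` is
conserved and starts at zero. -/
theorem IsFrameSolution.norm_position_of_norm_velocity (hs : IsFrameSolution (gField Θ) τ X V)
    (hX0 : ‖X 0‖ = 1) (hV0 : ⟪X 0, V 0⟫ = 0) (hV : ∀ t ∈ Icc 0 τ, ‖V t‖ = 1) :
    ∀ t ∈ Icc 0 τ, ‖X t‖ = 1 := by
  intro t ht
  have hd : ∀ t ∈ Icc 0 τ, HasDerivWithinAt
      (fun t => (⟪X t, X t⟫ - 1) ^ 2 + 2 * ⟪X t, V t⟫ ^ 2) 0 (Icc 0 τ) t := by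
    intro t ht
    have h1 := ((hs.hasDerivWithinAt_inner_self ht).sub_const 1).pow 2
    have h2 := ((hs.hasDerivWithinAt_inner ht).pow 2).const_mul 2
    rw [inner_gField, real_inner_self_eq_norm_sq (V t), hV t ht] at h2
    convert! h1.add h2 using 1
    push_cast
    ring
  have h := eq_of_hasDerivWithinAt_zero hd t ht
  simp only [hV0, real_inner_self_eq_norm_sq, hX0] at h
  have h2 : ‖X t‖ ^ 2 - 1 = 0 := by nlinarith [sq_nonneg (‖X t‖ ^ 2 - 1), sq_nonneg ⟪X t, V t⟫]
  exact (pow_eq_one_iff_of_nonneg (norm_nonneg _) two_ne_zero).mp (sub_eq_zero.mp h2)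

theorem IsFrameSolution.norm_position_of_inner (hs : IsFrameSolution (gField Θ) τ X V)
    (hX0 : ‖X 0‖ = 1) (hXV : ∀ t ∈ Icc 0 τ, ⟪X t, V t⟫ = 0) : ∀ t ∈ Icc 0 τ, ‖X t‖ = 1 := by
  intro t ht
  have h := eq_of_hasDerivWithinAt_zero (f := fun t => ⟪X t, X t⟫)
    (fun t ht => by simpa [hXV t ht] using hs.hasDerivWithinAt_inner_self ht) t ht
  simp only [real_inner_self_eq_norm_sq, hX0, one_pow] at h
  exact (pow_eq_one_iff_of_nonneg (norm_nonneg _) two_ne_zero).mp h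

/-- Along a solution on the sphere, the potential force is orthogonal to the velocity. -/
theorem IsFrameSolution.inner_velocity_sgrad (hτ : 0 < τ)
    (hs : IsFrameSolution (gField Θ) τ X V) (hX : ∀ t ∈ Icc 0 τ, ‖X t‖ = 1) {t : ℝ}
    (ht : t ∈ Icc 0 τ) : ⟪V t, sgrad Θ (X t)⟫ = 0 := by
  have h := hasDerivWithinAt_Icc_of_eqOn hτ ht (g := fun _ => (1 : ℝ))
    (fun s hs' => by simp [hs.norm_velocity hτ hX hs'])
    ((hs.velocity t ht).inner ℝ (hs.velocity t ht)) (hasDerivWithinAt_const _ _ _)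
  rw [real_inner_comm, ← two_mul, gField, inner_sub_left, inner_neg_left,
    hs.inner_eq_zero hτ hX ht, real_inner_comm] at h
  linarith

theorem unit_speed_equivalences (hτ : 0 < τ) (hs : IsFrameSolution (gField Θ) τ X V)
    (hX0 : ‖X 0‖ = 1) (hV0 : ⟪X 0, V 0⟫ = 0) :
    ((∀ t ∈ Icc 0 τ, ⟪X t, V t⟫ = 0) ↔ ∀ t ∈ Icc 0 τ, ‖V t‖ = 1) ∧
    ((∀ t ∈ Icc 0 τ, ‖V t‖ = 1) ↔ ∀ t ∈ Icc 0 τ, ‖X t‖ = 1) ∧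
    ((∀ t ∈ Icc 0 τ, ‖V t‖ = 1) →
      ∀ γ γ₁ γ₂ : ℝ → E3, IsArclengthParam τ X V γ γ₁ γ₂ →
        ∀ t ∈ Icc 0 τ, ∀ s : ℝ, s = arclength V t →
          |geodesicCurvature (γ₁ s) (γ₂ s) (γ s)| = ‖sgrad Θ (X t)‖) := by
  have hVX := hs.norm_position_of_norm_velocity hX0 hV0
  refine ⟨⟨fun h t ht => hs.norm_velocity hτ (hs.norm_position_of_inner hX0 h) ht,
    fun h t ht => hs.inner_eq_zero hτ (hVX h) ht⟩,
    ⟨hVX, fun h t ht => hs.norm_velocity hτ h ht⟩, ?_⟩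
  intro hV γ γ₁ γ₂ hγ t ht s hst
  have hX := hVX hV
  have hne : ∀ t ∈ Icc 0 τ, V t ≠ 0 := fun t ht h => by
    have := hV t ht
    simp [h] at this
  rw [(frenet_frame hτ hs hX hne hγ ht hst).2.1, hV t ht, one_pow, div_one, abs_neg]
  have hn : ⟪X t, X t⟫ = 1 := by rw [real_inner_self_eq_norm_sq, hX t ht, one_pow]
  have hu : ⟪V t, V t⟫ = 1 := by rw [real_inner_self_eq_norm_sq, hV t ht, one_pow]
  -- The surface gradient is orthogonal to both `X` and `V`, so only its component along `X × V`
  -- remains, which is the geodesic curvature up to sign.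
  have h := inner_self_eq_frame hn hu (hs.inner_eq_zero hτ hX ht) (sgrad Θ (X t))
  rw [real_inner_comm (V t), hs.inner_velocity_sgrad hτ hX ht, real_inner_comm (X t),
    inner_sgrad_self, real_inner_self_eq_norm_sq] at h
  have hc : ⟪V t, cross (X t) (gField Θ (X t))⟫ = ⟪sgrad Θ (X t), cross (X t) (V t)⟫ := by
    rw [gField, sub_eq_add_neg, cross_add_right, cross_neg_right, cross_neg_right,
      cross_self_eq_zero, neg_zero, zero_add, inner_neg_right, ← inner_cross_swap,
      inner_cross_rotate]
  rw [hc, ← Real.sqrt_sq_eq_abs, ← Real.sqrt_sq (norm_nonneg (sgrad Θ (X t))), h]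
  congr 1
  ring

end UnitSpeed

/-! ### The geodesic distance -/

theorem sdist_eq_angle (x y : S2) : sdist x y = InnerProductGeometry.angle (x : E3) (y : E3) := by
  simp [sdist, InnerProductGeometry.angle]

theorem sdist_nonneg (x y : S2) : 0 ≤ sdist x y := Real.arccos_nonneg _

theorem sdist_le_pi (x y : S2) : sdist x y ≤ Real.pi := Real.arccos_le_pi _

theorem sdist_comm (x y : S2) : sdist x y = sdist y x := by
  rw [sdist, sdist, real_inner_comm]

theorem sdist_self (x : S2) : sdist x x = 0 := by
  rw [sdist, inner_coe_self, Real.arccos_one]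

theorem sdist_triangle (x y z : S2) : sdist x z ≤ sdist x y + sdist y z := by
  simp only [sdist_eq_angle]
  exact InnerProductGeometry.angle_le_angle_add_angle _ _ _

theorem abs_inner_coe_le (x y : S2) : |⟪(x : E3), (y : E3)⟫| ≤ 1 := by
  simpa [norm_coe] using abs_real_inner_le_norm (x : E3) (y : E3)

theorem cos_sdist (x y : S2) : Real.cos (sdist x y) = ⟪(x : E3), (y : E3)⟫ :=
  Real.cos_arccos (abs_le.mp (abs_inner_coe_le x y)).1 (abs_le.mp (abs_inner_coe_le x y)).2

theorem continuous_sdist : Continuous fun p : S2 × S2 => sdist p.1 p.2 :=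
  Real.continuous_arccos.comp
    ((continuous_subtype_val.comp continuous_fst).inner (continuous_subtype_val.comp continuous_snd))

theorem continuous_sdist_left (x : S2) : Continuous fun y => sdist x y := by
  unfold sdist
  exact Real.continuous_arccos.comp (continuous_const.inner continuous_subtype_val)

/-- The half-angle formula for the chord. Unlike `arccos` at `1`, `arcsin` is differentiable at `0`,
so this form compares arc and chord at short distance. -/
theorem sdist_eq_arcsin (x y : S2) : sdist x y = 2 * Real.arcsin (‖(x : E3) - y‖ / 2) := by
  have hπ := sdist_le_pi x y
  have h0 := sdist_nonneg x y
  have hs : Real.sin (sdist x y / 2) = ‖(x : E3) - y‖ / 2 := by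
    rw [Real.sin_half_eq_sqrt h0 (by linarith), cos_sdist, Real.sqrt_eq_iff_eq_sq, div_pow,
      norm_sub_sq_real, norm_coe, norm_coe]
    · ring
    · linarith [(abs_le.mp (abs_inner_coe_le x y)).2]
    · positivity
  rw [← hs, Real.arcsin_sin] <;> linarith

theorem eventually_arcsin_le {k : ℝ} (hk : 1 < k) : ∀ᶠ u in 𝓝[≥] (0 : ℝ), Real.arcsin u ≤ k * u := by
  have hd : HasDerivWithinAt Real.arcsin 1 (Ioi 0) 0 := by
    simpa using (Real.hasDerivAt_arcsin (x := 0) (by norm_num) (by norm_num)).hasDerivWithinAt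
  have h := hd.limsup_slope_le' (by simp) hk
  rw [eventually_nhdsWithin_iff] at h ⊢
  filter_upwards [h] with u hu hu0
  rcases (mem_Ici.mp hu0).eq_or_lt with h0 | h0
  · simp [← h0]
  · have := hu h0
    rw [slope_def_field, Real.arcsin_zero, sub_zero, sub_zero, div_lt_iff₀ h0] at this
    exact this.le

/-- By the triangle inequality the distance to `x` grows no faster than the arc from `X t` to `X z`,
and arc over chord tends to `1`. A right-slope bound suffices, so the points where the distance is
not differentiable cause no trouble. -/
theorem frequently_slope_sdist_lt {τ C : ℝ} {X : ℝ → S2} {V : ℝ → E3}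
    (hX : ∀ t ∈ Icc 0 τ, HasDerivWithinAt (fun t => (X t : E3)) (V t) (Icc 0 τ) t)
    (hV : ∀ t ∈ Icc 0 τ, ‖V t‖ ≤ C) (x : S2) {t : ℝ} (htm : t ∈ Ico 0 τ) {r : ℝ} (hr : C < r) :
    ∃ᶠ z in 𝓝[>] t, slope (fun z => sdist x (X z)) t z < r := by
  refine Eventually.frequently ?_
  have hC : 0 ≤ C := (norm_nonneg _).trans (hV t (Ico_subset_Icc_self htm))
  -- The margin between `C` and `r` is shared: `r'` bounds the chord speed and `r / r'` the ratio of
  -- arc to chord.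
  obtain ⟨r', h1, h2⟩ := exists_between hr
  have hr' : 0 < r' := hC.trans_lt h1
  have hder : HasDerivWithinAt (fun t => (X t : E3)) (V t) (Ioi t) t :=
    (hX t (Ico_subset_Icc_self htm)).mono_of_mem_nhdsWithin (Icc_mem_nhdsGT_of_mem htm)
  have hslope := hder.limsup_norm_slope_le ((hV t (Ico_subset_Icc_self htm)).trans_lt h1)
  have htend : Tendsto (fun z => ‖(X t : E3) - X z‖ / 2) (𝓝[>] t) (𝓝[≥] 0) := by
    refine tendsto_nhdsWithin_iff.mpr ⟨?_, Eventually.of_forall fun z => by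
      simp only [mem_Ici]; positivity⟩
    have : Tendsto (fun z => ‖(X t : E3) - X z‖ / 2) (𝓝[>] t) (𝓝 (‖(X t : E3) - X t‖ / 2)) :=
      ((tendsto_const_nhds.sub hder.continuousWithinAt.tendsto).norm).div_const 2
    simpa using this
  have harc := htend.eventually (eventually_arcsin_le (k := r / r') ((one_lt_div hr').mpr h2))
  filter_upwards [hslope, harc, self_mem_nhdsWithin] with z hz1 hz2 hz3
  have hpos : 0 < z - t := sub_pos.mpr hz3
  rw [slope_def_field, div_lt_iff₀ hpos]
  rw [Real.norm_of_nonneg hpos.le, inv_mul_lt_iff₀ hpos, norm_sub_rev] at hz1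
  have h3 : sdist (X t) (X z) ≤ r / r' * ‖(X t : E3) - X z‖ := by
    rw [sdist_eq_arcsin]; linarith
  have h4 : r / r' * ‖(X t : E3) - X z‖ < r * (z - t) := by
    calc r / r' * ‖(X t : E3) - X z‖ < r / r' * ((z - t) * r') :=
          mul_lt_mul_of_pos_left hz1 (div_pos (hr'.trans h2) hr')
      _ = r * (z - t) := by field_simp
  have h5 := sdist_triangle x (X t) (X z)
  linarith

/-- The geodesic distance between two points of a curve is at most its length. -/
theorem sdist_le_of_norm_velocity_le {τ C : ℝ} {X : ℝ → S2} {V : ℝ → E3}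
    (hX : ∀ t ∈ Icc 0 τ, HasDerivWithinAt (fun t => (X t : E3)) (V t) (Icc 0 τ) t)
    (hV : ∀ t ∈ Icc 0 τ, ‖V t‖ ≤ C) {a b : ℝ} (ha : 0 ≤ a) (hab : a ≤ b) (hb : b ≤ τ) :
    sdist (X a) (X b) ≤ C * (b - a) := by
  have hsub : Icc a b ⊆ Icc 0 τ := Icc_subset_Icc ha hb
  have hcont : ContinuousOn X (Icc 0 τ) :=
    Topology.IsInducing.subtypeVal.continuousOn_iff.mpr fun t ht => (hX t ht).continuousWithinAt
  have key : ∀ t ∈ Ico a b, ∀ r, C < r →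
      ∃ᶠ z in 𝓝[>] t, slope (fun z => sdist (X a) (X z)) t z < r := fun t ht r hr =>
    frequently_slope_sdist_lt hX hV (X a) ⟨ha.trans ht.1, ht.2.trans_le hb⟩ hr
  have hf : ContinuousOn (fun z => sdist (X a) (X z)) (Icc a b) :=
    (continuous_sdist_left (X a)).comp_continuousOn (hcont.mono hsub)
  have hB : ∀ z ∈ Ico a b, HasDerivWithinAt (fun z => C * (z - a)) C (Ici z) z := fun z _ => by
    simpa using (((hasDerivWithinAt_id z (Ici z)).sub_const a).const_mul C)
  have hBc : ContinuousOn (fun z => C * (z - a)) (Icc a b) := by fun_prop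
  have h0 : sdist (X a) (X a) ≤ C * (a - a) := by rw [sdist_self, sub_self, mul_zero]
  have h := image_le_of_liminf_slope_right_le_deriv_boundary (f := fun z => sdist (X a) (X z))
    (B := fun z => C * (z - a)) (B' := fun _ => C) hf h0 hBc hB key
  have hbm : b ∈ Icc a b := right_mem_Icc.mpr hab
  exact h hbm

/-! ### The Wasserstein distance -/

theorem W2_nonneg (μ ν : Measure S2) : 0 ≤ W2 μ ν := Real.sqrt_nonneg _

/-- The costs of the couplings of two measures. -/
def couplingCosts (μ ν : Measure S2) : Set ℝ :=
  {c : ℝ | ∃ π : Measure (S2 × S2), π.map Prod.fst = μ ∧ π.map Prod.snd = ν ∧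
    c = ∫ p, sdist p.1 p.2 ^ 2 / 2 ∂π}

theorem couplingCosts_nonneg {μ ν : Measure S2} {c : ℝ} (hc : c ∈ couplingCosts μ ν) : 0 ≤ c := by
  obtain ⟨π, -, -, rfl⟩ := hc
  exact integral_nonneg fun p => by positivity

theorem W2_sq (μ ν : Measure S2) : W2 μ ν ^ 2 = sInf (couplingCosts μ ν) :=
  Real.sq_sqrt (Real.sInf_nonneg fun _ hc => couplingCosts_nonneg hc)

theorem W2_sq_le_of_mem {μ ν : Measure S2} {c : ℝ} (hc : c ∈ couplingCosts μ ν) :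
    W2 μ ν ^ 2 ≤ c := by
  rw [W2_sq]
  exact csInf_le ⟨0, fun _ hc => couplingCosts_nonneg hc⟩ hc

theorem W2_symm (μ ν : Measure S2) : W2 μ ν = W2 ν μ := by
  have key : ∀ μ ν : Measure S2, couplingCosts μ ν ⊆ couplingCosts ν μ := by
    rintro μ ν _ ⟨π, h1, h2, rfl⟩
    refine ⟨π.map Prod.swap, ?_, ?_, ?_⟩
    · rw [Measure.map_map measurable_fst measurable_swap]; exact h2
    · rw [Measure.map_map measurable_snd measurable_swap]; exact h1
    · rw [integral_map measurable_swap.aemeasurable]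
      · simp only [Prod.fst_swap, Prod.snd_swap]
        simp_rw [sdist_comm]
      · exact ((continuous_sdist.pow 2).div_const 2).aestronglyMeasurable
  exact congrArg Real.sqrt (congrArg sInf ((key μ ν).antisymm (key ν μ)))

/-! ### Couplings induced by a pair of maps. -/

section Map

variable {α : Type*} [MeasurableSpace α] {P : Measure α} {f g : α → S2}

theorem mem_couplingCosts_map (hf : AEMeasurable f P) (hg : AEMeasurable g P) :
    ∫ x, sdist (f x) (g x) ^ 2 / 2 ∂P ∈ couplingCosts (P.map f) (P.map g) := by
  refine ⟨P.map fun x => (f x, g x), ?_, ?_, ?_⟩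
  · rw [AEMeasurable.map_map_of_aemeasurable measurable_fst.aemeasurable (hf.prodMk hg)]; rfl
  · rw [AEMeasurable.map_map_of_aemeasurable measurable_snd.aemeasurable (hf.prodMk hg)]; rfl
  · rw [integral_map (hf.prodMk hg)]
    exact ((continuous_sdist.pow 2).div_const 2).aestronglyMeasurable

theorem W2_sq_map_le [IsProbabilityMeasure P] (hf : AEMeasurable f P) (hg : AEMeasurable g P)
    {D : ℝ} (hD : ∀ᵐ x ∂P, sdist (f x) (g x) ≤ D) : W2 (P.map f) (P.map g) ^ 2 ≤ D ^ 2 / 2 := by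
  refine (W2_sq_le_of_mem (mem_couplingCosts_map hf hg)).trans ?_
  have h : ∫ x, sdist (f x) (g x) ^ 2 / 2 ∂P ≤ ∫ _, D ^ 2 / 2 ∂P := by
    refine integral_mono_of_nonneg (Eventually.of_forall fun x => ?_) (integrable_const _) ?_
    · simp only [Pi.zero_apply]; positivity
    · filter_upwards [hD] with x hx
      have := pow_le_pow_left₀ (sdist_nonneg (f x) (g x)) hx 2
      linarith
  simpa using h

end Map

/-! ### Absolute continuity of the induced path of measures -/

/-- Finite unions of the disjoint intervals have Lebesgue measure at most that of `[0, τ]`. -/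
theorem tsum_lengths_le {τ : ℝ} {a b : ℕ → ℝ} (hτ : 0 ≤ τ)
    (hab : ∀ j, 0 ≤ a j ∧ a j < b j ∧ b j ≤ τ)
    (hd : Pairwise (fun i j => Disjoint (Ioo (a i) (b i)) (Ioo (a j) (b j)))) :
    Summable (fun j => b j - a j) ∧ ∑' j, (b j - a j) ≤ τ := by
  have hpos : ∀ j, 0 ≤ b j - a j := fun j => sub_nonneg.mpr (hab j).2.1.le
  have key : ∀ s : Finset ℕ, ∑ j ∈ s, (b j - a j) ≤ τ := by
    intro s
    have h1 : volume (⋃ j ∈ s, Ioo (a j) (b j)) = ∑ j ∈ s, volume (Ioo (a j) (b j)) :=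
      measure_biUnion_finset (fun i _ j _ hij => hd hij) fun j _ => measurableSet_Ioo
    have h2 : volume (⋃ j ∈ s, Ioo (a j) (b j)) ≤ volume (Icc 0 τ) :=
      measure_mono (iUnion₂_subset fun j _ x hx =>
        ⟨(hab j).1.trans hx.1.le, hx.2.le.trans (hab j).2.2⟩)
    rw [h1] at h2
    simp only [Real.volume_Ioo, Real.volume_Icc, sub_zero] at h2
    rw [← ENNReal.ofReal_sum_of_nonneg fun j _ => hpos j] at h2
    exact (ENNReal.ofReal_le_ofReal_iff hτ).mp h2
  exact ⟨summable_of_sum_le hpos key, Real.tsum_le_of_sum_le hpos key⟩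

/-- Coupling along trajectories bounds each quotient by `C² (b - a) / 2`, so the sum is controlled
by the total length `τ`. -/
theorem absolutelyContinuous_map {τ : ℝ} (hτ : 0 < τ) {ρ₀ : Measure S2} {X : S2 → ℝ → S2}
    {V : S2 → ℝ → E3} {C : ℝ} [IsProbabilityMeasure ρ₀]
    (hm : ∀ t ∈ Icc 0 τ, AEMeasurable (fun x => X x t) ρ₀)
    (hX : ∀ᵐ x ∂ρ₀, (∀ t ∈ Icc 0 τ,
      HasDerivWithinAt (fun t => (X x t : E3)) (V x t) (Icc 0 τ) t) ∧ ∀ t ∈ Icc 0 τ, ‖V x t‖ ≤ C) :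
    IsTwoAbsolutelyContinuous τ (fun t => ρ₀.map (fun x => X x t)) := by
  refine ⟨C ^ 2 / 2 * τ, fun a b hab hd => ?_⟩
  obtain ⟨hsum, hle⟩ := tsum_lengths_le hτ.le hab hd
  have hbound : ∀ j, W2 (ρ₀.map fun x => X x (b j)) (ρ₀.map fun x => X x (a j)) ^ 2 / (b j - a j) ≤
      C ^ 2 / 2 * (b j - a j) := by
    intro j
    obtain ⟨h0, h1, h2⟩ := hab j
    have hpos : 0 < b j - a j := sub_pos.mpr h1
    rw [W2_symm, div_le_iff₀ hpos]
    refine (W2_sq_map_le (hm _ ⟨h0, h1.le.trans h2⟩) (hm _ ⟨h0.trans h1.le, h2⟩)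
      (D := C * (b j - a j)) ?_).trans (by nlinarith)
    filter_upwards [hX] with x hx
    exact sdist_le_of_norm_velocity_le hx.1 hx.2 h0 h1.le h2
  have hnn : ∀ j, 0 ≤
      W2 (ρ₀.map fun x => X x (b j)) (ρ₀.map fun x => X x (a j)) ^ 2 / (b j - a j) := fun j =>
    div_nonneg (sq_nonneg _) (sub_nonneg.mpr (hab j).2.1.le)
  have hs' := Summable.of_nonneg_of_le hnn hbound (hsum.mul_left _)
  refine ⟨hs', (hs'.tsum_le_tsum hbound (hsum.mul_left _)).trans ?_⟩
  rw [tsum_mul_left]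
  exact mul_le_mul_of_nonneg_left hle (by positivity)

/-! ### Great circles -/

section GreatCircle

variable {τ : ℝ} {X : ℝ → S2} {V : ℝ → E3}

/-- The equation is linear, and the energy `|X - Y|² + |V - W|²` of the difference from the explicit
solution is conserved and starts at zero. -/
theorem greatCircle_eq (hs : IsFrameSolution (fun x => -x) τ (fun t => (X t : E3)) V) {t : ℝ}
    (ht : t ∈ Icc 0 τ) : (X t : E3) = Real.cos t • (X 0 : E3) + Real.sin t • V 0 := by
  set Y : ℝ → E3 := fun t => Real.cos t • (X 0 : E3) + Real.sin t • V 0 with hY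
  set W : ℝ → E3 := fun t => -Real.sin t • (X 0 : E3) + Real.cos t • V 0 with hW
  have hYd : ∀ t, HasDerivAt Y (W t) t := fun t =>
    ((Real.hasDerivAt_cos t).smul_const _).add ((Real.hasDerivAt_sin t).smul_const _)
  have hWd : ∀ t, HasDerivAt W (-Y t) t := by
    intro t
    have h := ((Real.hasDerivAt_sin t).neg.smul_const (X 0 : E3)).add
      ((Real.hasDerivAt_cos t).smul_const (V 0))
    convert! h using 1
    simp only [hY, neg_add, neg_smul]
  have hd : ∀ t ∈ Icc 0 τ, HasDerivWithinAt (fun t => ⟪(X t : E3) - Y t, (X t : E3) - Y t⟫ +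
      ⟪V t - W t, V t - W t⟫) 0 (Icc 0 τ) t := by
    intro t ht
    have h1 := (hs.position t ht).sub (hYd t).hasDerivWithinAt
    have h2 := (hs.velocity t ht).sub (hWd t).hasDerivWithinAt
    have h := (h1.inner ℝ h1).add (h2.inner ℝ h2)
    convert! h using 1
    simp only [Pi.sub_apply]
    have e : -(X t : E3) - -Y t = -((X t : E3) - Y t) := by abel
    rw [e, inner_neg_left, inner_neg_right, real_inner_comm (V t - W t)]
    ring
  have h := eq_of_hasDerivWithinAt_zero hd t ht
  have h0 : (X 0 : E3) - Y 0 = 0 := by simp [hY]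
  have h0' : V 0 - W 0 = 0 := by simp [hW]
  simp only [h0, h0', inner_zero_left, add_zero, real_inner_self_eq_norm_sq] at h
  have hz : ‖(X t : E3) - Y t‖ = 0 := by
    nlinarith [sq_nonneg ‖V t - W t‖, sq_nonneg ‖(X t : E3) - Y t‖, norm_nonneg ((X t : E3) - Y t)]
  exact sub_eq_zero.mp (norm_eq_zero.mp hz)

theorem greatCircle_velocity (hτ : 0 < τ)
    (hs : IsFrameSolution (fun x => -x) τ (fun t => (X t : E3)) V) {t : ℝ} (ht : t ∈ Icc 0 τ) :
    ‖V t‖ = 1 ∧ ⟪(X t : E3), V t⟫ = 0 := by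
  refine ⟨?_, hs.inner_eq_zero hτ (fun t _ => norm_coe _) ht⟩
  have h := hs.inner_velocity_self hτ (fun t _ => norm_coe _) ht
  rw [inner_neg_right, neg_neg, inner_coe_self, real_inner_self_eq_norm_sq] at h
  exact (pow_eq_one_iff_of_nonneg (norm_nonneg _) two_ne_zero).mp h

theorem sdist_greatCircle (hτ : 0 < τ)
    (hs : IsFrameSolution (fun x => -x) τ (fun t => (X t : E3)) V) {s t : ℝ} (hsm : s ∈ Icc 0 τ)
    (ht : t ∈ Icc 0 τ) (hst : |t - s| ≤ Real.pi) : sdist (X s) (X t) = |t - s| := by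
  obtain ⟨h1, h2⟩ := greatCircle_velocity hτ hs (left_mem_Icc.mpr hτ.le)
  have h3 : ⟪(X s : E3), (X t : E3)⟫ = Real.cos |t - s| := by
    rw [greatCircle_eq hs hsm, greatCircle_eq hs ht, Real.cos_abs, Real.cos_sub]
    simp only [inner_add_left, inner_add_right, inner_smul_left, inner_smul_right, h2,
      norm_coe, real_inner_comm (X 0 : E3) (V 0), real_inner_self_eq_norm_sq, h1,
      conj_trivial]
    ring
  rw [sdist, h3, Real.arccos_cos (abs_nonneg _) hst]

end GreatCircle

/-! ### Inf-convolutions with the squared distance -/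

theorem continuous_of_le_add_sdist {g : S2 → ℝ} {K : ℝ}
    (hg : ∀ w z, g w ≤ g z + K * sdist w z) : Continuous g := by
  refine continuous_iff_continuousAt.mpr fun w => ?_
  have h0 : Tendsto (fun z => K * sdist w z) (𝓝 w) (𝓝 0) := by
    have h := ((continuous_sdist_left w).const_mul K).tendsto w
    rwa [sdist_self, mul_zero] at h
  have h : Tendsto (fun z => g z - g w) (𝓝 w) (𝓝 0) := by
    refine squeeze_zero_norm (fun z => ?_) h0
    rw [Real.norm_eq_abs, abs_le]
    have h1 := hg w z
    have h2 := hg z w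
    rw [sdist_comm z w] at h2
    constructor <;> linarith
  simpa [ContinuousAt] using h.add_const (g w)

/-- Distances are at most `π`, so `a² - b² = (a - b)(a + b)` makes the cost `π`-Lipschitz in each
variable. This yields continuity of all inf-convolutions below. -/
theorem sq_sdist_le (w z y : S2) :
    sdist w y ^ 2 / 2 ≤ sdist z y ^ 2 / 2 + Real.pi * sdist w z := by
  have h1 := sdist_triangle w z y
  have h2 := sdist_le_pi w y
  have h3 := sdist_le_pi z y
  have h4 := sdist_nonneg w y
  have h5 := sdist_nonneg z y
  have h6 := sdist_nonneg w z
  nlinarith [mul_nonneg h6 (by linarith : (0 : ℝ) ≤ 2 * Real.pi - sdist w y - sdist z y),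
    mul_nonneg (by linarith : 0 ≤ sdist w z + sdist z y - sdist w y)
      (by linarith : 0 ≤ sdist w y + sdist z y)]

theorem exists_infConv {f : S2 → ℝ} (hf : Continuous f) {k : ℝ} (hk : 0 ≤ k) :
    ∃ g : S2 → ℝ, Continuous g ∧ (∀ w y, g w ≤ k * (sdist w y ^ 2 / 2) + f y) ∧
      ∀ w, ∃ y, g w = k * (sdist w y ^ 2 / 2) + f y := by
  have hmin : ∀ w, ∃ y₀, ∀ y,
      k * (sdist w y₀ ^ 2 / 2) + f y₀ ≤ k * (sdist w y ^ 2 / 2) + f y := by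
    intro w
    have hc : Continuous fun y => k * (sdist w y ^ 2 / 2) + f y :=
      ((((continuous_sdist_left w).pow 2).div_const 2).const_mul k).add hf
    obtain ⟨y₀, -, h⟩ := isCompact_univ.exists_isMinOn univ_nonempty hc.continuousOn
    exact ⟨y₀, fun y => h (mem_univ y)⟩
  choose Y hY using hmin
  refine ⟨fun w => k * (sdist w (Y w) ^ 2 / 2) + f (Y w), ?_, hY, fun w => ⟨Y w, rfl⟩⟩
  refine continuous_of_le_add_sdist (K := k * Real.pi) fun w z => ?_
  have h1 := hY w (Y z)
  have h2 := mul_le_mul_of_nonneg_left (sq_sdist_le w z (Y z)) hk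
  linarith

theorem IsCostConcave.continuous {ψ : S2 → ℝ} (hψ : IsCostConcave ψ) : Continuous ψ := by
  obtain ⟨Φ, hΦ⟩ := hψ
  refine continuous_of_le_add_sdist (K := Real.pi) fun w z => ?_
  rw [← sub_le_iff_le_add]
  refine (hΦ z).2 ?_
  rintro _ ⟨y, rfl⟩
  have h1 : ψ w ≤ sdist w y ^ 2 / 2 - Φ y := (hΦ w).1 ⟨y, rfl⟩
  have h2 := sq_sdist_le w z y
  simp only
  linarith

/-- Kantorovich duality for a cost-concave function: the conjugate potential. -/
theorem IsCostConcave.exists_conjugate {ψ : S2 → ℝ} (hψ : IsCostConcave ψ) :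
    ∃ χ : S2 → ℝ, Continuous χ ∧ (∀ x y, ψ x + χ y ≤ sdist x y ^ 2 / 2) ∧
      ∀ x, ∃ y, ψ x + χ y = sdist x y ^ 2 / 2 := by
  -- The infimum that defines `ψ` need not be attained for an arbitrary `Φ`. The conjugate of `ψ` is
  -- continuous, so with it in place of `Φ` the infimum is a minimum.
  obtain ⟨χ, hc, hle, hatt⟩ := exists_infConv hψ.continuous.neg zero_le_one
  simp only [Pi.neg_apply, one_mul] at hle hatt
  obtain ⟨Φ, hΦ⟩ := hψ
  have hle' : ∀ x y, ψ x + χ y ≤ sdist x y ^ 2 / 2 := by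
    intro x y
    have h := hle y x
    rw [sdist_comm] at h
    linarith
  refine ⟨χ, hc, hle', fun x => ?_⟩
  -- The conjugate `χ` dominates `Φ`, so the double conjugate `g` lies below `ψ`; its minimizer is
  -- the contact point.
  have hΦχ : ∀ y, Φ y ≤ χ y := by
    intro y
    obtain ⟨z, hz⟩ := hatt y
    have h : ψ z ≤ sdist z y ^ 2 / 2 - Φ y := (hΦ z).1 ⟨y, rfl⟩
    rw [hz, sdist_comm]
    linarith
  obtain ⟨g, -, hgle, hgatt⟩ := exists_infConv hc.neg zero_le_one
  simp only [Pi.neg_apply, one_mul] at hgle hgatt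
  obtain ⟨y, hy⟩ := hgatt x
  have h1 : g x ≤ ψ x := by
    refine (hΦ x).2 ?_
    rintro _ ⟨z, rfl⟩
    have h2 := hgle x z
    have h3 := hΦχ z
    simp only
    linarith
  have h2 := hle' x y
  exact ⟨y, by linarith⟩

/-! ### The optimal map of a differentiable cost-concave potential -/

theorem nonneg_of_hasDerivAt_of_le {H : ℝ → ℝ} {D δ : ℝ} (hδ : 0 < δ) (hH : HasDerivAt H D 0)
    (hle : ∀ ε ∈ Ioc 0 δ, H 0 ≤ H ε) : 0 ≤ D := by
  have h := (hasDerivWithinAt_iff_tendsto_slope' (s := Ioi 0) (by simp)).mp hH.hasDerivWithinAt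
  refine ge_of_tendsto h ?_
  filter_upwards [Ioc_mem_nhdsGT hδ] with ε hε
  rw [slope_def_field, sub_zero]
  exact div_nonneg (sub_nonneg.mpr (hle ε hε)) hε.1.le

theorem norm_greatCircle {x : S2} {e : E3} (he : ‖e‖ = 1) (hxe : ⟪(x : E3), e⟫ = 0) (ε : ℝ) :
    ‖Real.cos ε • (x : E3) + Real.sin ε • e‖ = 1 := by
  have h : ‖Real.cos ε • (x : E3) + Real.sin ε • e‖ ^ 2 = 1 := by
    rw [norm_add_sq_real, norm_smul, norm_smul, inner_smul_left, inner_smul_right, hxe, norm_coe,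
      he]
    simp
  exact (pow_eq_one_iff_of_nonneg (norm_nonneg _) two_ne_zero).mp h

theorem hasDerivAt_along_greatCircle {q : S2 → ℝ} {x : S2}
    (hq : MDifferentiableAt (𝓡 2) 𝓘(ℝ, ℝ) q x) (e : E3) :
    HasDerivAt (fun ε : ℝ => ext q (Real.cos ε • (x : E3) + Real.sin ε • e)) ⟪sgrad q x, e⟫ 0 := by
  have h1 : HasDerivAt (fun ε : ℝ => Real.cos ε • (x : E3) + Real.sin ε • e) e 0 := by
    simpa using! ((Real.hasDerivAt_cos 0).smul_const (x : E3)).add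
      ((Real.hasDerivAt_sin 0).smul_const e)
  rw [inner_sgrad]
  have h2 : HasFDerivAt (ext q) (fderiv ℝ (ext q) x)
      (Real.cos 0 • (x : E3) + Real.sin 0 • e) := by
    simpa using (differentiableAt_ext hq).hasFDerivAt
  exact h2.comp_hasDerivAt (0 : ℝ) h1

/-- The direction is that of the tangential part of `y`, of norm `sin d(x, y)`. When `y = ± x` this
vanishes and any unit tangent vector works, so the given `v` is taken. -/
theorem exists_tangent_direction {x y : S2} {v : E3} (hv : ‖v‖ = 1) (hxv : ⟪(x : E3), v⟫ = 0) :
    ∃ f : E3, ‖f‖ = 1 ∧ ⟪(x : E3), f⟫ = 0 ∧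
      (y : E3) = Real.cos (sdist x y) • (x : E3) + Real.sin (sdist x y) • f := by
  set θ := sdist x y
  set u : E3 := y - Real.cos θ • (x : E3) with hu
  have hxu : ⟪(x : E3), u⟫ = 0 := by
    rw [hu, inner_sub_right, inner_smul_right, inner_coe_self, cos_sdist]; ring
  have hnu : ‖u‖ ^ 2 = Real.sin θ ^ 2 := by
    rw [hu, norm_sub_sq_real, norm_smul, inner_smul_right, real_inner_comm, ← cos_sdist, norm_coe,
      norm_coe, Real.sin_sq, Real.norm_eq_abs, mul_one, sq_abs]
    ring
  have hs : 0 ≤ Real.sin θ := Real.sin_nonneg_of_nonneg_of_le_pi (sdist_nonneg x y) (sdist_le_pi x y)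
  have hnu' : ‖u‖ = Real.sin θ := by
    rwa [sq_eq_sq₀ (norm_nonneg _) hs] at hnu
  by_cases h0 : Real.sin θ = 0
  · refine ⟨v, hv, hxv, ?_⟩
    rw [h0] at hnu' ⊢
    rw [norm_eq_zero, hu, sub_eq_zero] at hnu'
    rw [zero_smul, add_zero, ← hnu']
  · refine ⟨(Real.sin θ)⁻¹ • u, ?_, ?_, ?_⟩
    · rw [norm_smul, hnu', norm_inv, Real.norm_of_nonneg hs, inv_mul_cancel₀ h0]
    · rw [inner_smul_right, hxu, mul_zero]
    · rw [smul_smul, mul_inv_cancel₀ h0, one_smul, hu]; abel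

/-- At a point where `q` has a unit gradient `v` and where `ψ = -T q` is conjugate to `χ` with
contact point `y`, the contact point is `exp (T v)`. -/
theorem contact_point_eq_exp {q χ : S2 → ℝ} {T : ℝ} (hT : 0 < T)
    (hle : ∀ z y, -(T * q z) + χ y ≤ sdist z y ^ 2 / 2) {x y : S2}
    (hxy : -(T * q x) + χ y = sdist x y ^ 2 / 2) (hq : MDifferentiableAt (𝓡 2) 𝓘(ℝ, ℝ) q x)
    (hv : ‖sgrad q x‖ = 1) :
    sdist x y = T ∧ (y : E3) = Real.cos T • (x : E3) + Real.sin T • sgrad q x := by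
  set v := sgrad q x with hvdef
  have hxv : ⟪(x : E3), v⟫ = 0 := inner_sgrad_self q x
  obtain ⟨f, hf, hxf, hy⟩ := exists_tangent_direction (y := y) hv hxv
  set θ := sdist x y with hθ
  have hθ0 : 0 ≤ θ := sdist_nonneg x y
  have hθπ : θ ≤ Real.pi := sdist_le_pi x y
  have hmin : ∀ z, θ ^ 2 / 2 + T * q x ≤ sdist z y ^ 2 / 2 + T * q z := by
    intro z
    have := hle z y
    linarith
  have hdist : ∀ (e : E3) (he : ‖e‖ = 1) (hxe : ⟪(x : E3), e⟫ = 0) (ε : ℝ), ∃ z : S2,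
      (z : E3) = Real.cos ε • (x : E3) + Real.sin ε • e ∧
      ext q (Real.cos ε • (x : E3) + Real.sin ε • e) = q z := by
    intro e he hxe ε
    refine ⟨⟨_, mem_sphere_zero_iff_norm.mpr (norm_greatCircle he hxe ε)⟩, rfl, ?_⟩
    exact ext_coe q ⟨_, mem_sphere_zero_iff_norm.mpr (norm_greatCircle he hxe ε)⟩
  have hq0 : ∀ e : E3, ext q (Real.cos 0 • (x : E3) + Real.sin 0 • e) = q x := by
    intro e
    simp
  -- First variation against the gradient. The distance to `y` is only bounded above by `θ + ε`,
  -- which holds even if `y` is antipodal to `x`.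
  have h1 : 0 ≤ θ - T := by
    have hd := (((hasDerivAt_id (0 : ℝ)).const_add θ).pow 2).div_const 2 |>.add
      ((hasDerivAt_along_greatCircle hq (-v)).const_mul T)
    have hD := nonneg_of_hasDerivAt_of_le Real.pi_pos hd ?_
    · rw [← hvdef, inner_neg_right, real_inner_self_eq_norm_sq, hv] at hD
      simp at hD
      linarith
    · intro ε hε
      have he : ‖-v‖ = 1 := by rw [norm_neg, hv]
      have hxe : ⟪(x : E3), -v⟫ = 0 := by rw [inner_neg_right, hxv, neg_zero]
      obtain ⟨z, hz, hqz⟩ := hdist (-v) he hxe ε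
      have hxz : sdist x z = ε := by
        rw [sdist, hz, inner_add_right, inner_smul_right, inner_smul_right, hxe, inner_coe_self,
          mul_one, mul_zero, add_zero, Real.arccos_cos hε.1.le hε.2]
      have h2 := hmin z
      have h3 := sdist_triangle z x y
      rw [sdist_comm z x, hxz] at h3
      have h4 : sdist z y ^ 2 ≤ (θ + ε) ^ 2 :=
        pow_le_pow_left₀ (sdist_nonneg z y) (by linarith) 2
      simp only [Pi.add_apply, Pi.pow_apply, id, hq0, hqz]
      linarith
  -- First variation towards `y`, where the distance is exactly `θ - ε`. Room to move is available
  -- since `θ ≥ T > 0`.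
  have h2 : 0 ≤ -θ + T * ⟪v, f⟫ := by
    have hd := (((hasDerivAt_id (0 : ℝ)).const_sub θ).pow 2).div_const 2 |>.add
      ((hasDerivAt_along_greatCircle hq f).const_mul T)
    have hθpos : 0 < θ := by linarith
    have hD := nonneg_of_hasDerivAt_of_le hθpos hd ?_
    · simp at hD
      linarith
    · intro ε hε
      obtain ⟨z, hz, hqz⟩ := hdist f hf hxf ε
      have hzy : sdist z y = θ - ε := by
        have h3 : ⟪(z : E3), (y : E3)⟫ = Real.cos (θ - ε) := by
          rw [hz, hy, Real.cos_sub]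
          simp only [inner_add_left, inner_add_right, inner_smul_left, inner_smul_right, hxf,
            inner_coe_self, real_inner_comm (x : E3) f, real_inner_self_eq_norm_sq f, hf,
            conj_trivial]
          ring
        rw [sdist, h3, Real.arccos_cos (by linarith [hε.2]) (by linarith [hε.1])]
      have h3 := hmin z
      rw [hzy] at h3
      simp only [Pi.add_apply, Pi.pow_apply, id, hq0, hqz]
      linarith
  -- Now `T ≤ θ ≤ T ⟨v, f⟩ ≤ T`, so equality holds throughout, and equality in Cauchy-Schwarz gives
  -- `v = f`.
  have h3 : ⟪v, f⟫ ≤ 1 := by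
    have := real_inner_le_norm v f
    rwa [hv, hf, one_mul] at this
  have h4 : T * ⟪v, f⟫ ≤ T := by nlinarith
  have hθT : θ = T := by linarith
  have h5 : ⟪v, f⟫ = 1 := by nlinarith
  have h6 : v = f := (inner_eq_one_iff_of_norm_eq_one hv hf).mp h5
  exact ⟨hθT, by rw [← hθT, h6]; exact hy⟩

/-! ### Displacement interpolation -/

/-- Weak Kantorovich duality: the integral of `φ(w) - χ(z)` depends only on the marginals, so a
lower bound along the given pair of maps bounds the cost of every coupling. -/
theorem le_mul_of_mem_couplingCosts {α : Type*} [MeasurableSpace α] {P : Measure α}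
    [IsProbabilityMeasure P] {f g : α → S2} (hf : AEMeasurable f P) (hg : AEMeasurable g P)
    {φ χ : S2 → ℝ} (hφ : Continuous φ) (hχ : Continuous χ) {k D : ℝ}
    (hle : ∀ w z, φ w - χ z ≤ k * (sdist w z ^ 2 / 2))
    (hD : ∀ᵐ x ∂P, D ≤ φ (f x) - χ (g x)) {c : ℝ} (hc : c ∈ couplingCosts (P.map f) (P.map g)) :
    D ≤ k * c := by
  obtain ⟨π, h1, h2, rfl⟩ := hc
  have hP : IsProbabilityMeasure (P.map f) := Measure.isProbabilityMeasure_map hf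
  have hπ : IsProbabilityMeasure π := by
    refine ⟨?_⟩
    have h := hP.measure_univ
    rwa [← h1, Measure.map_apply measurable_fst MeasurableSet.univ, preimage_univ] at h
  have hint : ∀ {β : Type} [TopologicalSpace β] [CompactSpace β] [MeasurableSpace β]
      [BorelSpace β] (m : Measure β) [IsProbabilityMeasure m] {u : β → ℝ}, Continuous u →
      Integrable u m := fun m _ u hu =>
    (BoundedContinuousFunction.mkOfCompact ⟨u, hu⟩).integrable m
  have hcost : Continuous fun p : S2 × S2 => k * (sdist p.1 p.2 ^ 2 / 2) :=
    ((continuous_sdist.pow 2).div_const 2).const_mul k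
  have hφ1 : Continuous fun p : S2 × S2 => φ p.1 := hφ.comp continuous_fst
  have hχ2 : Continuous fun p : S2 × S2 => χ p.2 := hχ.comp continuous_snd
  have hφf : Integrable (fun x => φ (f x)) P :=
    (integrable_map_measure hφ.aestronglyMeasurable hf).mp (hint _ hφ)
  have hP' : IsProbabilityMeasure (P.map g) := Measure.isProbabilityMeasure_map hg
  have hχg : Integrable (fun x => χ (g x)) P :=
    (integrable_map_measure hχ.aestronglyMeasurable hg).mp (hint _ hχ)
  calc D = ∫ _, D ∂P := by simp
    _ ≤ ∫ x, (φ (f x) - χ (g x)) ∂P := integral_mono_ae (integrable_const _) (hφf.sub hχg) hD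
    _ = ∫ x, φ (f x) ∂P - ∫ x, χ (g x) ∂P := integral_sub hφf hχg
    _ = ∫ w, φ w ∂(P.map f) - ∫ z, χ z ∂(P.map g) := by
      rw [integral_map hf hφ.aestronglyMeasurable, integral_map hg hχ.aestronglyMeasurable]
    _ = ∫ p, φ p.1 ∂π - ∫ p, χ p.2 ∂π := by
      rw [← h1, ← h2, integral_map measurable_fst.aemeasurable hφ.aestronglyMeasurable,
        integral_map measurable_snd.aemeasurable hχ.aestronglyMeasurable]
    _ = ∫ p, (φ p.1 - χ p.2) ∂π := (integral_sub (hint π hφ1) (hint π hχ2)).symm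
    _ ≤ ∫ p, k * (sdist p.1 p.2 ^ 2 / 2) ∂π :=
      integral_mono (hint π (hφ1.sub hχ2)) (hint π hcost) fun p => hle p.1 p.2
    _ = k * ∫ p, sdist p.1 p.2 ^ 2 / 2 ∂π := integral_const_mul _ _

/-- Subadditivity of `(a, p) ↦ a²/p`; the defect is the square `(aq - bp)²`. It expresses that
splitting a journey into two timed legs cannot lower its cost. -/
theorem add_sq_div_le {a b p q : ℝ} (hp : 0 < p) (hq : 0 < q) :
    (a + b) ^ 2 / (p + q) ≤ a ^ 2 / p + b ^ 2 / q := by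
  rw [div_add_div _ _ hp.ne' hq.ne', div_le_div_iff₀ (by positivity) (by positivity)]
  nlinarith [sq_nonneg (a * q - b * p), mul_pos hp hq]

theorem sq_sdist_div_le (w z y : S2) {p q : ℝ} (hp : 0 < p) (hq : 0 < q) :
    sdist w y ^ 2 / (p + q) ≤ sdist w z ^ 2 / p + sdist z y ^ 2 / q := by
  refine le_trans ?_ (add_sq_div_le hp hq)
  have h := pow_le_pow_left₀ (sdist_nonneg w y) (sdist_triangle w z y) 2
  gcongr

/-- The Hopf-Lax potentials at intermediate times. -/
theorem exists_intermediate_potentials {ψ χ : S2 → ℝ} (hχ : Continuous χ)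
    (hle : ∀ x y, ψ x + χ y ≤ sdist x y ^ 2 / 2) {s t T : ℝ} (hs : 0 ≤ s) (hst : s < t)
    (htT : t ≤ T) : ∃ φs φt : S2 → ℝ, Continuous φs ∧ Continuous φt ∧
      (∀ w z, φs w - φt z ≤ (t - s)⁻¹ * (sdist w z ^ 2 / 2)) ∧
      ∀ x y w z, ψ x + χ y = T ^ 2 / 2 → sdist x w ≤ s → sdist z y ≤ T - t →
        (t - s) / 2 ≤ φs w - φt z := by
  have hTs : 0 < T - s := by linarith
  have hts : 0 < t - s := by linarith
  have hT : 0 < T := by linarith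
  have hf : Continuous fun y => -(χ y / T) := (hχ.div_const T).neg
  -- The Hopf-Lax potential with terminal datum `-χ/T` and remaining time `T - s`.
  obtain ⟨φs, hφs, hsle, hsatt⟩ := exists_infConv hf (inv_nonneg.mpr hTs.le)
  have hlow : ∀ x y w, ψ x + χ y = T ^ 2 / 2 → sdist x w ≤ s →
      (T - s) / 2 - χ y / T ≤ φs w := by
    intro x y w hxy hxw
    obtain ⟨y', hy'⟩ := hsatt w
    have h1 := hle x y'
    have h2 : sdist x y' ≤ s + sdist w y' := (sdist_triangle x w y').trans (by linarith)
    have h3 : sdist x y' ^ 2 ≤ (s + sdist w y') ^ 2 := pow_le_pow_left₀ (sdist_nonneg _ _) h2 2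
    -- Again subadditivity of `a²/p`, with first leg of length `s` in time `s`; writing the defect
    -- as a square allows `s = 0`.
    have h4 : (s + sdist w y') ^ 2 / T ≤ s + sdist w y' ^ 2 / (T - s) := by
      rw [← sub_nonneg]
      have : s + sdist w y' ^ 2 / (T - s) - (s + sdist w y') ^ 2 / T =
          s * (T - s - sdist w y') ^ 2 / (T * (T - s)) := by
        field_simp
        ring
      rw [this]
      positivity
    have h5 : (T ^ 2 / 2 - χ y + χ y') / T ≤ (s + sdist w y') ^ 2 / T / 2 := by
      rw [div_right_comm]
      exact div_le_div_of_nonneg_right (by linarith) hT.le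
    have h6 : (T ^ 2 / 2 - χ y + χ y') / T = T / 2 - χ y / T + χ y' / T := by field_simp
    have h7 : (T - s)⁻¹ * (sdist w y' ^ 2 / 2) = sdist w y' ^ 2 / (T - s) / 2 := by ring
    rw [hy', h7]
    linarith
  -- At `t = T` no time remains, and the Hopf-Lax potential is replaced by its terminal datum.
  rcases htT.lt_or_eq with hlt | heq
  · have hTt : 0 < T - t := by linarith
    obtain ⟨φt, hφt, htle, htatt⟩ := exists_infConv hf (inv_nonneg.mpr hTt.le)
    refine ⟨φs, φt, hφs, hφt, fun w z => ?_, fun x y w z hxy hxw hzy => ?_⟩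
    · obtain ⟨y, hy⟩ := htatt z
      have h1 := hsle w y
      have h2 := sq_sdist_div_le w z y hts hTt
      have h3 : t - s + (T - t) = T - s := by ring
      rw [h3] at h2
      have h4 : ∀ a b : ℝ, a⁻¹ * (b ^ 2 / 2) = b ^ 2 / a / 2 := fun a b => by ring
      rw [h4] at h1 hy ⊢
      linarith
    · have h1 := hlow x y w hxy hxw
      have h2 := htle z y
      have h3 : (T - t)⁻¹ * (sdist z y ^ 2 / 2) ≤ (T - t) / 2 := by
        have h4 := pow_le_pow_left₀ (sdist_nonneg z y) hzy 2
        rw [inv_mul_le_iff₀ hTt]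
        linarith
      linarith
  · subst heq
    refine ⟨φs, fun y => -(χ y / t), hφs, hf, fun w z => ?_, fun x y w z hxy hxw hzy => ?_⟩
    · have := hsle w z
      linarith
    · have hzy' : z = y := by
        have h0 : sdist z y = 0 := le_antisymm (by linarith) (sdist_nonneg z y)
        rw [sdist_eq_arcsin] at h0
        have h1 : ‖(z : E3) - y‖ / 2 = 0 := Real.arcsin_eq_zero_iff.mp (by linarith)
        exact Subtype.ext (sub_eq_zero.mp (norm_eq_zero.mp (by linarith)))
      have h1 := hlow x y w hxy hxw
      subst hzy'
      linarith

/-- Trajectories have unit speed, which gives the upper bound. For the lower bound, `X x s` and `X x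
t` lie on the minimal arc from `x` to its contact point, along which the Hopf-Lax potentials differ
by at least `(t - s)/2`. -/
theorem W2_map_greatCircle {τ : ℝ} (hτ : 0 < τ) {ρ₀ : Measure S2} [IsProbabilityMeasure ρ₀]
    {X : S2 → ℝ → S2} {V : S2 → ℝ → E3} {q₀ : S2 → ℝ} {T : ℝ}
    (hm : ∀ t ∈ Icc 0 τ, AEMeasurable (fun x => X x t) ρ₀)
    (hX : ∀ᵐ x ∂ρ₀, X x 0 = x ∧ IsFrameSolution (fun y => -y) τ (fun t => (X x t : E3)) (V x) ∧
      MDifferentiableAt (𝓡 2) 𝓘(ℝ, ℝ) q₀ x ∧ V x 0 = sgrad q₀ x)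
    (hT : 0 < T) (hconc : IsCostConcave (fun x => -(T * q₀ x))) {s t : ℝ} (hs : 0 ≤ s)
    (hst : s ≤ t) (htT : t ≤ min T τ) :
    W2 (ρ₀.map fun x => X x s) (ρ₀.map fun x => X x t) ^ 2 = (t - s) ^ 2 / 2 := by
  have htT' : t ≤ T := htT.trans (min_le_left _ _)
  have htτ : t ≤ τ := htT.trans (min_le_right _ _)
  have hsm : s ∈ Icc 0 τ := ⟨hs, hst.trans htτ⟩
  have htm : t ∈ Icc 0 τ := ⟨hs.trans hst, htτ⟩
  refine le_antisymm (W2_sq_map_le (hm s hsm) (hm t htm) ?_) ?_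
  · filter_upwards [hX] with x hx
    have h := sdist_le_of_norm_velocity_le (C := 1) hx.2.1.position
      (fun u hu => (greatCircle_velocity hτ hx.2.1 hu).1.le) hs hst htτ
    linarith
  rcases hst.eq_or_lt with heq | hlt
  · rw [← heq, sub_self]; simp [sq_nonneg]
  obtain ⟨χ, hχ, hle, hatt⟩ := hconc.exists_conjugate
  obtain ⟨φs, φt, hφs, hφt, hφ, hlow⟩ := exists_intermediate_potentials hχ hle hs hlt htT'
  have hpos : 0 < t - s := sub_pos.mpr hlt
  have hae : ∀ᵐ x ∂ρ₀, (t - s) / 2 ≤ φs (X x s) - φt (X x t) := by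
    filter_upwards [hX] with x hx
    obtain ⟨hx0, hsol, hq, hv⟩ := hx
    have hvel := (greatCircle_velocity hτ hsol (left_mem_Icc.mpr hτ.le)).1
    rw [hv] at hvel
    obtain ⟨y, hy⟩ := hatt x
    obtain ⟨hxy, hyexp⟩ := contact_point_eq_exp hT hle hy hq hvel
    -- A contact point at distance `T` exists, so `T ≤ π` comes for free and arcs up to time `T` are
    -- minimal.
    have hTπ : T ≤ Real.pi := hxy ▸ sdist_le_pi x y
    have hxv : ⟪(x : E3), sgrad q₀ x⟫ = 0 := inner_sgrad_self q₀ x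
    refine hlow x y _ _ (by rw [hy, hxy]) ?_ ?_
    · have h := sdist_greatCircle hτ hsol (left_mem_Icc.mpr hτ.le) hsm (by
        rw [sub_zero, abs_of_nonneg hs]; linarith)
      rw [hx0, sub_zero, abs_of_nonneg hs] at h
      exact h.le
    · have h3 : ⟪(X x t : E3), (y : E3)⟫ = Real.cos (T - t) := by
        rw [greatCircle_eq hsol htm, hyexp, hx0, hv, Real.cos_sub]
        simp only [inner_add_left, inner_add_right, inner_smul_left, inner_smul_right, hxv,
          inner_coe_self, real_inner_comm (x : E3) (sgrad q₀ x),
          real_inner_self_eq_norm_sq (sgrad q₀ x), hvel, conj_trivial]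
        ring
      rw [sdist, h3, Real.arccos_cos (by linarith) (by linarith [htm.1])]
  rw [W2_sq]
  refine le_csInf ⟨_, mem_couplingCosts_map (hm s hsm) (hm t htm)⟩ fun c hc => ?_
  have h := le_mul_of_mem_couplingCosts (hm s hsm) (hm t htm) hφs hφt hφ hae hc
  rw [← div_eq_inv_mul, le_div_iff₀ hpos] at h
  linarith

theorem isWassersteinGeodesic_greatCircle {τ : ℝ} (hτ : 0 < τ) {ρ₀ : Measure S2}
    [IsProbabilityMeasure ρ₀] {X : S2 → ℝ → S2} {V : S2 → ℝ → E3} {q₀ : S2 → ℝ} {T : ℝ}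
    (hm : ∀ t ∈ Icc 0 τ, AEMeasurable (fun x => X x t) ρ₀)
    (hX : ∀ᵐ x ∂ρ₀, X x 0 = x ∧ IsFrameSolution (fun y => -y) τ (fun t => (X x t : E3)) (V x) ∧
      MDifferentiableAt (𝓡 2) 𝓘(ℝ, ℝ) q₀ x ∧ V x 0 = sgrad q₀ x)
    (hT : 0 < T) (hconc : IsCostConcave (fun x => -(T * q₀ x))) :
    IsWassersteinGeodesic (min T τ) (fun t => ρ₀.map (fun x => X x t)) := by
  have hmin : 0 < min T τ := lt_min hT hτ
  have key : ∀ s ∈ Icc 0 (min T τ), ∀ t ∈ Icc 0 (min T τ), s ≤ t →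
      W2 (ρ₀.map fun x => X x s) (ρ₀.map fun x => X x t) = |t - s| / √2 := by
    intro s hs t ht hst
    have h := W2_map_greatCircle hτ hm hX hT hconc hs.1 hst ht.2
    rw [← Real.sqrt_sq (W2_nonneg _ _), h, Real.sqrt_div (sq_nonneg _), Real.sqrt_sq_eq_abs]
  intro s hs t ht
  have h0 := key 0 (left_mem_Icc.mpr hmin.le) _ (right_mem_Icc.mpr hmin.le) hmin.le
  rw [sub_zero, abs_of_pos hmin] at h0
  have h1 : W2 (ρ₀.map fun x => X x s) (ρ₀.map fun x => X x t) = |t - s| / √2 := by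
    rcases le_total s t with h | h
    · exact key s hs t ht h
    · rw [W2_symm, key t ht s hs h, abs_sub_comm]
  simp only [h0, h1]
  field_simp

/-! ### Joint measurability of continuous processes -/

/-- Each time has its own exceptional null set. Those of rational times merge into one measurable
null set, off which continuity in time determines the process; the modified process is measurable in
one variable and continuous in the other. -/
theorem aemeasurable_uncurry_of_continuousOn {α : Type*} [MeasurableSpace α] {P : Measure α}
    [SFinite P] {h : ℝ} (hh : 0 ≤ h) {Y : α → ℝ → E3}
    (hm : ∀ t ∈ Icc 0 h, AEMeasurable (fun p => Y p t) P)
    (hc : ∀ᵐ p ∂P, ContinuousOn (Y p) (Icc 0 h)) :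
    AEMeasurable (fun z : ℝ × α => Y z.2 z.1) ((volume.restrict (Icc 0 h)).prod P) := by
  classical
  set u : α → ℝ → E3 := fun p t => Y p (projIcc 0 h hh t) with hu
  have hum : ∀ t, AEMeasurable (fun p => u p t) P := fun t => hm _ (projIcc 0 h hh t).2
  have hgood : ∀ᵐ p ∂P, Continuous (u p) ∧ ∀ q : ℚ, u p q = (hum q).mk _ p := by
    refine Filter.Eventually.and ?_ (ae_all_iff.mpr fun q => (hum q).ae_eq_mk)
    filter_upwards [hc] with p hp
    exact hp.comp_continuous (continuous_subtype_val.comp continuous_projIcc)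
      fun t => (projIcc 0 h hh t).2
  set N : Set α := toMeasurable P {p | ¬(Continuous (u p) ∧ ∀ q : ℚ, u p q = (hum q).mk _ p)}
  have hN0 : P N = 0 := by rw [measure_toMeasurable]; exact hgood
  have hNm : MeasurableSet N := measurableSet_toMeasurable _ _
  have hNg : ∀ p, p ∉ N → Continuous (u p) ∧ ∀ q : ℚ, u p q = (hum q).mk _ p := by
    intro p hp
    by_contra hcon
    exact hp (subset_toMeasurable P _ hcon)
  set w : ℝ → α → E3 := fun t p => if p ∈ N then 0 else u p t with hw
  have hwc : ∀ p, Continuous fun t => w t p := by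
    intro p
    by_cases hp : p ∈ N
    · simpa [hw, hp] using continuous_const
    · simpa [hw, hp] using (hNg p hp).1
  have hwq : ∀ q : ℚ, Measurable (w q) := by
    intro q
    have : w q = fun p => if p ∈ N then 0 else (hum q).mk _ p := by
      funext p
      by_cases hp : p ∈ N
      · simp [hw, hp]
      · simp [hw, hp, (hNg p hp).2 q]
    rw [this]
    exact Measurable.ite hNm measurable_const (hum q).measurable_mk
  have hwm : ∀ t, Measurable (w t) := by
    intro t
    obtain ⟨r, -, hr⟩ := Real.exists_seq_rat_strictMono_tendsto t
    refine measurable_of_tendsto_metrizable (fun n => hwq (r n)) ?_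
    exact tendsto_pi_nhds.mpr fun p => ((hwc p).tendsto t).comp hr.2
  refine ⟨Function.uncurry w, measurable_uncurry_of_continuous_of_measurable hwc hwm, ?_⟩
  have h1 : ∀ᵐ z ∂(volume.restrict (Icc 0 h)).prod P, z.1 ∈ Icc 0 h :=
    Measure.quasiMeasurePreserving_fst.ae (ae_restrict_mem measurableSet_Icc)
  have h2 : ∀ᵐ z ∂(volume.restrict (Icc 0 h)).prod P, z.2 ∉ N :=
    Measure.quasiMeasurePreserving_snd.ae (measure_eq_zero_iff_ae_notMem.mp hN0)
  filter_upwards [h1, h2] with z hz1 hz2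
  simp only [Function.uncurry, hw, hz2, if_false, hu, projIcc_of_mem hh hz1]

/-! ### The action of solution curves and of their competitors -/

section Action

variable {Θ : S2 → ℝ} {h : ℝ} {X V : ℝ → E3}

/-- Pythagoras: the constraint force is normal and the potential force tangent. -/
theorem sq_norm_gField (Θ : S2 → ℝ) {x : E3} (hx : ‖x‖ = 1) :
    ‖gField Θ x‖ ^ 2 = 1 + ‖sgrad Θ x‖ ^ 2 := by
  rw [gField, norm_sub_sq_real, norm_neg, inner_neg_left, inner_sgrad_self, hx]
  ring

theorem enorm_sq_eq_ofReal (x : E3) : ‖x‖ₑ ^ 2 = ENNReal.ofReal (‖x‖ ^ 2) := by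
  rw [← ofReal_norm, ENNReal.ofReal_pow (norm_nonneg _)]

theorem IsFrameSolution.action_eq (hh : 0 < h) (hs : IsFrameSolution (gField Θ) h X V)
    (hX : ∀ t ∈ Icc 0 h, ‖X t‖ = 1) :
    action h X = ENNReal.ofReal (2 * h) + ∫⁻ t in Icc 0 h, ‖sgrad Θ (X t)‖ₑ ^ 2 := by
  have hu : UniqueDiffOn ℝ (Icc 0 h) := uniqueDiffOn_Icc hh
  have hd1 : ∀ t ∈ Icc 0 h, derivWithin X (Icc 0 h) t = V t := fun t ht =>
    (hs.position t ht).derivWithin (hu t ht)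
  have hd2 : ∀ t ∈ Icc 0 h, derivWithin (derivWithin X (Icc 0 h)) (Icc 0 h) t = gField Θ (X t) :=
    fun t ht => by
      rw [derivWithin_congr hd1 (hd1 t ht)]
      exact (hs.velocity t ht).derivWithin (hu t ht)
  have hint : ∀ t ∈ Icc 0 h, ‖derivWithin X (Icc 0 h) t‖ₑ ^ 2 +
      ‖derivWithin (derivWithin X (Icc 0 h)) (Icc 0 h) t‖ₑ ^ 2 = 2 + ‖sgrad Θ (X t)‖ₑ ^ 2 := by
    intro t ht
    rw [hd1 t ht, hd2 t ht, enorm_sq_eq_ofReal, enorm_sq_eq_ofReal, enorm_sq_eq_ofReal,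
      sq_norm_gField Θ (hX t ht), hs.norm_velocity hh hX ht,
      ENNReal.ofReal_add zero_le_one (sq_nonneg _), ← add_assoc, one_pow, ENNReal.ofReal_one,
      one_add_one_eq_two]
  rw [action, setLIntegral_congr_fun measurableSet_Icc hint, lintegral_add_left measurable_const]
  congr 1
  rw [setLIntegral_const, Real.volume_Icc, sub_zero, ENNReal.ofReal_mul zero_le_two,
    ENNReal.ofReal_ofNat]

theorem lintegral_Icc_eq_ofReal (hh : 0 ≤ h) {f : ℝ → ℝ} (hf : ContinuousOn f (Icc 0 h))
    (h0 : ∀ t, 0 ≤ f t) :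
    ∫⁻ t in Icc 0 h, ENNReal.ofReal (f t) = ENNReal.ofReal (∫ t in (0 : ℝ)..h, f t) := by
  rw [intervalIntegral.integral_of_le hh, ← integral_Icc_eq_integral_Ioc,
    ofReal_integral_eq_lintegral_ofReal (hf.integrableOn_compact isCompact_Icc)
      (Eventually.of_forall h0)]

/-- A path with the same initial and final velocities as a solution curve has a larger action, up
to terms that are small on short time intervals. -/
theorem le_action_of_competitor (hΘ : ContMDiff (𝓡 2) 𝓘(ℝ, ℝ) 2 Θ) (hh : 0 < h)
    (hs : IsFrameSolution (gField Θ) h X V) (hX : ∀ t ∈ Icc 0 h, ‖X t‖ = 1)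
    (hosc : ∀ t ∈ Icc 0 h, ‖gField Θ (X t) - gField Θ (X 0)‖ ^ 2 ≤ 1 / 2)
    {d : ℝ} (hd : d ^ 2 ≤ h / 2) {γ : ℝ → E3} (hγ : ContDiffOn ℝ 4 γ (Icc 0 h))
    (h0 : derivWithin γ (Icc 0 h) 0 = V 0) (h1 : derivWithin γ (Icc 0 h) h = V h) :
    ENNReal.ofReal (d ^ 2) + ∫⁻ t in Icc 0 h, ‖sgrad Θ (X t)‖ₑ ^ 2 ≤ action h γ := by
  have hu : UniqueDiffOn ℝ (Icc 0 h) := uniqueDiffOn_Icc hh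
  set γ₁ := derivWithin γ (Icc 0 h) with hγ₁
  set γ₂ := derivWithin γ₁ (Icc 0 h) with hγ₂
  have hc1 : ContDiffOn ℝ 3 γ₁ (Icc 0 h) := hγ.derivWithin hu (by norm_num)
  have hc2 : ContDiffOn ℝ 2 γ₂ (Icc 0 h) := hc1.derivWithin hu (by norm_num)
  have hXne : MapsTo X (Icc 0 h) {0}ᶜ := fun t ht h' => by
    have := hX t ht
    rw [h', norm_zero] at this
    exact zero_ne_one this
  have hsc : ContinuousOn (fun t => sgrad Θ (X t)) (Icc 0 h) :=
    (contDiffOn_sgrad hΘ).continuousOn.comp hs.continuousOn_position hXne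
  have hgc : ContinuousOn (fun t => gField Θ (X t)) (Icc 0 h) :=
    (contDiffOn_gField hΘ).continuousOn.comp hs.continuousOn_position hXne
  set a := gField Θ (X 0) with ha
  have hAc : ContinuousOn (fun t => ‖γ₁ t‖ ^ 2 + ‖γ₂ t‖ ^ 2) (Icc 0 h) :=
    (hc1.continuousOn.norm.pow 2).add (hc2.continuousOn.norm.pow 2)
  have hIc : ContinuousOn (fun t => ⟪a, γ₂ t - gField Θ (X t)⟫) (Icc 0 h) :=
    continuousOn_const.inner (hc2.continuousOn.sub hgc)
  have hSc : ContinuousOn (fun t => ‖sgrad Θ (X t)‖ ^ 2) (Icc 0 h) := hsc.norm.pow 2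
  have hact : action h γ = ENNReal.ofReal (∫ t in (0 : ℝ)..h, (‖γ₁ t‖ ^ 2 + ‖γ₂ t‖ ^ 2)) := by
    rw [← lintegral_Icc_eq_ofReal hh.le hAc fun t => by positivity, action]
    congr 1
    funext t
    rw [enorm_sq_eq_ofReal, enorm_sq_eq_ofReal, ← ENNReal.ofReal_add (sq_nonneg _) (sq_nonneg _)]
  have hS : ∫⁻ t in Icc 0 h, ‖sgrad Θ (X t)‖ₑ ^ 2 =
      ENNReal.ofReal (∫ t in (0 : ℝ)..h, ‖sgrad Θ (X t)‖ ^ 2) := by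
    rw [← lintegral_Icc_eq_ofReal hh.le hSc fun t => sq_nonneg _]
    simp only [enorm_sq_eq_ofReal]
  have hii : ∀ {f : ℝ → ℝ}, ContinuousOn f (Icc 0 h) → IntervalIntegrable f volume 0 h :=
    fun hf => ContinuousOn.intervalIntegrable (by rwa [uIcc_of_le hh.le])
  -- The integrand is the derivative of `a · (γ' - V)`, which vanishes at both ends.
  have hzero : ∫ t in (0 : ℝ)..h, ⟪a, γ₂ t - gField Θ (X t)⟫ = 0 := by
    have hder : ∀ t ∈ Icc 0 h, HasDerivWithinAt (fun t => ⟪a, γ₁ t - V t⟫)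
        ⟪a, γ₂ t - gField Θ (X t)⟫ (Icc 0 h) t := by
      intro t ht
      have e1 : HasDerivWithinAt γ₁ (γ₂ t) (Icc 0 h) t :=
        ((hc1.differentiableOn (by norm_num)) t ht).hasDerivWithinAt
      simpa using! (hasDerivWithinAt_const t (Icc 0 h) a).inner ℝ (e1.sub (hs.velocity t ht))
    rw [intervalIntegral.integral_eq_sub_of_hasDerivAt_of_le hh.le
      (fun t ht => (hder t ht).continuousWithinAt)
      (fun t ht => (hder t (Ioo_subset_Icc_self ht)).hasDerivAt (Icc_mem_nhds ht.1 ht.2))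
      (hii hIc), h0, h1]
    simp
  rw [hact, hS, ← ENNReal.ofReal_add (sq_nonneg _)
    (intervalIntegral.integral_nonneg hh.le fun t _ => sq_nonneg _)]
  refine ENNReal.ofReal_le_ofReal ?_
  -- Pointwise, `|γ'' - a|² ≥ 0` and `|g(X) - a|² ≤ 1/2` give `|γ''|² ≥ |g(X)|² - 1/2 + 2 a · (γ'' -
  -- g(X))`, and `|g(X)|² = 1 + |∇Θ|²`.
  have hlow : ∫ t in (0 : ℝ)..h, (1 / 2 + ‖sgrad Θ (X t)‖ ^ 2 +
      2 * ⟪a, γ₂ t - gField Θ (X t)⟫) ≤ ∫ t in (0 : ℝ)..h, (‖γ₁ t‖ ^ 2 + ‖γ₂ t‖ ^ 2) := by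
    refine intervalIntegral.integral_mono_on hh.le
      (hii ((continuousOn_const.add hSc).add (continuousOn_const.mul hIc))) (hii hAc) ?_
    intro t ht
    have e1 := hosc t ht
    have e2 := sq_norm_gField Θ (hX t ht)
    have e3 : 0 ≤ ‖γ₂ t - a‖ ^ 2 := sq_nonneg _
    rw [norm_sub_sq_real] at e1 e3
    rw [inner_sub_right, real_inner_comm (γ₂ t) a, real_inner_comm (gField Θ (X t)) a]
    nlinarith [sq_nonneg ‖γ₁ t‖]
  have i1 : IntervalIntegrable (fun _ => (1 / 2 : ℝ)) volume 0 h := hii continuousOn_const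
  have i2 : IntervalIntegrable (fun t => 1 / 2 + ‖sgrad Θ (X t)‖ ^ 2) volume 0 h :=
    hii (continuousOn_const.add hSc)
  have i3 : IntervalIntegrable (fun t => 2 * ⟪a, γ₂ t - gField Θ (X t)⟫) volume 0 h :=
    hii (continuousOn_const.mul hIc)
  rw [intervalIntegral.integral_add i2 i3, intervalIntegral.integral_add i1 (hii hSc),
    intervalIntegral.integral_const, intervalIntegral.integral_const_mul, hzero] at hlow
  simp only [smul_eq_mul] at hlow
  linarith

theorem exists_time_of_small_oscillation (hΘ : ContMDiff (𝓡 2) 𝓘(ℝ, ℝ) 2 Θ) :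
    ∃ h₀ : ℝ, 0 < h₀ ∧ h₀ ≤ 1 / 2 ∧ ∀ h : ℝ, 0 < h → h ≤ h₀ → ∀ X V : ℝ → E3,
      IsFrameSolution (gField Θ) h X V → (∀ t ∈ Icc 0 h, ‖X t‖ = 1) →
      ∀ t ∈ Icc 0 h, ‖gField Θ (X t) - gField Θ (X 0)‖ ^ 2 ≤ 1 / 2 := by
  have hsub : Metric.sphere (0 : E3) 1 ⊆ {0}ᶜ := fun x hx => coe_ne_zero ⟨x, hx⟩
  have huc : UniformContinuousOn (gField Θ) (Metric.sphere (0 : E3) 1) :=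
    (isCompact_sphere 0 1).uniformContinuousOn_of_continuous
      ((contDiffOn_gField hΘ).continuousOn.mono hsub)
  obtain ⟨δ, hδ, hosc⟩ := Metric.uniformContinuousOn_iff.mp huc (1 / 2) (by norm_num)
  -- At unit speed `δ / 2` keeps `X` strictly within the modulus of continuity `δ`; the bound `1 /
  -- 2` ensures `h² ≤ h / 2`, so that the squared distance fits into the surplus left by a
  -- competitor.
  refine ⟨min (1 / 2) (δ / 2), lt_min (by norm_num) (by linarith), min_le_left _ _, ?_⟩
  intro h hh hh0 X V hs hX t ht
  have hm0 : (0 : ℝ) ∈ Icc 0 h := left_mem_Icc.mpr hh.le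
  have hdist : ‖X t - X 0‖ ≤ 1 * ‖t - 0‖ :=
    (convex_Icc 0 h).norm_image_sub_le_of_norm_hasDerivWithin_le hs.position
      (fun u hu => (hs.norm_velocity hh hX hu).le) hm0 ht
  rw [sub_zero, Real.norm_of_nonneg ht.1, one_mul] at hdist
  have hlt : dist (X t) (X 0) < δ := by
    rw [dist_eq_norm]
    have := hh0.trans (min_le_right _ _)
    linarith [ht.2]
  have h1 := hosc (X t) (mem_sphere_zero_iff_norm.mpr (hX t ht)) (X 0)
    (mem_sphere_zero_iff_norm.mpr (hX 0 hm0)) hlt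
  rw [dist_eq_norm] at h1
  nlinarith [norm_nonneg (gField Θ (X t) - gField Θ (X 0))]

end Action

/-! ### The transport cost of the induced plan -/

theorem continuous_proj : Continuous TS2.proj :=
  Continuous.subtype_mk (continuous_fst.comp continuous_subtype_val) _

/-- Both bounds are pathwise estimates, integrated. Along solutions `2 W₂² ≤ h² ≤ 2h` when `h ≤ 2`;
for the cost `c`, `2 W₂²` is at most the mean of `d(x, X(h))²`, to which the estimate for
competitors applies. -/
theorem transport_cost_lower_bound {Θ : S2 → ℝ} (hΘ : ContMDiff (𝓡 2) 𝓘(ℝ, ℝ) 2 Θ) :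
    ∃ h₀ : ℝ, 0 < h₀ ∧ ∀ h : ℝ, 0 < h → ∀ (ρ₀ ρh : Measure TS2) (Z : TS2 → ℝ → TS2),
      IsProbabilityMeasure ρ₀ → (∀ t ∈ Icc 0 h, AEMeasurable (fun p => Z p t) ρ₀) →
      (∀ᵐ p ∂ρ₀, Z p 0 = p ∧
        IsFrameSolution (gField Θ) h (fun t => (Z p t).1.1) (fun t => (Z p t).1.2) ∧
        ∀ t ∈ Icc 0 h, ‖(Z p t).1.2‖ = 1) →
      ρh = ρ₀.map (fun p => Z p h) →
      (h ≤ 2 →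
        2 * ENNReal.ofReal (W2 (ρ₀.map TS2.proj) (ρh.map TS2.proj) ^ 2) +
            ∫⁻ t in Icc 0 h, ∫⁻ p, ‖sgrad Θ (Z p t).1.1‖ₑ ^ 2 ∂ρ₀
          ≤ ∫⁻ p, action h (fun t => (Z p t).1.1) ∂ρ₀) ∧
      (h ≤ h₀ →
        2 * ENNReal.ofReal (W2 (ρ₀.map TS2.proj) (ρh.map TS2.proj) ^ 2) +
            ∫⁻ t in Icc 0 h, ∫⁻ p, ‖sgrad Θ (Z p t).1.1‖ₑ ^ 2 ∂ρ₀
          ≤ ∫⁻ p, tangentCost h p (Z p h) ∂ρ₀) := by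
  obtain ⟨h₀, hh₀, hh₀', hosc⟩ := exists_time_of_small_oscillation hΘ
  refine ⟨h₀, hh₀, fun h hh ρ₀ ρh Z hprob hm hZ hρh => ?_⟩
  have hhm : h ∈ Icc 0 h := right_mem_Icc.mpr hh.le
  have hprojm : Measurable TS2.proj := continuous_proj.measurable
  have hgm : AEMeasurable (fun p => TS2.proj (Z p h)) ρ₀ := hprojm.comp_aemeasurable (hm h hhm)
  have hmap : ρh.map TS2.proj = ρ₀.map (fun p => TS2.proj (Z p h)) := by
    rw [hρh, AEMeasurable.map_map_of_aemeasurable hprojm.aemeasurable (hm h hhm)]; rfl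
  have hunit : ∀ p t, ‖(Z p t).1.1‖ = 1 := fun p t => (Z p t).2.1
  have hdist : ∀ᵐ p ∂ρ₀, sdist (TS2.proj p) (TS2.proj (Z p h)) ≤ h := by
    filter_upwards [hZ] with p hp
    have e := sdist_le_of_norm_velocity_le (X := fun t => TS2.proj (Z p t)) (C := 1)
      hp.2.1.position (fun u hu => (hp.2.2 u hu).le) le_rfl hh.le le_rfl
    simpa [hp.1] using e
  have hpos : AEMeasurable (fun z : ℝ × TS2 => (Z z.2 z.1).1.1)
      ((volume.restrict (Icc 0 h)).prod ρ₀) := by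
    refine aemeasurable_uncurry_of_continuousOn (Y := fun p t => (Z p t).1.1) hh.le
      (fun t ht => ?_) ?_
    · exact (measurable_fst.comp measurable_subtype_coe).comp_aemeasurable (hm t ht)
    · filter_upwards [hZ] with p hp
      exact hp.2.1.continuousOn_position
  have hsm : Measurable (fun x : E3 => ‖sgrad Θ x‖ₑ ^ 2) := by
    have : Measurable (sgrad Θ) := by
      refine measurable_of_continuousOn_compl_singleton 0 ?_
      exact (contDiffOn_sgrad hΘ).continuousOn
    exact this.enorm.pow_const 2
  have hswap : ∫⁻ t in Icc 0 h, ∫⁻ p, ‖sgrad Θ (Z p t).1.1‖ₑ ^ 2 ∂ρ₀ =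
      ∫⁻ p, (∫⁻ t in Icc 0 h, ‖sgrad Θ (Z p t).1.1‖ₑ ^ 2) ∂ρ₀ :=
    lintegral_lintegral_swap (f := fun t p => ‖sgrad Θ (Z p t).1.1‖ₑ ^ 2)
      (hsm.comp_aemeasurable hpos)
  rw [hmap, hswap]
  constructor
  · intro hh2
    have hact : ∀ᵐ p ∂ρ₀, action h (fun t => (Z p t).1.1) =
        ENNReal.ofReal (2 * h) + ∫⁻ t in Icc 0 h, ‖sgrad Θ (Z p t).1.1‖ₑ ^ 2 := by
      filter_upwards [hZ] with p hp
      exact hp.2.1.action_eq hh fun t _ => hunit p t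
    rw [lintegral_congr_ae hact, lintegral_add_left measurable_const]
    refine add_le_add ?_ le_rfl
    rw [lintegral_const, measure_univ, mul_one, ENNReal.ofReal_mul zero_le_two,
      ENNReal.ofReal_ofNat]
    refine mul_le_mul_right (ENNReal.ofReal_le_ofReal ?_) 2
    have := W2_sq_map_le hprojm.aemeasurable hgm hdist
    nlinarith
  · intro hhh0
    have hA : AEMeasurable (fun p => ENNReal.ofReal (sdist (TS2.proj p) (TS2.proj (Z p h)) ^ 2))
        ρ₀ := by
      have e := (continuous_sdist.pow 2).measurable.comp_aemeasurable
        (hprojm.aemeasurable.prodMk hgm)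
      exact ENNReal.measurable_ofReal.comp_aemeasurable e
    have hW : 2 * ENNReal.ofReal
        (W2 (ρ₀.map TS2.proj) (ρ₀.map (fun p => TS2.proj (Z p h))) ^ 2) ≤
        ∫⁻ p, ENNReal.ofReal (sdist (TS2.proj p) (TS2.proj (Z p h)) ^ 2) ∂ρ₀ := by
      have e1 := W2_sq_le_of_mem (mem_couplingCosts_map hprojm.aemeasurable hgm)
      rw [integral_div] at e1
      have hint : Integrable (fun p => sdist (TS2.proj p) (TS2.proj (Z p h)) ^ 2) ρ₀ := by
        refine Integrable.of_bound ((continuous_sdist.pow 2).measurable.comp_aemeasurable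
          (hprojm.aemeasurable.prodMk hgm)).aestronglyMeasurable (Real.pi ^ 2)
          (Eventually.of_forall fun p => ?_)
        rw [Real.norm_of_nonneg (sq_nonneg _)]
        exact pow_le_pow_left₀ (sdist_nonneg _ _) (sdist_le_pi _ _) 2
      rw [← ofReal_integral_eq_lintegral_ofReal hint (Eventually.of_forall fun p => sq_nonneg _)]
      have e2 : ∀ r : ℝ, 2 * ENNReal.ofReal r = ENNReal.ofReal (2 * r) := fun r => by
        rw [ENNReal.ofReal_mul zero_le_two, ENNReal.ofReal_ofNat]
      rw [e2]
      exact ENNReal.ofReal_le_ofReal (by linarith)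
    refine (add_le_add hW le_rfl).trans ?_
    -- Only the distance term has to be measurable here; the cost, an infimum over paths, is
    -- compared almost everywhere.
    rw [← lintegral_add_left' hA]
    refine lintegral_mono_ae ?_
    filter_upwards [hZ, hdist] with p hp hpd
    refine le_iInf₂ fun γ hγ => ?_
    obtain ⟨hγc, -, -, hγ0, -, hγ1⟩ := hγ
    have hX : ∀ t ∈ Icc 0 h, ‖(Z p t).1.1‖ = 1 := fun t _ => hunit p t
    refine le_action_of_competitor hΘ hh hp.2.1 hX (hosc h hh hhh0 _ _ hp.2.1 hX) ?_ hγc ?_ hγ1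
    · have := sdist_nonneg (TS2.proj p) (TS2.proj (Z p h))
      nlinarith
    · simp only [hp.1, hγ0]

/-! ### Derivatives with respect to a parameter -/

section Parameter

variable {F : Type*} [NormedAddCommGroup F] [NormedSpace ℝ F] {C : Set E3} {τ : ℝ}

theorem hasDerivWithinAt_integral [CompleteSpace F] {f : ℝ → F} (hf : ContinuousOn f (Icc 0 τ))
    {t : ℝ} (ht : t ∈ Icc 0 τ) :
    HasDerivWithinAt (fun t => ∫ u in (0 : ℝ)..t, f u) (f t) (Icc 0 τ) t := by
  have hτ : 0 ≤ τ := ht.1.trans ht.2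
  have hc : Continuous fun u => f (projIcc 0 τ hτ u) :=
    hf.comp_continuous (continuous_subtype_val.comp continuous_projIcc)
      fun u => (projIcc 0 τ hτ u).2
  have he : ∀ s ∈ Icc 0 τ,
      ∫ u in (0 : ℝ)..s, f u = ∫ u in (0 : ℝ)..s, f (projIcc 0 τ hτ u) := by
    intro s hs
    refine intervalIntegral.integral_congr fun u hu => ?_
    rw [uIcc_of_le hs.1] at hu
    simp only [projIcc_of_mem hτ (⟨hu.1, hu.2.trans hs.2⟩ : u ∈ Icc 0 τ)]
  have h := (hc.integral_hasStrictDerivAt 0 t).hasDerivAt.hasDerivWithinAt (s := Icc 0 τ)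
  simp only [projIcc_of_mem hτ ht] at h
  exact h.congr he (he t ht)

/-- The partial derivative in the space variable. -/
noncomputable def pderiv (G : E3 × ℝ → F) (p : E3 × ℝ) : E3 →L[ℝ] F :=
  fderiv ℝ (fun y => G (y, p.2)) p.1

theorem hasFDerivAt_slice (hC : IsOpen C) {G : E3 × ℝ → F}
    (hG : ContDiffOn ℝ 1 G (C ×ˢ Icc 0 τ)) {p : E3 × ℝ} (hp : p ∈ C ×ˢ Icc 0 τ) :
    HasFDerivAt (fun y => G (y, p.2))
      ((fderivWithin ℝ G (C ×ˢ Icc 0 τ) p).comp (ContinuousLinearMap.inl ℝ E3 ℝ)) p.1 := by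
  have h1 : HasFDerivWithinAt G (fderivWithin ℝ G (C ×ˢ Icc 0 τ) p) (C ×ˢ Icc 0 τ) (p.1, p.2) :=
    ((hG.differentiableOn (by norm_num)) p hp).hasFDerivWithinAt
  have h2 : HasFDerivWithinAt (fun y : E3 => (y, p.2)) (ContinuousLinearMap.inl ℝ E3 ℝ) C p.1 :=
    (hasFDerivAt_prodMk_left p.1 p.2).hasFDerivWithinAt
  have hm : MapsTo (fun y : E3 => (y, p.2)) C (C ×ˢ Icc 0 τ) := fun y hy => ⟨hy, hp.2⟩
  exact (h1.comp p.1 h2 hm).hasFDerivAt (hC.mem_nhds hp.1)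

theorem hasFDerivAt_pderiv (hC : IsOpen C) {G : E3 × ℝ → F}
    (hG : ContDiffOn ℝ 1 G (C ×ˢ Icc 0 τ)) {z : E3} {t : ℝ} (hz : z ∈ C) (ht : t ∈ Icc 0 τ) :
    HasFDerivAt (fun y => G (y, t)) (pderiv G (z, t)) z :=
  (hasFDerivAt_slice hC hG (p := (z, t)) ⟨hz, ht⟩).differentiableAt.hasFDerivAt

theorem continuousOn_pderiv (hC : IsOpen C) (hτ : 0 < τ) {G : E3 × ℝ → F}
    (hG : ContDiffOn ℝ 1 G (C ×ˢ Icc 0 τ)) : ContinuousOn (pderiv G) (C ×ˢ Icc 0 τ) := by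
  have h := (hG.continuousOn_fderivWithin (hC.uniqueDiffOn.prod (uniqueDiffOn_Icc hτ)) le_rfl)
  refine ContinuousOn.congr (h.clm_comp (continuousOn_const (c := ContinuousLinearMap.inl ℝ E3 ℝ)))
    fun p hp => ?_
  exact (hasFDerivAt_slice hC hG hp).fderiv

theorem hasFDerivAt_integral_slice [CompleteSpace F] (hC : IsOpen C) {G : E3 × ℝ → F}
    {G' : E3 × ℝ → E3 →L[ℝ] F} (hG : ContinuousOn G (C ×ˢ Icc 0 τ))
    (hG' : ContinuousOn G' (C ×ˢ Icc 0 τ))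
    (hd : ∀ z ∈ C, ∀ t ∈ Icc 0 τ, HasFDerivAt (fun y => G (y, t)) (G' (z, t)) z)
    {z : E3} (hz : z ∈ C) {t : ℝ} (ht : t ∈ Icc 0 τ) :
    HasFDerivAt (fun y => ∫ u in (0 : ℝ)..t, G (y, u)) (∫ u in (0 : ℝ)..t, G' (z, u)) z := by
  obtain ⟨r, hr, hball⟩ := Metric.nhds_basis_closedBall.mem_iff.mp (hC.mem_nhds hz)
  have hmem : ∀ y ∈ C, MapsTo (fun u : ℝ => (y, u)) (Icc 0 τ) (C ×ˢ Icc 0 τ) :=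
    fun y hy u hu => ⟨hy, hu⟩
  have hsub : ∀ u ∈ uIoc 0 t, u ∈ Icc 0 τ := by
    intro u hu
    rw [uIoc_of_le ht.1] at hu
    exact ⟨hu.1.le, hu.2.trans ht.2⟩
  have hsl : ∀ y ∈ C, ContinuousOn (fun u => G (y, u)) (Icc 0 τ) := fun y hy =>
    hG.comp (by fun_prop) (hmem y hy)
  have hsl' : ContinuousOn (fun u => G' (z, u)) (Icc 0 τ) := hG'.comp (by fun_prop) (hmem z hz)
  have hII : uIcc 0 t ⊆ Icc 0 τ := by
    rw [uIcc_of_le ht.1]; exact Icc_subset_Icc le_rfl ht.2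
  obtain ⟨K, hK⟩ := ((isCompact_closedBall z r).prod (isCompact_Icc (a := 0) (b := τ))).exists_bound_of_continuousOn
    (hG'.mono (prod_mono hball subset_rfl))
  have hi : ∀ y ∈ C, IntervalIntegrable (fun u => G (y, u)) volume 0 t := fun y hy =>
    ((hsl y hy).mono hII).intervalIntegrable
  have hi' : IntervalIntegrable (fun u => G' (z, u)) volume 0 t :=
    (hsl'.mono hII).intervalIntegrable
  refine intervalIntegral.hasFDerivAt_integral_of_dominated_of_fderiv_le (bound := fun _ => K)
    (F := fun y u => G (y, u)) (F' := fun y u => G' (y, u)) (μ := volume)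
    (Metric.closedBall_mem_nhds z hr) ?_ (hi z hz) hi'.def'.aestronglyMeasurable ?_
    intervalIntegrable_const ?_
  · filter_upwards [hC.mem_nhds hz] with y hy using (hi y hy).def'.aestronglyMeasurable
  · exact Eventually.of_forall fun u hu y hy => hK (y, u) ⟨hy, hsub u hu⟩
  · exact Eventually.of_forall fun u hu y hy => hd y (hball hy) u (hsub u hu)

/-- Time and space derivatives commute. -/
theorem hasDerivWithinAt_pderiv [CompleteSpace F] (hC : IsOpen C) {H G : E3 × ℝ → F}
    {H' G' : E3 × ℝ → E3 →L[ℝ] F} (hG : ContinuousOn G (C ×ˢ Icc 0 τ))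
    (hG' : ContinuousOn G' (C ×ˢ Icc 0 τ))
    (hd : ∀ z ∈ C, ∀ t ∈ Icc 0 τ, HasFDerivAt (fun y => G (y, t)) (G' (z, t)) z)
    (hH' : ∀ z ∈ C, ∀ t ∈ Icc 0 τ, HasFDerivAt (fun y => H (y, t)) (H' (z, t)) z)
    (hH : ∀ z ∈ C, ∀ t ∈ Icc 0 τ, HasDerivWithinAt (fun s => H (z, s)) (G (z, t)) (Icc 0 τ) t)
    {z : E3} (hz : z ∈ C) {t : ℝ} (ht : t ∈ Icc 0 τ) :
    HasDerivWithinAt (fun s => H' (z, s)) (G' (z, t)) (Icc 0 τ) t := by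
  have hm0 : (0 : ℝ) ∈ Icc 0 τ := ⟨le_rfl, ht.1.trans ht.2⟩
  have hmem : ∀ y ∈ C, MapsTo (fun u : ℝ => (y, u)) (Icc 0 τ) (C ×ˢ Icc 0 τ) :=
    fun y hy u hu => ⟨hy, hu⟩
  have hsl : ∀ y ∈ C, ContinuousOn (fun u => G (y, u)) (Icc 0 τ) := fun y hy =>
    hG.comp (by fun_prop) (hmem y hy)
  have hsl' : ContinuousOn (fun u => G' (z, u)) (Icc 0 τ) := hG'.comp (by fun_prop) (hmem z hz)
  -- Writing `H` as a time integral and differentiating under it avoids second derivatives of `H`.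
  have hrep : ∀ y ∈ C, ∀ s ∈ Icc 0 τ, H (y, s) = H (y, 0) + ∫ u in (0 : ℝ)..s, G (y, u) := by
    intro y hy
    refine eq_of_hasDerivWithinAt_eq (fun s hs => hH y hy s hs)
      (fun s hs => (hasDerivWithinAt_integral (hsl y hy) hs).const_add _) (by simp)
  have hrep' : ∀ s ∈ Icc 0 τ, H' (z, s) = H' (z, 0) + ∫ u in (0 : ℝ)..s, G' (z, u) := by
    intro s hs
    have h1 := (hH' z hz 0 hm0).add (hasFDerivAt_integral_slice hC hG hG' hd hz hs)
    have h2 := (hH' z hz s hs).congr_of_eventuallyEq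
      (f₁ := fun y => H (y, 0) + ∫ u in (0 : ℝ)..s, G (y, u)) (by
        filter_upwards [hC.mem_nhds hz] with y hy
        exact (hrep y hy s hs).symm)
    exact h2.unique h1
  exact ((hasDerivWithinAt_integral hsl' ht).const_add _).congr hrep' (hrep' t ht)

end Parameter

/-! ### Linear algebra of the surface curl -/

theorem cross_eq_smul_of_tangent {y p q : E3} (hy : ⟪y, y⟫ = 1) (hp : ⟪y, p⟫ = 0)
    (hq : ⟪y, q⟫ = 0) : cross p q = ⟪y, cross p q⟫ • y := by
  have h1 : cross y (cross p q) = 0 := by rw [cross_cross_eq, hp, hq]; simp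
  have h2 := cross_cross_eq y y (cross p q)
  rw [h1, hy, one_smul] at h2
  have h3 : cross y (0 : E3) = 0 := by simpa using cross_smul_right y 0 0
  rw [h3] at h2
  exact (sub_eq_zero.mp h2.symm).symm

theorem map_eq_sum_single {F : Type*} [NormedAddCommGroup F] [NormedSpace ℝ F] (L : E3 →L[ℝ] F)
    (a : E3) : L a = a 0 • L (EuclideanSpace.single 0 1) + a 1 • L (EuclideanSpace.single 1 1) +
      a 2 • L (EuclideanSpace.single 2 1) := by
  rw [← map_smul, ← map_smul, ← map_smul, ← map_add, ← map_add]
  congr 1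
  apply ext_coord <;> simp

/-- The curl is the axial vector of the antisymmetric part of `L`. -/
theorem inner_curl_cross (L : E3 →L[ℝ] E3) (a b : E3) :
    ⟪∑ i : Fin 3, cross (EuclideanSpace.single i 1) (L (EuclideanSpace.single i 1)), cross a b⟫ =
      ⟪L a, b⟫ - ⟪L b, a⟫ := by
  rw [map_eq_sum_single L a, map_eq_sum_single L b, Fin.sum_univ_three]
  simp only [inner_add_left, inner_smul_left, inner_cross_cross, conj_trivial]
  simp only [inner_eq_sum, PiLp.single_apply]
  simp
  ring

/-- The cross product of tangent vectors is normal, so only the normal part of the curl counts: it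
is the density of the exterior derivative of `v` against the area form. -/
theorem normalVorticity_mul {v : S2 → E3} {y : S2} {p q : E3} (hp : ⟪(y : E3), p⟫ = 0)
    (hq : ⟪(y : E3), q⟫ = 0) : normalVorticity v y * ⟪(y : E3), cross p q⟫ =
      ⟪fderiv ℝ (ext v) y p, q⟫ - ⟪fderiv ℝ (ext v) y q, p⟫ := by
  rw [← inner_curl_cross, normalVorticity, real_inner_comm]
  nth_rw 2 [cross_eq_smul_of_tangent (inner_coe_self y) hp hq]
  rw [inner_smul_right, mul_comm]
  rfl

/-! ### Derivative of the radial projection -/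

theorem hasFDerivAt_norm_coe (x : S2) :
    HasFDerivAt (fun y : E3 => ‖y‖) (innerSL ℝ (x : E3)) (x : E3) := by
  have h := ((hasStrictFDerivAt_norm_sq (x : E3)).hasFDerivAt).sqrt (by
    rw [norm_coe]; norm_num)
  simp only [Real.sqrt_sq (norm_nonneg _), norm_coe] at h
  convert! h using 1
  ext; simp

theorem fderiv_nrm_tangent {x : S2} {a : E3} (ha : ⟪(x : E3), a⟫ = 0) :
    fderiv ℝ (fun y => (nrm y : E3)) x a = a := by
  have h0 : {0}ᶜ ∈ 𝓝 (x : E3) := isOpen_compl_singleton.mem_nhds (coe_ne_zero x)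
  have hd : HasFDerivAt (fun y : E3 => ‖y‖⁻¹ • y) _ (x : E3) :=
    ((hasDerivAt_inv (x := ‖(x : E3)‖) (by rw [norm_coe]; norm_num)).comp_hasFDerivAt (x : E3)
      (hasFDerivAt_norm_coe x)).smul (hasFDerivAt_id (x : E3))
  have he : (fun y : E3 => (nrm y : E3)) =ᶠ[𝓝 (x : E3)] fun y => ‖y‖⁻¹ • y := by
    filter_upwards [h0] with y hy using coe_nrm hy
  rw [he.fderiv_eq, hd.fderiv]
  simp [ha]

/-! ### Flows with an Eulerian velocity field -/

/-- The flow `X`, with Eulerian velocity field `v`, of `C¹` solution curves on the sphere that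
start in the open region `U`. -/
structure IsEulerianFlow (Θ : S2 → ℝ) (τ : ℝ) (U : Set S2) (X : S2 → ℝ → S2)
    (v : ℝ → S2 → E3) : Prop where
  pos : 0 < τ
  potential : ContMDiff (𝓡 2) 𝓘(ℝ, ℝ) 2 Θ
  isOpen : IsOpen U
  init : ∀ x ∈ U, X x 0 = x
  solution : ∀ x ∈ U, IsFrameSolution (gField Θ) τ (fun t => (X x t : E3)) (fun t => v t (X x t))
  contMDiffOn_position : ContMDiffOn ((𝓡 2).prod 𝓘(ℝ, ℝ)) 𝓘(ℝ, E3) 1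
    (fun p : S2 × ℝ => (X p.1 p.2 : E3)) (U ×ˢ Icc 0 τ)
  contMDiffOn_velocity : ContMDiffOn ((𝓡 2).prod 𝓘(ℝ, ℝ)) 𝓘(ℝ, E3) 1
    (fun p : S2 × ℝ => v p.2 (X p.1 p.2)) (U ×ˢ Icc 0 τ)
  contMDiffOn_field : ∀ t ∈ Icc 0 τ, ContMDiffOn (𝓡 2) 𝓘(ℝ, E3) 1 (v t) ((fun x => X x t) '' U)

theorem contDiffOn_ext_prod {f : S2 × ℝ → E3} {U : Set S2} {τ : ℝ}
    (hf : ContMDiffOn ((𝓡 2).prod 𝓘(ℝ, ℝ)) 𝓘(ℝ, E3) 1 f (U ×ˢ Icc 0 τ)) :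
    ContDiffOn ℝ 1 (fun z : E3 × ℝ => f (nrm z.1, z.2)) (cone U ×ˢ Icc 0 τ) := by
  have h1 : ContMDiffOn 𝓘(ℝ, E3 × ℝ) (𝓡 2) 1 (fun z : E3 × ℝ => nrm z.1) (cone U ×ˢ Icc 0 τ) :=
    (contMDiffOn_nrm.of_le le_top).comp contDiff_fst.contMDiff.contMDiffOn fun z hz => hz.1.1
  have h2 : ContMDiffOn 𝓘(ℝ, E3 × ℝ) 𝓘(ℝ, ℝ) 1 (fun z : E3 × ℝ => z.2) (cone U ×ˢ Icc 0 τ) :=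
    contDiff_snd.contMDiff.contMDiffOn
  exact contMDiffOn_iff_contDiffOn.mp
    (hf.comp (h1.prodMk h2) fun z hz => ⟨hz.1.2, hz.2⟩)

/-- The position of a flow as a function on a subset of `ℝ³ × ℝ`. -/
noncomputable def posE (X : S2 → ℝ → S2) (z : E3 × ℝ) : E3 := X (nrm z.1) z.2

/-- The velocity of a flow as a function on a subset of `ℝ³ × ℝ`. -/
noncomputable def velE (X : S2 → ℝ → S2) (v : ℝ → S2 → E3) (z : E3 × ℝ) : E3 := v z.2 (X (nrm z.1) z.2)

namespace IsEulerianFlow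

variable {Θ : S2 → ℝ} {τ : ℝ} {U : Set S2} {X : S2 → ℝ → S2} {v : ℝ → S2 → E3}

theorem isOpen_cone (hf : IsEulerianFlow Θ τ U X v) : IsOpen (cone U) :=
  SphereFlow.isOpen_cone hf.isOpen

theorem contDiffOn_posE (hf : IsEulerianFlow Θ τ U X v) :
    ContDiffOn ℝ 1 (posE X) (cone U ×ˢ Icc 0 τ) := contDiffOn_ext_prod hf.contMDiffOn_position

theorem contDiffOn_velE (hf : IsEulerianFlow Θ τ U X v) :
    ContDiffOn ℝ 1 (velE X v) (cone U ×ˢ Icc 0 τ) := contDiffOn_ext_prod hf.contMDiffOn_velocity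

variable {z : E3} {t : ℝ}

theorem norm_velE (hf : IsEulerianFlow Θ τ U X v) (hz : z ∈ cone U) (ht : t ∈ Icc 0 τ) :
    ‖velE X v (z, t)‖ = 1 :=
  (hf.solution _ hz.2).norm_velocity hf.pos (fun _ _ => norm_coe _) ht

theorem norm_posE (X : S2 → ℝ → S2) (p : E3 × ℝ) : ‖posE X p‖ = 1 := norm_coe _

theorem posE_ne_zero (X : S2 → ℝ → S2) (p : E3 × ℝ) : posE X p ≠ 0 := coe_ne_zero _

theorem inner_posE_velE (hf : IsEulerianFlow Θ τ U X v) (hz : z ∈ cone U) (ht : t ∈ Icc 0 τ) :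
    ⟪posE X (z, t), velE X v (z, t)⟫ = 0 :=
  (hf.solution _ hz.2).inner_eq_zero hf.pos (fun _ _ => norm_coe _) ht

theorem hasFDerivAt_posE (hf : IsEulerianFlow Θ τ U X v) (hz : z ∈ cone U) (ht : t ∈ Icc 0 τ) :
    HasFDerivAt (fun y => posE X (y, t)) (pderiv (posE X) (z, t)) z :=
  hasFDerivAt_pderiv hf.isOpen_cone hf.contDiffOn_posE hz ht

theorem hasFDerivAt_velE (hf : IsEulerianFlow Θ τ U X v) (hz : z ∈ cone U) (ht : t ∈ Icc 0 τ) :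
    HasFDerivAt (fun y => velE X v (y, t)) (pderiv (velE X v) (z, t)) z :=
  hasFDerivAt_pderiv hf.isOpen_cone hf.contDiffOn_velE hz ht

/-! ### Linearized flow and pull-back of the velocity form. -/

theorem inner_posE_pderiv (hf : IsEulerianFlow Θ τ U X v) (hz : z ∈ cone U) (ht : t ∈ Icc 0 τ)
    (a : E3) : ⟪posE X (z, t), pderiv (posE X) (z, t) a⟫ = 0 := by
  have h := (hf.hasFDerivAt_posE hz ht).inner ℝ (hf.hasFDerivAt_posE hz ht)
  have h0 : HasFDerivAt (fun y => ⟪posE X (y, t), posE X (y, t)⟫) (0 : E3 →L[ℝ] ℝ) z := by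
    simp only [real_inner_self_eq_norm_sq, norm_posE]
    exact hasFDerivAt_const _ _
  have e := congrArg (fun L : E3 →L[ℝ] ℝ => L a) (h.unique h0)
  simp [fderivInnerCLM_apply, real_inner_comm (posE X (z, t))] at e
  linarith

theorem inner_velE_pderiv (hf : IsEulerianFlow Θ τ U X v) (hz : z ∈ cone U) (ht : t ∈ Icc 0 τ)
    (a : E3) : ⟪velE X v (z, t), pderiv (velE X v) (z, t) a⟫ = 0 := by
  have h := (hf.hasFDerivAt_velE hz ht).inner ℝ (hf.hasFDerivAt_velE hz ht)
  have h0 : HasFDerivAt (fun y => ⟪velE X v (y, t), velE X v (y, t)⟫) (0 : E3 →L[ℝ] ℝ) z := by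
    refine (hasFDerivAt_const (1 : ℝ) z).congr_of_eventuallyEq ?_
    filter_upwards [hf.isOpen_cone.mem_nhds hz] with y hy
    rw [real_inner_self_eq_norm_sq, hf.norm_velE hy ht, one_pow]
  have e := congrArg (fun L : E3 →L[ℝ] ℝ => L a) (h.unique h0)
  simp [fderivInnerCLM_apply, real_inner_comm (velE X v (z, t))] at e
  linarith

theorem inner_pderiv_velE_posE (hf : IsEulerianFlow Θ τ U X v) (hz : z ∈ cone U)
    (ht : t ∈ Icc 0 τ) (a : E3) : ⟪pderiv (velE X v) (z, t) a, posE X (z, t)⟫ =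
      -⟪velE X v (z, t), pderiv (posE X) (z, t) a⟫ := by
  have h := (hf.hasFDerivAt_posE hz ht).inner ℝ (hf.hasFDerivAt_velE hz ht)
  have h0 : HasFDerivAt (fun y => ⟪posE X (y, t), velE X v (y, t)⟫) (0 : E3 →L[ℝ] ℝ) z := by
    refine (hasFDerivAt_const (0 : ℝ) z).congr_of_eventuallyEq ?_
    filter_upwards [hf.isOpen_cone.mem_nhds hz] with y hy
    rw [hf.inner_posE_velE hy ht]
  have e := congrArg (fun L : E3 →L[ℝ] ℝ => L a) (h.unique h0)
  simp [fderivInnerCLM_apply] at e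
  rw [real_inner_comm, real_inner_comm (pderiv (posE X) (z, t) a)]
  linarith

/-- The linearized flow: the derivative of the position. -/
theorem hasDerivWithinAt_pderiv_posE (hf : IsEulerianFlow Θ τ U X v) (hz : z ∈ cone U)
    (ht : t ∈ Icc 0 τ) : HasDerivWithinAt (fun s => pderiv (posE X) (z, s))
      (pderiv (velE X v) (z, t)) (Icc 0 τ) t :=
  hasDerivWithinAt_pderiv hf.isOpen_cone hf.contDiffOn_velE.continuousOn
    (continuousOn_pderiv hf.isOpen_cone hf.pos hf.contDiffOn_velE)
    (fun _ hz _ ht => hf.hasFDerivAt_velE hz ht) (fun _ hz _ ht => hf.hasFDerivAt_posE hz ht)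
    (fun _ hz _ ht => (hf.solution _ hz.2).position _ ht) hz ht

theorem continuousOn_fderiv_comp {F : Type*} [NormedAddCommGroup F] [NormedSpace ℝ F] {f : E3 → F}
    (hf : IsEulerianFlow Θ τ U X v) (hd : ContDiffOn ℝ 1 f {0}ᶜ) :
    ContinuousOn (fun p => fderiv ℝ f (posE X p)) (cone U ×ˢ Icc 0 τ) :=
  (hd.continuousOn_fderiv_of_isOpen isOpen_compl_singleton le_rfl).comp
    hf.contDiffOn_posE.continuousOn fun p _ => posE_ne_zero X p

theorem hasFDerivAt_comp_posE {F : Type*} [NormedAddCommGroup F] [NormedSpace ℝ F] {f : E3 → F}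
    (hf : IsEulerianFlow Θ τ U X v) (hd : ContDiffOn ℝ 1 f {0}ᶜ) (hz : z ∈ cone U)
    (ht : t ∈ Icc 0 τ) : HasFDerivAt (fun y => f (posE X (y, t)))
      ((fderiv ℝ f (posE X (z, t))).comp (pderiv (posE X) (z, t))) z :=
  (((hd.contDiffAt (isOpen_compl_singleton.mem_nhds (posE_ne_zero X (z, t)))).differentiableAt
    (by norm_num)).hasFDerivAt).comp z (hf.hasFDerivAt_posE hz ht)

/-- The linearized flow: the derivative of the velocity. -/
theorem hasDerivWithinAt_pderiv_velE (hf : IsEulerianFlow Θ τ U X v) (hz : z ∈ cone U)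
    (ht : t ∈ Icc 0 τ) : HasDerivWithinAt (fun s => pderiv (velE X v) (z, s))
      ((fderiv ℝ (gField Θ) (posE X (z, t))).comp (pderiv (posE X) (z, t))) (Icc 0 τ) t := by
  have hg := contDiffOn_gField hf.potential
  refine hasDerivWithinAt_pderiv (G := fun p => gField Θ (posE X p))
    (H := velE X v) (H' := pderiv (velE X v))
    (G' := fun p => (fderiv ℝ (gField Θ) (posE X p)).comp (pderiv (posE X) p)) hf.isOpen_cone
    (hg.continuousOn.comp hf.contDiffOn_posE.continuousOn fun p _ => posE_ne_zero X p)
    ((hf.continuousOn_fderiv_comp hg).clm_comp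
      (continuousOn_pderiv hf.isOpen_cone hf.pos hf.contDiffOn_posE))
    (fun _ hz _ ht => hf.hasFDerivAt_comp_posE hg hz ht)
    (fun _ hz _ ht => hf.hasFDerivAt_velE hz ht)
    (fun _ hz _ ht => (hf.solution _ hz.2).velocity _ ht) hz ht

/-- The exterior derivative of the velocity, pulled back to the initial time, is constant. -/
theorem curl_pullback_eq (hf : IsEulerianFlow Θ τ U X v) (hz : z ∈ cone U) (ht : t ∈ Icc 0 τ)
    (a b : E3) :
    ⟪pderiv (velE X v) (z, t) a, pderiv (posE X) (z, t) b⟫ -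
      ⟪pderiv (velE X v) (z, t) b, pderiv (posE X) (z, t) a⟫ =
    ⟪pderiv (velE X v) (z, 0) a, pderiv (posE X) (z, 0) b⟫ -
      ⟪pderiv (velE X v) (z, 0) b, pderiv (posE X) (z, 0) a⟫ := by
  refine eq_of_hasDerivWithinAt_zero (f := fun t =>
    ⟪pderiv (velE X v) (z, t) a, pderiv (posE X) (z, t) b⟫ -
      ⟪pderiv (velE X v) (z, t) b, pderiv (posE X) (z, t) a⟫) (fun t ht => ?_) t ht
  have hA : ∀ c, HasDerivWithinAt (fun s => pderiv (posE X) (z, s) c)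
      (pderiv (velE X v) (z, t) c) (Icc 0 τ) t := fun c => by
    simpa using (hf.hasDerivWithinAt_pderiv_posE hz ht).clm_apply (hasDerivWithinAt_const t _ c)
  have hB : ∀ c, HasDerivWithinAt (fun s => pderiv (velE X v) (z, s) c)
      (fderiv ℝ (gField Θ) (posE X (z, t)) (pderiv (posE X) (z, t) c)) (Icc 0 τ) t := fun c => by
    simpa using (hf.hasDerivWithinAt_pderiv_velE hz ht).clm_apply (hasDerivWithinAt_const t _ c)
  have h := ((hB a).inner ℝ (hA b)).sub ((hB b).inner ℝ (hA a))
  convert! h using 1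
  -- The force terms cancel by symmetry of `Dg`, and `⟨D_aV, D_bV⟩` cancels by antisymmetrization.
  rw [inner_fderiv_gField_symm hf.potential (posE_ne_zero X (z, t)),
    real_inner_comm (pderiv (velE X v) (z, t) a)]
  ring

/-- The action density, integrated along trajectories. -/
noncomputable def phase (Θ : S2 → ℝ) (X : S2 → ℝ → S2) (p : E3 × ℝ) : ℝ :=
  ∫ u in (0 : ℝ)..p.2, ext Θ (posE X (p.1, u))

theorem contDiffOn_ext_potential (hf : IsEulerianFlow Θ τ U X v) : ContDiffOn ℝ 1 (ext Θ) {0}ᶜ := by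
  rw [← cone_univ]
  exact (contDiffOn_ext hf.potential.contMDiffOn).of_le (by norm_num)

/-- Weber's formula: the velocity, pulled back to the initial time, changes by a gradient. -/
theorem hasFDerivAt_phase (hf : IsEulerianFlow Θ τ U X v) (hz : z ∈ cone U) (ht : t ∈ Icc 0 τ) :
    HasFDerivAt (fun y => phase Θ X (y, t))
      ((innerSL ℝ (velE X v (z, 0))).comp (pderiv (posE X) (z, 0)) -
        (innerSL ℝ (velE X v (z, t))).comp (pderiv (posE X) (z, t))) z := by
  have hΘ := hf.contDiffOn_ext_potential
  set G' : E3 × ℝ → E3 →L[ℝ] ℝ := fun p =>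
    (fderiv ℝ (ext Θ) (posE X p)).comp (pderiv (posE X) p) with hG'
  have hcG' : ContinuousOn G' (cone U ×ˢ Icc 0 τ) :=
    (hf.continuousOn_fderiv_comp hΘ).clm_comp
      (continuousOn_pderiv hf.isOpen_cone hf.pos hf.contDiffOn_posE)
  have h := hasFDerivAt_integral_slice (G := fun p => ext Θ (posE X p)) (G' := G') hf.isOpen_cone
    (hΘ.continuousOn.comp hf.contDiffOn_posE.continuousOn fun p _ => posE_ne_zero X p) hcG'
    (fun _ hz _ ht => hf.hasFDerivAt_comp_posE hΘ hz ht) hz ht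
  have hslice : ContinuousOn (fun u => G' (z, u)) (Icc 0 τ) :=
    hcG'.comp (by fun_prop) fun u hu => ⟨hz, hu⟩
  convert! h using 1
  refine (eq_of_hasDerivWithinAt_eq (fun s hs => hasDerivWithinAt_integral hslice hs)
    (g := fun s => (innerSL ℝ (velE X v (z, 0))).comp (pderiv (posE X) (z, 0)) -
        (innerSL ℝ (velE X v (z, s))).comp (pderiv (posE X) (z, s))) (fun s hs => ?_)
    (by simp) t ht).symm
  have hv : HasDerivWithinAt (fun s => innerSL ℝ (velE X v (z, s)))
      (innerSL ℝ (gField Θ (posE X (z, s)))) (Icc 0 τ) s :=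
    (innerSL ℝ (E := E3)).hasFDerivAt.comp_hasDerivWithinAt s
      ((hf.solution _ hz.2).velocity s hs)
  have h1 := (hv.clm_comp (hf.hasDerivWithinAt_pderiv_posE hz hs)).const_sub
    ((innerSL ℝ (velE X v (z, 0))).comp (pderiv (posE X) (z, 0)))
  convert! h1 using 1
  ext a
  -- The time derivative of `⟨V, D_aX⟩` is `⟨g(X), D_aX⟩ + ⟨V, D_aV⟩`. Constant `|X|` and `|V|`
  -- remove everything but `-D_a(Θ(X))`.
  have e1 := hf.inner_posE_pderiv hz hs a
  have e2 := hf.inner_velE_pderiv hz hs a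
  simp [hG', gField, e1, e2, inner_sgrad]

/-- The derivative of the flow at the initial time is the identity on tangent vectors. -/
theorem pderiv_posE_zero (hf : IsEulerianFlow Θ τ U X v) {x : S2} (hx : x ∈ U) {a : E3}
    (ha : ⟪(x : E3), a⟫ = 0) : pderiv (posE X) (x, 0) a = a := by
  have he : (fun y : E3 => posE X (y, 0)) =ᶠ[𝓝 (x : E3)] fun y => (nrm y : E3) := by
    filter_upwards [hf.isOpen_cone.mem_nhds (coe_mem_cone.mpr hx)] with y hy
    simp only [posE, hf.init _ hy.2]
  simp only [pderiv]
  rw [he.fderiv_eq, fderiv_nrm_tangent ha]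

/-! #### The flow map is a local diffeomorphism -/

variable {x : S2}

theorem contDiffOn_ext_field (hf : IsEulerianFlow Θ τ U X v) (ht : t ∈ Icc 0 τ) :
    ContDiffOn ℝ 1 (ext (v t)) (cone ((fun x => X x t) '' U)) :=
  contDiffOn_ext (hf.contMDiffOn_field t ht)

theorem posE_coe (X : S2 → ℝ → S2) (x : S2) (t : ℝ) : posE X (x, t) = X x t := by
  simp [posE]

theorem velE_coe (X : S2 → ℝ → S2) (v : ℝ → S2 → E3) (x : S2) (t : ℝ) :
    velE X v (x, t) = v t (X x t) := by
  simp [velE]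

theorem ext_posE (X : S2 → ℝ → S2) (v : ℝ → S2 → E3) (z : E3) (t : ℝ) :
    ext (v t) (posE X (z, t)) = velE X v (z, t) := by
  simp [posE, velE]

/-- The velocity is a function of the position, so `D_aX = 0` at time `t` forces `D_aV = 0` there;
backward uniqueness for the linearized equation then gives `a = 0`. -/
theorem pderiv_posE_injective (hf : IsEulerianFlow Θ τ U X v) (hx : x ∈ U) (ht : t ∈ Icc 0 τ)
    {a : E3} (ha : ⟪(x : E3), a⟫ = 0) (h0 : pderiv (posE X) (x, t) a = 0) : a = 0 := by
  have hz : (x : E3) ∈ cone U := coe_mem_cone.mpr hx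
  have hmaps : MapsTo (fun y => posE X (y, t)) (cone U) (cone ((fun x => X x t) '' U)) := by
    intro y hy
    exact coe_mem_cone.mpr ⟨nrm y, hy.2, rfl⟩
  -- The image of `U` is not yet known to be open, so the field is differentiated only within its
  -- cone; the composite has a full derivative since `cone U` is open.
  have hw : HasFDerivWithinAt (ext (v t))
      (fderivWithin ℝ (ext (v t)) (cone ((fun x => X x t) '' U)) (posE X (x, t)))
      (cone ((fun x => X x t) '' U)) (posE X (x, t)) :=
    ((hf.contDiffOn_ext_field ht).differentiableOn (by norm_num) _ (hmaps hz)).hasFDerivWithinAt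
  have hcomp := (hw.comp (x : E3) (hf.hasFDerivAt_posE hz ht).hasFDerivWithinAt hmaps).hasFDerivAt
    (hf.isOpen_cone.mem_nhds hz)
  have he : ext (v t) ∘ (fun y => posE X (y, t)) = fun y => velE X v (y, t) := by
    funext y; exact ext_posE X v y t
  rw [he] at hcomp
  have hB : pderiv (velE X v) (x, t) a = 0 := by
    rw [(hf.hasFDerivAt_velE hz ht).unique hcomp, ContinuousLinearMap.comp_apply, h0, map_zero]
  have hg := contDiffOn_gField hf.potential
  have hDg : ContinuousOn (fun s => fderiv ℝ (gField Θ) (posE X ((x : E3), s))) (Icc 0 τ) :=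
    (hf.continuousOn_fderiv_comp hg).comp (by fun_prop) fun u hu => ⟨hz, hu⟩
  obtain ⟨K, hK⟩ := isCompact_Icc.exists_bound_of_continuousOn hDg
  have hzero := eq_zero_of_norm_deriv_le (K := max 1 K) ht
    (f := fun s => (pderiv (posE X) (x, s) a, pderiv (velE X v) (x, s) a))
    (f' := fun s => (pderiv (velE X v) (x, s) a,
      fderiv ℝ (gField Θ) (posE X (x, s)) (pderiv (posE X) (x, s) a)))
    (fun s hs => ?_) (fun s hs => ?_) (by rw [h0, hB]; rfl) 0 (left_mem_Icc.mpr ht.1)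
  · have := congrArg Prod.fst hzero
    simpa [hf.pderiv_posE_zero hx ha] using this
  · refine HasDerivWithinAt.prodMk ?_ ?_
    · simpa using (hf.hasDerivWithinAt_pderiv_posE hz hs).clm_apply (hasDerivWithinAt_const s _ a)
    · simpa using (hf.hasDerivWithinAt_pderiv_velE hz hs).clm_apply (hasDerivWithinAt_const s _ a)
  · rw [Prod.norm_def]
    refine max_le ?_ ?_
    · calc _ ≤ _ := norm_snd_le (pderiv (posE X) (x, s) a, pderiv (velE X v) (x, s) a)
        _ ≤ _ := le_mul_of_one_le_left (norm_nonneg _) (le_max_left _ _)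
    · refine (ContinuousLinearMap.le_of_opNorm_le _ (hK s hs) _).trans ?_
      exact mul_le_mul (le_max_right _ _)
        (norm_fst_le (pderiv (posE X) (x, s) a, pderiv (velE X v) (x, s) a)) (norm_nonneg _)
        (zero_le_one.trans (le_max_left _ _))

/-- The homogeneous extension of the flow map. -/
noncomputable def hom (X : S2 → ℝ → S2) (t : ℝ) (y : E3) : E3 := ‖y‖ • posE X (y, t)

theorem nrm_hom (X : S2 → ℝ → S2) (t : ℝ) {y : E3} (hy : y ≠ 0) : nrm (hom X t y) = X (nrm y) t := by
  rw [hom, nrm_smul (norm_pos_iff.mpr hy) _ (posE_ne_zero X _), posE, nrm_coe]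

/-- Extending with degree one sends the normal `x` to the normal `X x t`, which completes the
injective tangent map to an isomorphism of space; the inverse function theorem then applies in the
ambient space. -/
theorem exists_hasStrictFDerivAt_hom (hf : IsEulerianFlow Θ τ U X v) (hx : x ∈ U)
    (ht : t ∈ Icc 0 τ) : ∃ E : E3 ≃L[ℝ] E3, HasStrictFDerivAt (hom X t) (E : E3 →L[ℝ] E3) (x : E3) ∧
      ∀ a, E a = ⟪(x : E3), a⟫ • (X x t : E3) + pderiv (posE X) (x, t) a := by
  have hz : (x : E3) ∈ cone U := coe_mem_cone.mpr hx
  have hslice : ContDiffAt ℝ 1 (fun y => posE X (y, t)) (x : E3) :=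
    (hf.contDiffOn_posE.comp (s := cone U) (f := fun y : E3 => (y, t)) (by fun_prop)
      fun y hy => ⟨hy, ht⟩).contDiffAt (hf.isOpen_cone.mem_nhds hz)
  have hc : ContDiffAt ℝ 1 (hom X t) (x : E3) :=
    (contDiffAt_norm ℝ (coe_ne_zero x)).smul hslice
  have hd := (hasFDerivAt_norm_coe x).smul (hf.hasFDerivAt_posE hz ht)
  have hs := hc.hasStrictFDerivAt' hd one_ne_zero
  set D : E3 →L[ℝ] E3 := ‖(x : E3)‖ • pderiv (posE X) (x, t) +
    (innerSL ℝ (x : E3)).smulRight (posE X (x, t)) with hD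
  have hDa : ∀ a, D a = ⟪(x : E3), a⟫ • (X x t : E3) + pderiv (posE X) (x, t) a := by
    intro a
    simp [hD, posE_coe, add_comm]
  have hinj : Function.Injective (D : E3 →ₗ[ℝ] E3) := by
    rw [← LinearMap.ker_eq_bot, LinearMap.ker_eq_bot']
    intro a h0
    have h0 : D a = 0 := h0
    rw [hDa] at h0
    have h1 := congrArg (fun w => ⟪(X x t : E3), w⟫) h0
    have h2 := hf.inner_posE_pderiv hz ht a
    rw [posE_coe] at h2
    simp only [inner_add_right, inner_smul_right, inner_coe_self, h2, inner_zero_right, mul_one,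
      add_zero] at h1
    rw [h1, zero_smul, zero_add] at h0
    exact hf.pderiv_posE_injective hx ht h1 h0
  refine ⟨(LinearEquiv.ofInjectiveEndo (D : E3 →ₗ[ℝ] E3) hinj).toContinuousLinearEquiv, ?_, hDa⟩
  convert! hs using 1

theorem cone_image_mem_nhds (hf : IsEulerianFlow Θ τ U X v) (hx : x ∈ U) (ht : t ∈ Icc 0 τ) :
    cone ((fun x => X x t) '' U) ∈ 𝓝 (X x t : E3) := by
  obtain ⟨E, hE, -⟩ := hf.exists_hasStrictFDerivAt_hom hx ht
  have hz : (x : E3) ∈ cone U := coe_mem_cone.mpr hx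
  have hmap := hE.map_nhds_eq_of_equiv
  have h0 : hom X t x = X x t := by rw [hom, norm_coe, one_smul, posE_coe]
  rw [← h0, ← hmap]
  refine Filter.mem_map.mpr ?_
  filter_upwards [hf.isOpen_cone.mem_nhds hz] with y hy
  refine ⟨smul_ne_zero (norm_ne_zero_iff.mpr hy.1) (posE_ne_zero X _), ?_⟩
  rw [nrm_hom X t hy.1]
  exact ⟨nrm y, hy.2, rfl⟩

theorem hasFDerivAt_ext_field (hf : IsEulerianFlow Θ τ U X v) (hx : x ∈ U) (ht : t ∈ Icc 0 τ) :
    HasFDerivAt (ext (v t)) (fderiv ℝ (ext (v t)) (X x t : E3)) (X x t : E3) :=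
  (((hf.contDiffOn_ext_field ht).contDiffAt (hf.cone_image_mem_nhds hx ht)).differentiableAt
    (by norm_num)).hasFDerivAt

theorem fderiv_field_pderiv (hf : IsEulerianFlow Θ τ U X v) (hx : x ∈ U) (ht : t ∈ Icc 0 τ)
    (a : E3) : fderiv ℝ (ext (v t)) (X x t : E3) (pderiv (posE X) (x, t) a) =
      pderiv (velE X v) (x, t) a := by
  have hz : (x : E3) ∈ cone U := coe_mem_cone.mpr hx
  have h1 := hf.hasFDerivAt_ext_field hx ht
  rw [← posE_coe] at h1
  have h := h1.comp (x : E3) (hf.hasFDerivAt_posE hz ht)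
  have he : ext (v t) ∘ (fun y => posE X (y, t)) = fun y => velE X v (y, t) := by
    funext y; exact ext_posE X v y t
  rw [he] at h
  rw [(hf.hasFDerivAt_velE hz ht).unique h, posE_coe]
  rfl

/-- Every tangent vector at `X_t(x)` is the image of a tangent vector at `x`. -/
theorem exists_pderiv_posE_eq (hf : IsEulerianFlow Θ τ U X v) (hx : x ∈ U) (ht : t ∈ Icc 0 τ)
    {p : E3} (hp : ⟪(X x t : E3), p⟫ = 0) :
    ∃ a, ⟪(x : E3), a⟫ = 0 ∧ pderiv (posE X) (x, t) a = p := by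
  obtain ⟨E, -, hE⟩ := hf.exists_hasStrictFDerivAt_hom hx ht
  obtain ⟨a, ha⟩ := E.surjective p
  rw [hE] at ha
  have h2 := hf.inner_posE_pderiv (coe_mem_cone.mpr hx) ht a
  rw [posE_coe] at h2
  have h1 := congrArg (fun w => ⟪(X x t : E3), w⟫) ha
  simp only [inner_add_right, inner_smul_right, inner_coe_self, h2, hp, mul_one, add_zero] at h1
  rw [h1, zero_smul, zero_add] at ha
  exact ⟨a, h1, ha⟩

/-- Trajectories that meet at time `t` have the same velocity there, and `g` is Lipschitz on the
sphere, so they agree back to time zero. -/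
theorem injOn (hf : IsEulerianFlow Θ τ U X v) (ht : t ∈ Icc 0 τ) :
    InjOn (fun x => X x t) U := by
  intro x hx y hy hxy
  have hxy : X x t = X y t := hxy
  have hlip : ∃ K, LipschitzOnWith K (gField Θ) (Metric.sphere (0 : E3) 1) := by
    refine LocallyLipschitzOn.exists_lipschitzOnWith_of_compact (isCompact_sphere 0 1) ?_
    intro w hw
    have hw0 : w ≠ 0 := coe_ne_zero ⟨w, hw⟩
    obtain ⟨K, s, hs, hK⟩ := ((contDiffOn_gField hf.potential).contDiffAt
      (isOpen_compl_singleton.mem_nhds hw0)).exists_lipschitzOnWith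
    exact ⟨K, s, mem_nhdsWithin_of_mem_nhds hs, hK⟩
  obtain ⟨K, hK⟩ := hlip
  have hzero := eq_zero_of_norm_deriv_le (K := max 1 K) ht
    (f := fun s => ((X x s : E3) - X y s, v s (X x s) - v s (X y s)))
    (f' := fun s => (v s (X x s) - v s (X y s), gField Θ (X x s) - gField Θ (X y s)))
    (fun s hs => HasDerivWithinAt.prodMk
      (((hf.solution x hx).position s hs).sub ((hf.solution y hy).position s hs))
      (((hf.solution x hx).velocity s hs).sub ((hf.solution y hy).velocity s hs)))
    (fun s hs => ?_) (by rw [hxy, sub_self, sub_self]; rfl) 0 (left_mem_Icc.mpr ht.1)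
  · have h := congrArg Prod.fst hzero
    simp only [hf.init x hx, hf.init y hy, Prod.fst_zero] at h
    exact Subtype.ext (sub_eq_zero.mp h)
  · rw [Prod.norm_def]
    refine max_le ?_ ?_
    · calc _ ≤ _ := norm_snd_le ((X x s : E3) - X y s, v s (X x s) - v s (X y s))
        _ ≤ _ := le_mul_of_one_le_left (norm_nonneg _) (le_max_left _ _)
    · refine (hK.norm_sub_le (X x s).2 (X y s).2).trans ?_
      exact mul_le_mul (le_max_right _ _)
        (norm_fst_le ((X x s : E3) - X y s, v s (X x s) - v s (X y s))) (norm_nonneg _)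
        (zero_le_one.trans (le_max_left _ _))

/-! #### Vorticity -/

theorem dirDeriv_eq (X : S2 → ℝ → S2) (x : S2) (t : ℝ) (a : E3) :
    dirDeriv (fun y => X y t) x a = pderiv (posE X) (x, t) a := by
  have he : ext (fun y => (X y t : E3)) =ᶠ[𝓝 (x : E3)] fun y => posE X (y, t) := by
    filter_upwards [isOpen_compl_singleton.mem_nhds (coe_ne_zero x)] with y hy
    rw [ext_eq hy, posE]
  simp only [dirDeriv, pderiv, he.fderiv_eq]

theorem normalVorticity_mul_eq (hf : IsEulerianFlow Θ τ U X v) (hx : x ∈ U) (ht : t ∈ Icc 0 τ)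
    (a b : E3) : normalVorticity (v t) (X x t) *
      ⟪(X x t : E3), cross (pderiv (posE X) (x, t) a) (pderiv (posE X) (x, t) b)⟫ =
      ⟪pderiv (velE X v) (x, t) a, pderiv (posE X) (x, t) b⟫ -
        ⟪pderiv (velE X v) (x, t) b, pderiv (posE X) (x, t) a⟫ := by
  have hz : (x : E3) ∈ cone U := coe_mem_cone.mpr hx
  have h := fun c => posE_coe X x t ▸ hf.inner_posE_pderiv hz ht c
  rw [normalVorticity_mul (h a) (h b), hf.fderiv_field_pderiv hx ht, hf.fderiv_field_pderiv hx ht]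

theorem vorticity_transport (hf : IsEulerianFlow Θ τ U X v) (hx : x ∈ U) (ht : t ∈ Icc 0 τ)
    {a b : E3} (ha : ⟪(x : E3), a⟫ = 0) (hb : ⟪(x : E3), b⟫ = 0) :
    normalVorticity (v t) (X x t) * ⟪(X x t : E3), cross (dirDeriv (fun y => X y t) x a)
      (dirDeriv (fun y => X y t) x b)⟫ = normalVorticity (v 0) x * ⟪(x : E3), cross a b⟫ := by
  have hm0 : (0 : ℝ) ∈ Icc 0 τ := left_mem_Icc.mpr hf.pos.le
  have h0 := hf.normalVorticity_mul_eq hx hm0 a b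
  rw [← hf.curl_pullback_eq (coe_mem_cone.mpr hx) ht a b, hf.init x hx,
    hf.pderiv_posE_zero hx ha, hf.pderiv_posE_zero hx hb] at h0
  rw [dirDeriv_eq, dirDeriv_eq, hf.normalVorticity_mul_eq hx ht, h0]

/-! #### Circulation -/

theorem circulation_eq (hf : IsEulerianFlow Θ τ U X v) (ht : t ∈ Icc 0 τ) {c : ℝ → S2}
    (hc : ContDiffOn ℝ 1 (fun s => (c s : E3)) (Icc 0 1)) (hcU : ∀ s ∈ Icc (0 : ℝ) 1, c s ∈ U) :
    circulation (v t) (fun s => X (c s) t) =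
      ∫ s in (0 : ℝ)..1, ⟪velE X v (c s, t), pderiv (posE X) (c s, t)
        (derivWithin (fun s => (c s : E3)) (Icc 0 1) s)⟫ := by
  -- The endpoints are discarded: `deriv` is two-sided, while `c` is only controlled within `[0,
  -- 1]`.
  rw [circulation, intervalIntegral.integral_of_le zero_le_one,
    intervalIntegral.integral_of_le zero_le_one, integral_Ioc_eq_integral_Ioo,
    integral_Ioc_eq_integral_Ioo]
  refine setIntegral_congr_fun measurableSet_Ioo fun s hs => ?_
  have hsI : s ∈ Icc (0 : ℝ) 1 := Ioo_subset_Icc_self hs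
  have hd : HasDerivAt (fun s => (c s : E3)) (derivWithin (fun s => (c s : E3)) (Icc 0 1) s) s :=
    ((hc.differentiableOn (by norm_num)) s hsI).hasDerivWithinAt.hasDerivAt (Icc_mem_nhds hs.1 hs.2)
  have h := (hf.hasFDerivAt_posE (coe_mem_cone.mpr (hcU s hsI)) ht).comp_hasDerivAt s hd
  have he : (fun y => posE X (y, t)) ∘ (fun s => (c s : E3)) = fun r => (X (c r) t : E3) := by
    funext r; exact posE_coe X (c r) t
  rw [he] at h
  simp only [h.deriv, velE_coe]

/-- By Weber's formula the two integrands differ by the derivative of `phase` along `c`, which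
integrates to zero over a closed curve. -/
theorem circulation_invariant (hf : IsEulerianFlow Θ τ U X v) (ht : t ∈ Icc 0 τ) {c : ℝ → S2}
    (hc : ContDiffOn ℝ 1 (fun s => (c s : E3)) (Icc 0 1)) (hcU : ∀ s ∈ Icc (0 : ℝ) 1, c s ∈ U)
    (hclosed : c 0 = c 1) :
    circulation (v t) (fun s => X (c s) t) = circulation (v 0) c := by
  have hm0 : (0 : ℝ) ∈ Icc 0 τ := left_mem_Icc.mpr hf.pos.le
  have hinit : circulation (v 0) (fun s => X (c s) 0) = circulation (v 0) c := by
    rw [circulation, circulation, intervalIntegral.integral_of_le zero_le_one,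
      intervalIntegral.integral_of_le zero_le_one, integral_Ioc_eq_integral_Ioo,
      integral_Ioc_eq_integral_Ioo]
    refine setIntegral_congr_fun measurableSet_Ioo fun s hs => ?_
    have he : (fun r => (X (c r) 0 : E3)) =ᶠ[𝓝 s] fun r => (c r : E3) := by
      filter_upwards [Icc_mem_nhds hs.1 hs.2] with r hr
      rw [hf.init _ (hcU r hr)]
    simp only [he.deriv_eq, hf.init _ (hcU s (Ioo_subset_Icc_self hs))]
  rw [← hinit, hf.circulation_eq ht hc hcU, hf.circulation_eq hm0 hc hcU, ← sub_eq_zero]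
  set c' := derivWithin (fun s => (c s : E3)) (Icc 0 1) with hc'
  have hcc' : ContinuousOn c' (Icc 0 1) :=
    hc.continuousOn_derivWithin (uniqueDiffOn_Icc zero_lt_one) le_rfl
  have hmaps : ∀ u ∈ Icc 0 τ, MapsTo (fun s => ((c s : E3), u)) (Icc 0 1) (cone U ×ˢ Icc 0 τ) :=
    fun u hu s hs => ⟨coe_mem_cone.mpr (hcU s hs), hu⟩
  have hcont : ∀ u ∈ Icc 0 τ, ContinuousOn
      (fun s => ⟪velE X v (c s, u), pderiv (posE X) (c s, u) (c' s)⟫) (Icc 0 1) := by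
    intro u hu
    have hcu : ContinuousOn (fun s => ((c s : E3), u)) (Icc 0 1) :=
      hc.continuousOn.prodMk continuousOn_const
    exact (hf.contDiffOn_velE.continuousOn.comp hcu (hmaps u hu)).inner
      (((continuousOn_pderiv hf.isOpen_cone hf.pos hf.contDiffOn_posE).comp hcu
        (hmaps u hu)).clm_apply hcc')
  have hint : ∀ u ∈ Icc 0 τ, IntervalIntegrable
      (fun s => ⟪velE X v (c s, u), pderiv (posE X) (c s, u) (c' s)⟫) volume 0 1 :=
    fun u hu => ContinuousOn.intervalIntegrable (by
      rw [uIcc_of_le zero_le_one]; exact hcont u hu)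
  have hphase : ∀ s ∈ Icc (0 : ℝ) 1, HasDerivWithinAt (fun s => phase Θ X (c s, t))
      (⟪velE X v (c s, 0), pderiv (posE X) (c s, 0) (c' s)⟫ -
        ⟪velE X v (c s, t), pderiv (posE X) (c s, t) (c' s)⟫) (Icc 0 1) s := by
    intro s hs
    have hd : HasDerivWithinAt (fun s => (c s : E3)) (c' s) (Icc 0 1) s :=
      ((hc.differentiableOn (by norm_num)) s hs).hasDerivWithinAt
    exact (hf.hasFDerivAt_phase (coe_mem_cone.mpr (hcU s hs)) ht).comp_hasDerivWithinAt s hd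
  have hftc := intervalIntegral.integral_eq_sub_of_hasDerivAt_of_le zero_le_one
    (fun s hs => (hphase s hs).continuousWithinAt)
    (fun s hs => (hphase s (Ioo_subset_Icc_self hs)).hasDerivAt (Icc_mem_nhds hs.1 hs.2))
    ((hint 0 hm0).sub (hint t ht))
  rw [hclosed, sub_self, intervalIntegral.integral_sub (hint 0 hm0) (hint t ht)] at hftc
  linarith

/-! #### Potential flows -/

variable {q₀ : S2 → ℝ}

/-- The gradient of a function homogeneous of degree zero is homogeneous of degree `-1`, whence the
factor `‖y‖⁻¹`. -/
theorem hasFDerivAt_ext_of_gradient {w : S2 → E3} {y : E3} (hy : y ≠ 0)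
    (hq : MDifferentiableAt (𝓡 2) 𝓘(ℝ, ℝ) q₀ (nrm y)) (hw : w (nrm y) = sgrad q₀ (nrm y)) :
    HasFDerivAt (ext q₀) (innerSL ℝ (‖y‖⁻¹ • ext w y)) y := by
  have hpos : 0 < ‖y‖⁻¹ := inv_pos.mpr (norm_pos_iff.mpr hy)
  have h1 : HasFDerivAt (ext q₀) (innerSL ℝ (ext w y)) (‖y‖⁻¹ • y) := by
    rw [← coe_nrm hy, ext_eq hy, hw]
    convert! (differentiableAt_ext hq).hasFDerivAt using 1
    ext a
    simp [inner_sgrad]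
  have h2 : HasFDerivAt (fun x : E3 => ‖y‖⁻¹ • x) (‖y‖⁻¹ • ContinuousLinearMap.id ℝ E3) y :=
    (‖y‖⁻¹ • ContinuousLinearMap.id ℝ E3).hasFDerivAt
  have h3 := h1.comp y h2
  have he : ext q₀ ∘ (fun x : E3 => ‖y‖⁻¹ • x) = ext q₀ := by
    funext x; exact ext_smul hpos x
  rw [he] at h3
  convert! h3 using 1
  ext a
  simp

/-- A gradient field on an open region of the sphere has no normal vorticity. -/
theorem normalVorticity_zero_of_gradient (hf : IsEulerianFlow Θ τ U X v)
    (hq : ∀ x ∈ U, MDifferentiableAt (𝓡 2) 𝓘(ℝ, ℝ) q₀ x ∧ v 0 x = sgrad q₀ x) (hx : x ∈ U)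
    {a b : E3} (ha : ⟪(x : E3), a⟫ = 0) (hb : ⟪(x : E3), b⟫ = 0) :
    normalVorticity (v 0) x * ⟪(x : E3), cross a b⟫ = 0 := by
  have hz : (x : E3) ∈ cone U := coe_mem_cone.mpr hx
  have hm0 : (0 : ℝ) ∈ Icc 0 τ := left_mem_Icc.mpr hf.pos.le
  have hL := hf.hasFDerivAt_ext_field hx hm0
  rw [hf.init x hx] at hL
  have hinv := (hasDerivAt_inv (x := ‖(x : E3)‖) (by rw [norm_coe]; norm_num)).comp_hasFDerivAt
    (x : E3) (hasFDerivAt_norm_coe x)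
  have hsm := hinv.smul hL
  have hf'' := (innerSL ℝ (E := E3)).hasFDerivAt.comp (x : E3) hsm
  -- Although `q₀` is only assumed differentiable, its gradient is differentiable because `v 0` is.
  -- The derivative of `‖y‖⁻¹` is radial and drops out on tangent vectors.
  have hsym := second_derivative_symmetric_of_eventually (f := ext q₀)
    (f' := fun y => innerSL ℝ (‖y‖⁻¹ • ext (v 0) y)) (x := (x : E3)) (by
      filter_upwards [hf.isOpen_cone.mem_nhds hz] with y hy
      exact hasFDerivAt_ext_of_gradient hy.1 (hq _ hy.2).1 (hq _ hy.2).2) hf'' a b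
  rw [normalVorticity_mul ha hb]
  simp [ha, hb] at hsym
  exact sub_eq_zero.mpr hsym

/-- Pull the orthonormal pair `V`, `X × V` back to tangent vectors at `x`; the area factor at time
`t` is then `1`, and the transported density is zero. -/
theorem normalVorticity_eq_zero (hf : IsEulerianFlow Θ τ U X v)
    (hq : ∀ x ∈ U, MDifferentiableAt (𝓡 2) 𝓘(ℝ, ℝ) q₀ x ∧ v 0 x = sgrad q₀ x) (hx : x ∈ U)
    (ht : t ∈ Icc 0 τ) : normalVorticity (v t) (X x t) = 0 := by
  have hz : (x : E3) ∈ cone U := coe_mem_cone.mpr hx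
  have hV := hf.norm_velE hz ht
  have hXV := hf.inner_posE_velE hz ht
  rw [posE_coe, velE_coe] at hXV
  rw [velE_coe] at hV
  obtain ⟨a, ha, hpa⟩ := hf.exists_pderiv_posE_eq hx ht hXV
  obtain ⟨b, hb, hpb⟩ := hf.exists_pderiv_posE_eq hx ht
    (inner_self_cross (X x t : E3) (v t (X x t)))
  have h := hf.vorticity_transport hx ht ha hb
  rw [hf.normalVorticity_zero_of_gradient hq hx ha hb, dirDeriv_eq, dirDeriv_eq, hpa, hpb,
    cross_cross_eq, inner_sub_right, inner_smul_right, inner_smul_right,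
    inner_coe_self, real_inner_self_eq_norm_sq, hV, hXV] at h
  simpa using h

theorem scurl_eq (hf : IsEulerianFlow Θ τ U X v)
    (hq : ∀ x ∈ U, MDifferentiableAt (𝓡 2) 𝓘(ℝ, ℝ) q₀ x ∧ v 0 x = sgrad q₀ x) (hx : x ∈ U)
    (ht : t ∈ Icc 0 τ) : scurl (v t) (X x t) = cross (X x t) (v t (X x t)) := by
  have hz : (x : E3) ∈ cone U := coe_mem_cone.mpr hx
  have hV := hf.norm_velE hz ht
  have hXV := hf.inner_posE_velE hz ht
  rw [posE_coe, velE_coe] at hXV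
  rw [velE_coe] at hV
  set y : E3 := (X x t : E3) with hy
  set w : E3 := v t (X x t) with hw
  have hyy : ⟪y, y⟫ = 1 := inner_coe_self _
  have hww : ⟪w, w⟫ = 1 := by rw [real_inner_self_eq_norm_sq, hV, one_pow]
  -- The tangential part of the curl comes from tangency alone: the extended field is radially
  -- constant, and differentiating `X · V = 0` gives `y · D_d v = -w · d`.
  have hcurl : ∀ d, ⟪y, d⟫ = 0 → ⟪scurl (v t) (X x t), cross d y⟫ = -⟪w, d⟫ := by
    intro d hd
    obtain ⟨a, -, had⟩ := hf.exists_pderiv_posE_eq hx ht hd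
    have h1 := inner_curl_cross (fderiv ℝ (ext (v t)) y) d y
    have h2 : fderiv ℝ (ext (v t)) y y = 0 := fderiv_ext_self _ _
    have h3 := hf.inner_pderiv_velE_posE hz ht a
    rw [posE_coe, velE_coe, had, ← hf.fderiv_field_pderiv hx ht, had] at h3
    rw [h2, inner_zero_left, sub_zero] at h1
    exact h1.trans h3
  have e0 : ⟪scurl (v t) (X x t), y⟫ = 0 := by
    rw [real_inner_comm]; exact hf.normalVorticity_eq_zero hq hx ht
  have e1 : ⟪scurl (v t) (X x t), cross y w⟫ = 1 := by
    have h := hcurl w hXV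
    rw [cross_anticomm_eq y w, inner_neg_right, hww] at h
    linarith
  have e2 : ⟪scurl (v t) (X x t), w⟫ = 0 := by
    have h := hcurl (cross y w) (inner_self_cross y w)
    have h1 : cross (cross y w) y = w := by
      rw [cross_anticomm_eq y, cross_cross_eq, hXV, hyy]; simp
    rw [h1, inner_cross_self, neg_zero] at h
    exact h
  rw [eq_frame_expansion hyy hww hXV (scurl (v t) (X x t)), e0, e1, e2]
  simp

theorem frame_scurl_mem (hf : IsEulerianFlow Θ τ U X v)
    (hq : ∀ x ∈ U, MDifferentiableAt (𝓡 2) 𝓘(ℝ, ℝ) q₀ x ∧ v 0 x = sgrad q₀ x) (hx : x ∈ U)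
    (ht : t ∈ Icc 0 τ) : frame (X x t) (v t (X x t)) (scurl (v t) (X x t)) ∈
      Matrix.orthogonalGroup (Fin 3) ℝ := by
  have hz : (x : E3) ∈ cone U := coe_mem_cone.mpr hx
  have hV := hf.norm_velE hz ht
  have hXV := hf.inner_posE_velE hz ht
  rw [posE_coe, velE_coe] at hXV
  rw [velE_coe] at hV
  have hww : ⟪v t (X x t), v t (X x t)⟫ = 1 := by rw [real_inner_self_eq_norm_sq, hV, one_pow]
  rw [hf.scurl_eq hq hx ht]
  refine frame_mem_orthogonalGroup (inner_coe_self _) hww ?_ hXV (inner_self_cross _ _)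
    (inner_cross_self _ _)
  rw [inner_cross_cross, inner_coe_self, hww, hXV]
  simp

/-- Potential flow remains potential flow. -/
theorem exists_potential (hf : IsEulerianFlow Θ τ U X v)
    (hq : ∀ x ∈ U, MDifferentiableAt (𝓡 2) 𝓘(ℝ, ℝ) q₀ x ∧ v 0 x = sgrad q₀ x)
    (ht : t ∈ Icc 0 τ) : ∃ q : S2 → ℝ, ∀ y ∈ (fun x => X x t) '' U,
      MDifferentiableAt (𝓡 2) 𝓘(ℝ, ℝ) q y ∧ v t y = sgrad q y := by
  -- Weber's formula suggests the potential `(q₀ - phase) ∘ X_t⁻¹`, with the inverse taken on `U`.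
  set q : S2 → ℝ := fun y =>
    q₀ (Function.invFunOn (fun x => X x t) U y) -
      phase Θ X ((Function.invFunOn (fun x => X x t) U y : S2), t) with hqdef
  have hqX : ∀ x ∈ U, q (X x t) = q₀ x - phase Θ X (x, t) := by
    intro x hx
    have h := (hf.injOn ht).leftInvOn_invFunOn hx
    simp only [hqdef]
    rw [h]
  refine ⟨q, ?_⟩
  rintro _ ⟨x, hx, rfl⟩
  simp only
  have hz : (x : E3) ∈ cone U := coe_mem_cone.mpr hx
  have hm0 : (0 : ℝ) ∈ Icc 0 τ := left_mem_Icc.mpr hf.pos.le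
  obtain ⟨E, hE, hEa⟩ := hf.exists_hasStrictFDerivAt_hom hx ht
  set inv := hE.localInverse (hom X t) E x with hinv
  have hhx : hom X t x = X x t := by rw [hom, norm_coe, one_smul, posE_coe]
  have hinvx : inv (X x t) = x := by rw [← hhx]; exact hE.localInverse_apply_image
  have hdinv : HasFDerivAt inv (E.symm : E3 →L[ℝ] E3) (X x t : E3) := by
    rw [← hhx]; exact hE.to_localInverse.hasFDerivAt
  have hright : ∀ᶠ y in 𝓝 (X x t : E3), hom X t (inv y) = y := by
    rw [← hhx]; exact hE.eventually_right_inverse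
  have hP : HasFDerivAt (fun y => ext q₀ y - phase Θ X (y, t))
      ((innerSL ℝ (v t (X x t))).comp (pderiv (posE X) (x, t))) (x : E3) := by
    have h1 := (differentiableAt_ext (hq x hx).1).hasFDerivAt.sub (hf.hasFDerivAt_phase hz ht)
    convert! h1 using 1
    ext a
    have hsplit : a = ⟪(x : E3), a⟫ • (x : E3) + (a - ⟪(x : E3), a⟫ • (x : E3)) := by abel
    have htan : ⟪(x : E3), a - ⟪(x : E3), a⟫ • (x : E3)⟫ = 0 := by
      rw [inner_sub_right, inner_smul_right, inner_coe_self]; ring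
    have hrad : pderiv (posE X) (x, 0) (x : E3) = 0 := by
      have he : (fun y : E3 => posE X (y, 0)) =ᶠ[𝓝 (x : E3)] ext (fun y => (X y 0 : E3)) := by
        filter_upwards [isOpen_compl_singleton.mem_nhds (coe_ne_zero x)] with y hy
        rw [ext_eq hy, posE]
      simp only [pderiv]
      rw [he.fderiv_eq, fderiv_ext_self]
    have h2 : pderiv (posE X) (x, 0) a = a - ⟪(x : E3), a⟫ • (x : E3) := by
      nth_rw 1 [hsplit]
      rw [map_add, map_smul, hrad, smul_zero, zero_add, hf.pderiv_posE_zero hx htan]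
    have h3 : ⟪sgrad q₀ x, (x : E3)⟫ = 0 := by rw [real_inner_comm, inner_sgrad_self]
    simp [velE_coe, h2, ← inner_sgrad, hf.init x hx, (hq x hx).2, inner_sub_right,
      inner_smul_right, h3]
  have hcomp : HasFDerivAt (fun y => ext q₀ (inv y) - phase Θ X (inv y, t))
      (((innerSL ℝ (v t (X x t))).comp (pderiv (posE X) (x, t))).comp
        (E.symm : E3 →L[ℝ] E3)) (X x t : E3) := by
    exact HasFDerivAt.comp (X x t : E3) (by rwa [hinvx]) hdinv
  have hext : HasFDerivAt (ext q) (innerSL ℝ (v t (X x t))) (X x t : E3) := by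
    -- Injectivity on `U` identifies the set-theoretic inverse with the smooth local inverse of
    -- `hom`, up to a radial factor that neither function sees.
    have he : ext q =ᶠ[𝓝 (X x t : E3)] fun y => ext q₀ (inv y) - phase Θ X (inv y, t) := by
      have hcont : Tendsto inv (𝓝 (X x t : E3)) (𝓝 (x : E3)) := by
        have := hdinv.continuousAt.tendsto
        rwa [hinvx] at this
      filter_upwards [hright, hcont.eventually (hf.isOpen_cone.mem_nhds hz),
        isOpen_compl_singleton.mem_nhds (coe_ne_zero (X x t))] with y hy1 hy2 hy3
      have h1 : nrm y = X (nrm (inv y)) t := by rw [← nrm_hom X t hy2.1, hy1]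
      rw [ext_eq hy3, h1, hqX _ hy2.2, ext_eq hy2.1]
      simp [phase, posE]
    have h := hcomp.congr_of_eventuallyEq he
    convert! h using 1
    ext p
    obtain ⟨a, rfl⟩ := E.surjective p
    have hXV := hf.inner_posE_velE hz ht
    rw [posE_coe, velE_coe, real_inner_comm] at hXV
    have hr : (((innerSL ℝ (v t (X x t))).comp (pderiv (posE X) (x, t))).comp
        (E.symm : E3 →L[ℝ] E3)) (E a) = ⟪v t (X x t), pderiv (posE X) (x, t) a⟫ := by
      simp only [ContinuousLinearMap.comp_apply, ContinuousLinearEquiv.coe_coe,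
        ContinuousLinearEquiv.symm_apply_apply, innerSL_apply_apply]
    refine Eq.trans ?_ hr.symm
    -- The normal component added by `hom` is invisible to `V`, which is tangent.
    rw [innerSL_apply_apply, hEa, inner_add_right, inner_smul_right, hXV, mul_zero, zero_add]
  refine ⟨mdifferentiableAt_of_ext hext.differentiableAt, ?_⟩
  have hgrad : HasGradientAt (ext q) (v t (X x t)) (X x t : E3) := by
    rw [hasGradientAt_iff_hasFDerivAt]
    convert! hext using 1
  exact hgrad.gradient.symm

end IsEulerianFlow

end SphereFlow

/-! ### Assembly of the statements. -/

theorem proposition2 (τ : ℝ) (hτ : 0 < τ) :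
    -- (i) curvatures and Frenet matrix of a regular solution curve on the sphere
    (∀ (g : E3 → E3) (X V : ℝ → E3), IsFrameSolution g τ X V →
      (∀ t ∈ Icc 0 τ, ‖X t‖ = 1) → (∀ t ∈ Icc 0 τ, V t ≠ 0) →
      (∃ γ γ₁ γ₂ : ℝ → E3, IsArclengthParam τ X V γ γ₁ γ₂) ∧
      ∀ γ γ₁ γ₂ : ℝ → E3, IsArclengthParam τ X V γ γ₁ γ₂ →
        ∀ t ∈ Icc 0 τ, ∀ s : ℝ, s = arclength V t →
          normalCurvature (γ₂ s) (γ s) = -1 ∧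
          geodesicCurvature (γ₁ s) (γ₂ s) (γ s) = -⟪V t, cross (X t) (g (X t))⟫ / ‖V t‖ ^ 3 ∧
          frame (γ₁ s) (γ s) (cross (γ s) (γ₁ s)) ∈ Matrix.orthogonalGroup (Fin 3) ℝ ∧
          γ₂ s ≠ 0 ∧
          frame (γ₁ s) (‖γ₂ s‖⁻¹ • γ₂ s) (cross (γ₁ s) (‖γ₂ s‖⁻¹ • γ₂ s)) =
            frenetMatrix (normalCurvature (γ₂ s) (γ s))
                (geodesicCurvature (γ₁ s) (γ₂ s) (γ s)) *
              frame (γ₁ s) (γ s) (cross (γ s) (γ₁ s))) ∧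
    -- (ii) unit speed is equivalent to `X · V = 0` (and to staying on the sphere), for
    -- solutions in space that start in the tangent bundle of the sphere
    (∀ Θ : S2 → ℝ, ContMDiff (𝓡 2) 𝓘(ℝ, ℝ) 2 Θ →
      ∀ X V : ℝ → E3, IsFrameSolution (gField Θ) τ X V → (∀ t ∈ Icc 0 τ, X t ≠ 0) →
      ‖X 0‖ = 1 → ⟪X 0, V 0⟫ = 0 →
      ((∀ t ∈ Icc 0 τ, ⟪X t, V t⟫ = 0) ↔ ∀ t ∈ Icc 0 τ, ‖V t‖ = 1) ∧
      ((∀ t ∈ Icc 0 τ, ‖V t‖ = 1) ↔ ∀ t ∈ Icc 0 τ, ‖X t‖ = 1) ∧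
      ((∀ t ∈ Icc 0 τ, ‖V t‖ = 1) →
        ∀ γ γ₁ γ₂ : ℝ → E3, IsArclengthParam τ X V γ γ₁ γ₂ →
          ∀ t ∈ Icc 0 τ, ∀ s : ℝ, s = arclength V t →
            |geodesicCurvature (γ₁ s) (γ₂ s) (γ s)| = ‖sgrad Θ (X t)‖)) ∧
    -- (iii) transport cost: for the action along the solution curves, and for the cost `c`
    -- of the transport plan that the flow induces
    (∀ Θ : S2 → ℝ, ContMDiff (𝓡 2) 𝓘(ℝ, ℝ) 2 Θ →
      ∃ h₀ : ℝ, 0 < h₀ ∧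
      ∀ h : ℝ, 0 < h →
      ∀ (ρ₀ ρh : Measure TS2) (Z : TS2 → ℝ → TS2), IsProbabilityMeasure ρ₀ →
      (∀ t ∈ Icc 0 h, AEMeasurable (fun p => Z p t) ρ₀) →
      (∀ᵐ p ∂ρ₀, Z p 0 = p ∧
        IsFrameSolution (gField Θ) h (fun t => (Z p t).1.1) (fun t => (Z p t).1.2) ∧
        ∀ t ∈ Icc 0 h, ‖(Z p t).1.2‖ = 1) →
      ρh = ρ₀.map (fun p => Z p h) →
      (h ≤ 2 →
        2 * ENNReal.ofReal (W2 (ρ₀.map TS2.proj) (ρh.map TS2.proj) ^ 2) +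
            ∫⁻ t in Icc 0 h, ∫⁻ p, ‖sgrad Θ (Z p t).1.1‖ₑ ^ 2 ∂ρ₀
          ≤ ∫⁻ p, action h (fun t => (Z p t).1.1) ∂ρ₀) ∧
      (h ≤ h₀ →
        2 * ENNReal.ofReal (W2 (ρ₀.map TS2.proj) (ρh.map TS2.proj) ^ 2) +
            ∫⁻ t in Icc 0 h, ∫⁻ p, ‖sgrad Θ (Z p t).1.1‖ₑ ^ 2 ∂ρ₀
          ≤ ∫⁻ p, tangentCost h p (Z p h) ∂ρ₀)) ∧
    -- (iv) vorticity of a `C¹` flow with Eulerian velocity field `v` on a region `U`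
    (∀ Θ : S2 → ℝ, ContMDiff (𝓡 2) 𝓘(ℝ, ℝ) 2 Θ →
      ∀ (U : Set S2) (X : S2 → ℝ → S2) (v : ℝ → S2 → E3), IsOpen U →
      (∀ x ∈ U, X x 0 = x ∧
        IsFrameSolution (gField Θ) τ (fun t => (X x t : E3)) (fun t => v t (X x t))) →
      ContMDiffOn ((𝓡 2).prod 𝓘(ℝ, ℝ)) 𝓘(ℝ, E3) 1
        (fun p : S2 × ℝ => (X p.1 p.2 : E3)) (U ×ˢ Icc 0 τ) →
      ContMDiffOn ((𝓡 2).prod 𝓘(ℝ, ℝ)) 𝓘(ℝ, E3) 1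
        (fun p : S2 × ℝ => v p.2 (X p.1 p.2)) (U ×ˢ Icc 0 τ) →
      (∀ t ∈ Icc 0 τ, ContMDiffOn (𝓡 2) 𝓘(ℝ, E3) 1 (v t) ((fun x => X x t) '' U)) →
      (∀ t ∈ Icc 0 τ, ∀ x ∈ U, ∀ a b : E3, ⟪(x : E3), a⟫ = 0 → ⟪(x : E3), b⟫ = 0 →
        normalVorticity (v t) (X x t) *
            ⟪(X x t : E3), cross (dirDeriv (fun y => X y t) x a)
              (dirDeriv (fun y => X y t) x b)⟫
          = normalVorticity (v 0) x * ⟪(x : E3), cross a b⟫) ∧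
      (∀ c : ℝ → S2, ContDiffOn ℝ 1 (fun s => (c s : E3)) (Icc 0 1) →
        (∀ s ∈ Icc (0 : ℝ) 1, c s ∈ U) → c 0 = c 1 →
        ∀ t ∈ Icc 0 τ, circulation (v t) (fun s => X (c s) t) = circulation (v 0) c) ∧
      (∀ q₀ : S2 → ℝ,
        (∀ x ∈ U, MDifferentiableAt (𝓡 2) 𝓘(ℝ, ℝ) q₀ x ∧ v 0 x = sgrad q₀ x) →
        ∀ t ∈ Icc 0 τ,
          (∀ x ∈ U, normalVorticity (v t) (X x t) = 0 ∧
            scurl (v t) (X x t) = cross (X x t) (v t (X x t)) ∧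
            frame (X x t) (v t (X x t)) (scurl (v t) (X x t)) ∈
              Matrix.orthogonalGroup (Fin 3) ℝ) ∧
          ∃ q : S2 → ℝ, ∀ y ∈ (fun x => X x t) '' U,
            MDifferentiableAt (𝓡 2) 𝓘(ℝ, ℝ) q y ∧ v t y = sgrad q y)) ∧
    -- (v) absolute continuity of the induced path of measures
    (∀ (g : E3 → E3) (ρ₀ : Measure S2) (X : S2 → ℝ → S2) (V : S2 → ℝ → E3) (C : ℝ),
      IsProbabilityMeasure ρ₀ →
      (∀ t ∈ Icc 0 τ, AEMeasurable (fun x => X x t) ρ₀) →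
      (∀ᵐ x ∂ρ₀, X x 0 = x ∧ IsFrameSolution g τ (fun t => (X x t : E3)) (V x) ∧
        ∀ t ∈ Icc 0 τ, ‖V x t‖ ≤ C) →
      (∀ t ∈ Icc 0 τ, IsProbabilityMeasure (ρ₀.map (fun x => X x t))) ∧
      IsTwoAbsolutelyContinuous τ (fun t => ρ₀.map (fun x => X x t))) ∧
    -- (vi) the case `g(X) = -X`: geodesics on the sphere and in Wasserstein space
    (∀ (X : ℝ → S2) (V : ℝ → E3),
      IsFrameSolution (fun x => -x) τ (fun t => (X t : E3)) V →
      (∀ t ∈ Icc 0 τ, (X t : E3) = Real.cos t • (X 0 : E3) + Real.sin t • V 0) ∧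
      ∀ s ∈ Icc 0 τ, ∀ t ∈ Icc 0 τ, |t - s| ≤ Real.pi → sdist (X s) (X t) = |t - s|) ∧
    (∀ (ρ₀ : Measure S2) (X : S2 → ℝ → S2) (V : S2 → ℝ → E3) (q₀ : S2 → ℝ) (T : ℝ),
      IsProbabilityMeasure ρ₀ →
      (∀ t ∈ Icc 0 τ, AEMeasurable (fun x => X x t) ρ₀) →
      (∀ᵐ x ∂ρ₀, X x 0 = x ∧
        IsFrameSolution (fun y => -y) τ (fun t => (X x t : E3)) (V x) ∧
        MDifferentiableAt (𝓡 2) 𝓘(ℝ, ℝ) q₀ x ∧ V x 0 = sgrad q₀ x) →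
      0 < T → IsCostConcave (fun x => -(T * q₀ x)) →
      IsWassersteinGeodesic (min T τ) (fun t => ρ₀.map (fun x => X x t))) := by
  refine ⟨?_, ?_, fun Θ hΘ => transport_cost_lower_bound hΘ, ?_, ?_, ?_, ?_⟩
  · intro g X V hs hX hV0
    exact ⟨exists_isArclengthParam hτ.le hs hV0,
      fun γ γ₁ γ₂ hγ t ht s hst => frenet_frame hτ hs hX hV0 hγ ht hst⟩
  · intro Θ _ X V hs _ hX0 hV0
    exact unit_speed_equivalences hτ hs hX0 hV0
  · intro Θ hΘ U X v hU hX hpos hvel hfield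
    have hf : IsEulerianFlow Θ τ U X v :=
      ⟨hτ, hΘ, hU, fun x hx => (hX x hx).1, fun x hx => (hX x hx).2, hpos, hvel, hfield⟩
    exact ⟨fun t ht x hx a b ha hb => hf.vorticity_transport hx ht ha hb,
      fun c hc hcU hcl t ht => hf.circulation_invariant ht hc hcU hcl,
      fun q₀ hq t ht => ⟨fun x hx => ⟨hf.normalVorticity_eq_zero hq hx ht, hf.scurl_eq hq hx ht,
        hf.frame_scurl_mem hq hx ht⟩, hf.exists_potential hq ht⟩⟩
  · intro g ρ₀ X V C _ hm hX
    exact ⟨fun t ht => Measure.isProbabilityMeasure_map (hm t ht),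
      absolutelyContinuous_map hτ hm (hX.mono fun x hx => ⟨hx.2.1.position, hx.2.2⟩)⟩
  · intro X V hs
    exact ⟨fun t ht => greatCircle_eq hs ht,
      fun s hsm t ht hst => sdist_greatCircle hτ hs hsm ht hst⟩
  · intro ρ₀ X V q₀ T _ hm hX hT hconc
    exact isWassersteinGeodesic_greatCircle hτ hm hX hT hconc
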